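/- **Weights and blocks.** A number line is a horizontal line whose vertices are indexed by a (possibly infinite) set $J$ of consecutive integers. A weight is a labelling of the vertices by $\circ,\times,\vee,\wedge$ such that, outside some finite set of vertices, no two vertices are labelled $\vee\,\wedge$ in that order from left to right. A block is an equivalence class of weights, where $\lambda\sim\mu$ if $\mu$ is obtained from $\lambda$ by finitely many swaps of a $\vee$ with a $\wedge$. **Diagrams.** The cup diagram $\underline\lambda$ is obtained by repeatedly joining by a cup two vertices labelled $\vee\,\wedge$ (in that order) with only $\circ$'s, $\times$'s and already joined vertices in between, and then drawing rays down to infinity at the remaining $\vee$'s and $\wedge$'s; $\overline\lambda$ is its mirror image, a cap diagram. Write $\alpha\subset\lambda$ if $\alpha\sim\lambda$ and $\underline\alpha\lambda$ is oriented: free vertices of $\underline\alpha$ are labelled $\circ$ or $\times$ in $\lambda$, the ends of each cup are labelled by one $\vee$ and one $\wedge$, rays are labelled $\vee$ or $\wedge$, and no two rays are labelled $\vee\,\wedge$ from left to right. For $\alpha\subset\lambda\supset\beta$ this gives an oriented circle diagram $\underline\alpha\lambda\overline\beta$; its degree is the number of cups and caps whose left end is labelled $\wedge$ (the clockwise ones).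 **The algebra $K_\Lambda$.** Let $\Lambda$ be a finite block. $K_\Lambda$ is the graded complex vector space with basis $(\underline\alpha\lambda\overline\beta)$, for $\alpha,\lambda,\beta\in\Lambda$ with $\alpha\subset\lambda\supset\beta$. The product $(\underline\alpha\lambda\overline\beta)(\underline\gamma\mu\overline\delta)$ is $0$ if $\beta\ne\gamma$. If $\beta=\gamma$, it is computed as follows. 1. If $J$ is infinite, restrict all weights to a bounded interval of vertices off which all weights in $\Lambda$ agree and have no labels $\vee\,\wedge$ in that order (such an interval exists, and the product does not depend on it). If $J$ is finite, keep all vertices. Let $p$ and $q$ be the numbers of $\wedge$'s and $\vee$'s in the restricted weights. 2. Close each weight by adding $p$ vertices labelled $\vee$ at the left end and $q$ vertices labelled $\wedge$ at the right end. Replacing $\alpha,\lambda,\beta,\mu,\delta$ by their closures yields closed diagrams, made of circles only. 3. Draw the first closed diagram under the second and iterate Khovanov's surgery procedure: cut a symmetric cap–cup pair of the middle section that can be connected without crossings, replace it by two vertical segments, and re-orient the circles involved by the rules $1\otimes1\mapsto1$, $1\otimes x\mapsto x$, $x\otimes1\mapsto x$, $x\otimes x\mapsto0$ when two circles merge, and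 $1\mapsto1\otimes x+x\otimes1$, $x\mapsto x\otimes x$ when one circle splits. Here $1$ stands for an anti-clockwise circle (leftmost vertex labelled $\vee$) and $x$ for a clockwise one. The result does not depend on the order of the surgeries. 4. When no cap–cup pair is left, identify the two number lines. The product is the sum of the resulting diagrams, where those whose weight is not the closure of a weight in $\Lambda$ are dropped, and the others are replaced by the basis vectors $(\underline\alpha\nu\overline\delta)$ of which they are the closures. **Statement.** For every finite block $\Lambda$, this product makes $K_\Lambda$ an associative unital $\mathbb C$-algebra, and $K_\Lambda$ is a positively graded quasi-hereditary algebra in the sense of Cline, Parshall and Scott. That is, $K_\Lambda=\bigoplus_{j\ge0}(K_\Lambda)_j$ is a finite-dimensional graded algebra with $(K_\Lambda)_0$ semisimple, and there is a chain $0=I_0\subset I_1\subset\dots\subset I_t=K_\Lambda$ of homogeneous two-sided ideals such that for each $1\le i\le t$ the ideal $\bar I=I_i/I_{i-1}$ of $\bar K=K_\Lambda/I_{i-1}$ is a heredity ideal, i.e. $\bar I^2=\bar I$, $\bar I\,\mathrm{rad}(\bar K)\,\bar I=0$, and $\bar I$ is projective as a left $\bar K$-module. -/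

import Mathlib

/-! ## Heredity chains and positively graded quasi-hereditary algebras -/

/-- A heredity ideal of a ring `B` (Cline, Parshall, Scott): a two-sided ideal `I` with `I² = I` and
`I · rad(B) · I = 0` which is projective as a left `B`-module. -/
structure IsHeredityIdeal {B : Type*} [Ring B] (I : Ideal B) : Prop where
  isTwoSided : I.IsTwoSided
  mul_self : I * I = I
  mul_jacobson_mul : I * Ring.jacobson B * I = ⊥
  projective : Module.Projective B I

/-- A positively graded quasi-hereditary algebra over a field `k`: a finite-dimensional algebra `A`,
graded by the subspaces `𝒜 0, 𝒜 1, 𝒜 2, …`, with semisimple degree zero component, and with a chain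
`0 = I₀ ⊂ I₁ ⊂ ⋯ ⊂ I_t = A` of homogeneous two-sided ideals such that, for each `i`, the ideal
`I_{i+1} / I_i` of `A / I_i` is a heredity ideal. -/
def IsPositivelyGradedQuasiHereditary (k : Type*) {A : Type*} [Field k] [Ring A] [Algebra k A]
    (𝒜 : ℕ → Submodule k A) : Prop :=
  FiniteDimensional k A ∧
  ∃ _ : GradedAlgebra 𝒜,
    IsSemisimpleRing (𝒜 0) ∧
    ∃ (t : ℕ) (I : Fin (t + 1) → Ideal A) (_ : ∀ i, (I i).IsTwoSided),
      StrictMono I ∧ I 0 = ⊥ ∧ I (Fin.last t) = ⊤ ∧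
      (∀ i, (I i).IsHomogeneous 𝒜) ∧
      ∀ i : Fin t,
        IsHeredityIdeal ((I i.succ).map (Ideal.Quotient.mk (I i.castSucc)))

namespace ArcAlgebra

/-! ## Weights and blocks -/

/-- The possible labels of a vertex. -/
inductive Label
  | nought
  | cross
  | down
  | up
  deriving DecidableEq

instance : Fintype Label :=
  ⟨{.nought, .cross, .down, .up}, fun s => by cases s <;> simp⟩

section Weights

variable {V : Type*} [LinearOrder V]

/-- A labelling `w` of the vertices `V` of a number line is a weight if outside of some finite set
of vertices there are no two vertices labelled `down`, `up` in that order from left to right. -/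
def IsWeight (w : V → Label) : Prop :=
  ∃ F : Finset V, ∀ i j, i ∉ F → j ∉ F → i < j → ¬ (w i = .down ∧ w j = .up)

/-- `u` is obtained from `w` by swapping a `down` and an `up`, the `down` moving to the right.
These are the operations that generate the Bruhat order. -/
def SwapStep (w u : V → Label) : Prop :=
  ∃ i j, i < j ∧ w i = .down ∧ w j = .up ∧ u = w ∘ Equiv.swap i j

/-- `w ∼ u`: the labelling `u` is obtained from `w` by permuting `down`s and `up`s, that is, by
finitely many swaps of a `down` with an `up`. -/
def Linked (w u : V → Label) : Prop :=
  Relation.EqvGen SwapStep w u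

/-- A block is a `∼`-equivalence class of weights. -/
def IsBlock (Λ : Set (V → Label)) : Prop :=
  ∃ w, IsWeight w ∧ Λ = {u | Linked w u}

/-! ## The cup diagram of a weight, oriented cup diagrams, degrees -/

/-- `Cup w i j`: the cup diagram of the weight `w` has a cup with left end `i` and right end `j`.
Such a cup is drawn when `i < j` are labelled `down`, `up`, and every vertex strictly between them
that is labelled `down` or `up` has already been joined by a cup to a vertex `partner k` (which
is then strictly between them, too). -/
inductive Cup (w : V → Label) : V → V → Prop
  | join {i j : V} (hij : i < j) (hi : w i = .down) (hj : w j = .up) (partner : V → V)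
      (between : ∀ k, i < k → k < j → i < partner k ∧ partner k < j)
      (joined_down : ∀ k, i < k → k < j → w k = .down → Cup w k (partner k))
      (joined_up : ∀ k, i < k → k < j → w k = .up → Cup w (partner k) k) : Cup w i j

/-- The cup diagram of `w` has a ray at each vertex labelled `down` or `up` that is not on a cup. -/
def Ray (w : V → Label) (i : V) : Prop :=
  (w i = .down ∨ w i = .up) ∧ ∀ j, ¬ Cup w i j ∧ ¬ Cup w j i

/-- The diagram obtained by gluing the cup diagram of `a` under the weight `l` is an oriented cup
diagram. Equivalently, gluing the cap diagram of `a` (its mirror image) on top of `l` gives an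
oriented cap diagram. -/
structure IsOriented (a l : V → Label) : Prop where
  free : ∀ i, a i = .nought ∨ a i = .cross → l i = .nought ∨ l i = .cross
  cup : ∀ i j, Cup a i j → (l i = .down ∧ l j = .up) ∨ (l i = .up ∧ l j = .down)
  ray : ∀ i, Ray a i → l i = .down ∨ l i = .up
  rays : ∀ i j, i < j → Ray a i → Ray a j → ¬ (l i = .down ∧ l j = .up)

/-- The relation `a ⊂ l` on weights. -/
def Sub (a l : V → Label) : Prop :=
  Linked a l ∧ IsOriented a l

/-- The number of clockwise cups (left end labelled `up`) of the oriented cup diagram given by the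
cup diagram of `a` and the weight `l`; also the number of clockwise caps of its mirror image. -/
noncomputable def cupDegree (a l : V → Label) : ℕ :=
  {p : V × V | Cup a p.1 p.2 ∧ l p.1 = .up}.ncard

end Weights

/-! ## Khovanov's algebra: the surgery procedure

In this section `V` is the vertex set of a bounded number line. A diagram with two number lines has
the vertices `V × Bool`, where `(i, false)` is the vertex `i` of the bottom number line and
`(i, true)` the vertex `i` of the top one. Under the bottom line is the cup diagram of the weight
`a`, above the top line the cap diagram of the weight `d`. The middle section has a cap and a cup
(its mirror image) for each pair `(i, j)` in a list `S`, and vertical segments at the other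
vertices. -/

section Surgery

variable {V : Type*} [LinearOrder V]

/-- Two vertices are the ends of a cup or a cap of the diagram. -/
inductive Arc (a d : V → Label) (S : List (V × V)) : V × Bool → V × Bool → Prop
  | bottomCup {i j : V} (h : Cup a i j) : Arc a d S (i, false) (j, false)
  | topCap {i j : V} (h : Cup d i j) : Arc a d S (i, true) (j, true)
  | middleCap {i j : V} (h : (i, j) ∈ S) : Arc a d S (i, false) (j, false)
  | middleCup {i j : V} (h : (i, j) ∈ S) : Arc a d S (i, true) (j, true)

/-- There is a vertical segment at `i` in the middle section. -/
def Vertical (S : List (V × V)) (i : V) : Prop :=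
  ∀ p ∈ S, p.1 ≠ i ∧ p.2 ≠ i

/-- Two vertices are joined by a cup, a cap or a vertical segment. -/
def Adjacent (a d : V → Label) (S : List (V × V)) (u v : V × Bool) : Prop :=
  Arc a d S u v ∨ (Vertical S u.1 ∧ u.1 = v.1 ∧ u.2 = false ∧ v.2 = true)

/-- Two vertices lie on the same circle of the diagram. -/
def SameCircle (a d : V → Label) (S : List (V × V)) (u v : V × Bool) : Prop :=
  Relation.EqvGen (Adjacent a d S) u v

/-- The labels `o` of the vertices are an orientation of the diagram. -/
structure IsOrientation (a d : V → Label) (S : List (V × V)) (o : V × Bool → Label) : Prop where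
  arc : ∀ u v, Arc a d S u v → (o u = .down ∧ o v = .up) ∨ (o u = .up ∧ o v = .down)
  vertical : ∀ i, Vertical S i → o (i, false) = o (i, true)

/-- The type of a circle: `1` is anti-clockwise, `x` is clockwise. -/
inductive CircleType
  | one
  | x
  deriving DecidableEq

open Classical in
/-- The type of the circle through the vertex `u`: anti-clockwise if its leftmost vertex is labelled
`down`, clockwise otherwise. -/
noncomputable def circleType (a d : V → Label) (S : List (V × V)) (o : V × Bool → Label)
    (u : V × Bool) : CircleType :=
  if ∃ v, SameCircle a d S u v ∧ (∀ w, SameCircle a d S u w → v.1 ≤ w.1) ∧ o v = .down then .one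
  else .x

/-- `1 ⊗ 1 ↦ 1`, `1 ⊗ x ↦ x`, `x ⊗ 1 ↦ x`, `x ⊗ x ↦ 0`. -/
def mergeRule : CircleType → CircleType → Option CircleType
  | .one, .one => some .one
  | .one, .x => some .x
  | .x, .one => some .x
  | .x, .x => none

/-- `1 ↦ 1 ⊗ x + x ⊗ 1`, `x ↦ x ⊗ x`. -/
def splitRule : CircleType → List (CircleType × CircleType)
  | .one => [(.one, .x), (.x, .one)]
  | .x => [(.x, .x)]

/-- One iteration of the surgery procedure: the cap and the cup of the first pair `(i, j)` of the
list `(i, j) :: S` are cut and replaced by vertical segments at `i` and `j`, and `o'` is one of the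
orientations of the new diagram produced by the orientation `o` of the old diagram. Circles that do
not contain the cap or the cup keep their orientation. If the cap and the cup were on two different
circles, these merge into the circle through `(i, false)`; if they were on the same circle,
this circle splits into the circles through `(i, false)` and `(j, false)`. -/
def Surgery (a d : V → Label) (i j : V) (S : List (V × V)) (o o' : V × Bool → Label) : Prop :=
  IsOrientation a d S o' ∧
  (∀ v, ¬ SameCircle a d ((i, j) :: S) (i, false) v → ¬ SameCircle a d ((i, j) :: S) (i, true) v →
    o' v = o v) ∧
  (¬ SameCircle a d ((i, j) :: S) (i, false) (i, true) →
    mergeRule (circleType a d ((i, j) :: S) o (i, false)) (circleType a d ((i, j) :: S) o (i, true))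
      = some (circleType a d S o' (i, false))) ∧
  (SameCircle a d ((i, j) :: S) (i, false) (i, true) →
    (circleType a d S o' (i, false), circleType a d S o' (j, false)) ∈
      splitRule (circleType a d ((i, j) :: S) o (i, false)))

open Classical in
/-- The number of times that the orientation `o'` is produced from `o` when the surgery procedure is
iterated for all the pairs in the list, in the order of the list. -/
noncomputable def surgeryCount [Fintype V] (a d : V → Label) :
    List (V × V) → (V × Bool → Label) → (V × Bool → Label) → ℕ
  | [], o, o' => if o = o' then 1 else 0
  | (i, j) :: S, o, o' =>
      ∑ o₁ : V × Bool → Label, if Surgery a d i j S o o₁ then surgeryCount a d S o₁ o' else 0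

open Classical in
/-- The cups of the cup diagram of `b`, in the order of their left ends. In this order, no cup is
nested inside a later one, so at each iteration of the surgery procedure the cap and the cup can be
connected without crossings. -/
noncomputable def cupList [Fintype V] (b : V → Label) : List (V × V) :=
  ((Finset.univ.filter fun p : V ×ₗ V => Cup b (ofLex p).1 (ofLex p).2).sort (· ≤ ·)).map
    fun p => ofLex p

/-- The weights `bot` and `top` on the bottom and the top number line. -/
def stack (bot top : V → Label) : V × Bool → Label :=
  fun v => if v.2 then top v.1 else bot v.1

/-- The coefficient of the closed oriented circle diagram `(a n d)` in the product
`(a l b) (b* m d)` in Khovanov's algebra. Here `a`, `b`, `d` stand for the cup diagrams of the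
weights `a`, `b`, `d` or their mirror images, and `l`, `m`, `n` are weights. -/
noncomputable def khovanovCoeff [Fintype V] (a l b m d n : V → Label) : ℕ :=
  surgeryCount a d (cupList b) (stack l m) (stack n n)

end Surgery

/-! ## Truncation and closure

A number line is an interval `J` of `ℤ`, possibly infinite. -/

section Closure

variable {J : Set ℤ}

/-- The vertices `m, …, n - 1` of the number line `J` carry a truncation of the finite block `Λ`: the
weights in `Λ` are obtained from their restrictions to these vertices by one and the same extension,
and off these vertices no weight has labels `down`, `up` in that order. If the
number line is bounded, all of it is kept. -/
structure IsWindow (Λ : Set (J → Label)) (m n : ℤ) : Prop where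
  subset : Set.Ico m n ⊆ J
  bounded : J.Finite → Set.Ico m n = J
  agree : ∀ w ∈ Λ, ∀ u ∈ Λ, ∀ i : J, (i : ℤ) ∉ Set.Ico m n → w i = u i
  prec : ∀ w ∈ Λ, ∀ i j : J, (i : ℤ) ∉ Set.Ico m n → (j : ℤ) ∉ Set.Ico m n → i < j →
    ¬ (w i = .down ∧ w j = .up)

theorem Linked.finite_ne {V : Type*} [LinearOrder V] {w u : V → Label} (h : Linked w u) :
    {i | w i ≠ u i}.Finite := by
  induction h with
  | rel x y h =>
    obtain ⟨i, j, -, -, -, rfl⟩ := h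
    refine (Set.toFinite {i, j}).subset fun k hk => ?_
    by_contra hne
    simp only [Set.mem_insert_iff, Set.mem_singleton_iff, not_or] at hne
    exact hk (by simp [Equiv.swap_apply_of_ne_of_ne hne.1 hne.2])
  | refl x => simp
  | symm x y _ ih => simpa only [ne_comm] using ih
  | trans x y z _ _ ih1 ih2 =>
    refine (ih1.union ih2).subset fun k hk => ?_
    by_contra hne
    simp only [Set.mem_union, Set.mem_ofPred_eq, not_or, not_not] at hne
    exact hk (hne.1.trans hne.2)

theorem Linked.isWeight {V : Type*} [LinearOrder V] {w u : V → Label} (h : Linked w u)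
    (hw : IsWeight w) : IsWeight u := by
  classical
  obtain ⟨F, hF⟩ := hw
  refine ⟨F ∪ h.finite_ne.toFinset, fun i j hi hj hij => ?_⟩
  simp only [Finset.mem_union, Set.Finite.mem_toFinset, Set.mem_ofPred_eq, not_or, not_not] at hi hj
  rw [← hi.2, ← hj.2]
  exact hF i j hi.1 hj.1 hij

/-- Every finite set of vertices lies in a bounded interval of the number line. -/
theorem exists_Ico (hJ : J.OrdConnected) {F : Set ℤ} (hF : F.Finite) (hFJ : F ⊆ J) :
    ∃ m n : ℤ, F ⊆ Set.Ico m n ∧ Set.Ico m n ⊆ J := by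
  rcases F.eq_empty_or_nonempty with rfl | hne
  · exact ⟨0, 0, by simp, by simp⟩
  · obtain ⟨a, haF, ha⟩ := Set.exists_min_image F id hF hne
    obtain ⟨b, hbF, hb⟩ := Set.exists_max_image F id hF hne
    refine ⟨a, b + 1, fun i hi => ⟨ha i hi, Int.lt_add_one_iff.mpr (hb i hi)⟩, fun i hi => ?_⟩
    exact hJ.out (hFJ haF) (hFJ hbF) ⟨hi.1, Int.lt_add_one_iff.mp hi.2⟩

theorem exists_isWindow (hJ : J.OrdConnected) {Λ : Set (J → Label)} (hΛ : IsBlock Λ)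
    (hfin : Λ.Finite) : ∃ w : ℤ × ℤ, IsWindow Λ w.1 w.2 := by
  classical
  obtain ⟨w₀, hw₀, rfl⟩ := hΛ
  have key : ∃ F : Set J, F.Finite ∧ ∀ u, Linked w₀ u → (∀ i ∉ F, w₀ i = u i) ∧
      ∀ i j, i ∉ F → j ∉ F → i < j → ¬ (u i = .down ∧ u j = .up) := by
    have h1 : ∀ u : J → Label, ∃ F : Set J, F.Finite ∧ (Linked w₀ u → (∀ i ∉ F, w₀ i = u i) ∧
        ∀ i j, i ∉ F → j ∉ F → i < j → ¬ (u i = .down ∧ u j = .up)) := by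
      intro u
      by_cases hu : Linked w₀ u
      · obtain ⟨F, hF⟩ := hu.isWeight hw₀
        refine ⟨{i | w₀ i ≠ u i} ∪ F, hu.finite_ne.union F.finite_toSet, fun _ => ⟨?_, ?_⟩⟩
        · intro i hi
          by_contra hne
          exact hi (Or.inl hne)
        · intro i j hi hj
          exact hF i j (fun h => hi (Or.inr h)) (fun h => hj (Or.inr h))
      · exact ⟨∅, Set.finite_empty, fun h => absurd h hu⟩
    choose F hF hF' using h1
    refine ⟨⋃ u ∈ {u | Linked w₀ u}, F u, hfin.biUnion fun u _ => hF u, fun u hu => ?_⟩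
    have hsub : ∀ i, i ∉ (⋃ u ∈ {u | Linked w₀ u}, F u) → i ∉ F u := fun i hi h =>
      hi (Set.mem_biUnion (show u ∈ {u | Linked w₀ u} from hu) h)
    exact ⟨fun i hi => (hF' u hu).1 i (hsub i hi),
      fun i j hi hj => (hF' u hu).2 i j (hsub i hi) (hsub j hj)⟩
  obtain ⟨F, hF, hF'⟩ := key
  obtain ⟨G, hG, hGJ, hFG, hJG⟩ : ∃ G : Set ℤ, G.Finite ∧ G ⊆ J ∧ (∀ i ∈ F, (i : ℤ) ∈ G) ∧
      (J.Finite → J ⊆ G) := by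
    by_cases hJf : J.Finite
    · exact ⟨J, hJf, subset_rfl, fun i _ => i.2, fun _ => subset_rfl⟩
    · refine ⟨Subtype.val '' F, hF.image _, ?_, fun i hi => ⟨i, hi, rfl⟩, fun h => absurd h hJf⟩
      rintro _ ⟨i, -, rfl⟩
      exact i.2
  obtain ⟨m, n, hmn, hmnJ⟩ := exists_Ico hJ hG hGJ
  have hout : ∀ i : J, (i : ℤ) ∉ Set.Ico m n → i ∉ F := fun i hi h => hi (hmn (hFG i h))
  refine ⟨(m, n), ⟨hmnJ, fun h => subset_antisymm hmnJ ((hJG h).trans hmn), ?_, ?_⟩⟩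
  · intro w hw u hu i hi
    rw [← (hF' w hw).1 i (hout i hi), ← (hF' u hu).1 i (hout i hi)]
  · intro w hw i j hi hj
    exact (hF' w hw).2 i j (hout i hi) (hout j hj)

/-- The number of vertices with the label `s` among the vertices `m, …, n - 1`. -/
noncomputable def count (m n : ℤ) (s : Label) (w : J → Label) : ℕ :=
  {i : J | (i : ℤ) ∈ Set.Ico m n ∧ w i = s}.ncard

open Classical in
/-- Restrict the weight `w` to the vertices `m, …, n - 1`, then add `p` new vertices labelled `down`
to the left end and `q` new vertices labelled `up` to the right end. (The last case does not occur
when `Set.Ico m n ⊆ J`.) -/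
noncomputable def closure (m n : ℤ) (p q : ℕ) (w : J → Label) :
    Set.Ico (m - p) (n + q) → Label := fun i =>
  if (i : ℤ) < m then .down
  else if n ≤ (i : ℤ) then .up
  else if h : (i : ℤ) ∈ J then w ⟨i, h⟩
  else .nought

end Closure

/-! ## The algebra `K_Λ` -/

section KLambda

variable {J : Set ℤ}

/-- The oriented circle diagrams with weight in `Λ`: the weights `a ⊂ l ⊃ b` in `Λ` stand for
the diagram made of the cup diagram of `a`, the weight `l` and the cap diagram of `b`. -/
structure OrientedCircleDiagram (Λ : Set (J → Label)) where
  a : J → Label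
  l : J → Label
  b : J → Label
  a_mem : a ∈ Λ
  l_mem : l ∈ Λ
  b_mem : b ∈ Λ
  a_sub : Sub a l
  b_sub : Sub b l

/-- The degree of an oriented circle diagram: its number of clockwise cups and caps. -/
noncomputable def OrientedCircleDiagram.degree {Λ : Set (J → Label)}
    (x : OrientedCircleDiagram Λ) : ℕ :=
  cupDegree x.a x.l + cupDegree x.b x.l

/-- The complex vector space `K_Λ` with basis the oriented circle diagrams. -/
abbrev KLambda (Λ : Set (J → Label)) : Type :=
  OrientedCircleDiagram Λ →₀ ℂ

/-- The subspace of `K_Λ` spanned by the basis vectors of degree `k`. -/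
def degreePart (Λ : Set (J → Label)) (k : ℕ) : Submodule ℂ (KLambda Λ) :=
  Finsupp.supported ℂ ℂ {x | x.degree = k}

open Classical in
/-- The coefficient of the basis vector `z` in the product `x y` of two basis vectors, computed
with the truncation to the vertices `m, …, n - 1`: close the diagrams, multiply in Khovanov's
algebra, and drop the basis vectors whose weight is not the closure of a weight in `Λ`. Here `p` and
`q` are the numbers of `up`s and `down`s in the truncated weights. -/
noncomputable def mulCoeff {Λ : Set (J → Label)} (m n : ℤ) (x y z : OrientedCircleDiagram Λ) : ℕ :=
  if x.b = y.a ∧ z.a = x.a ∧ z.b = y.b then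
    let p := count m n .up x.l
    let q := count m n .down x.l
    khovanovCoeff (closure m n p q x.a) (closure m n p q x.l) (closure m n p q x.b)
      (closure m n p q y.l) (closure m n p q y.b) (closure m n p q z.l)
  else 0

/-- The product of two elements of `K_Λ`, for a finite block `Λ`. -/
noncomputable def KLambda.mul (hJ : J.OrdConnected) {Λ : Set (J → Label)} (hΛ : IsBlock Λ)
    (hfin : Λ.Finite) (f g : KLambda Λ) : KLambda Λ :=
  let w := (exists_isWindow hJ hΛ hfin).choose
  f.sum fun x r => g.sum fun y s =>
    ∑ᶠ z : OrientedCircleDiagram Λ, Finsupp.single z (r * s * (mulCoeff w.1 w.2 x y z : ℂ))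

end KLambda

end ArcAlgebra

namespace ArcAlgebra

section Cups

variable {V : Type*} [LinearOrder V] {w : V → Label} {i j k l : V}

theorem Cup.lt (h : Cup w i j) : i < j := by cases h; assumption

theorem Cup.down (h : Cup w i j) : w i = .down := by cases h; assumption

theorem Cup.up (h : Cup w i j) : w j = .up := by cases h; assumption

theorem Cup.exists_of_down (h : Cup w i j) (hik : i < k) (hkj : k < j) (hk : w k = .down) :
    ∃ l, Cup w k l ∧ l < j := by
  cases h with
  | join hij hi hj partner between jd ju =>
    exact ⟨_, jd k hik hkj hk, (between k hik hkj).2⟩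

theorem Cup.exists_of_up (h : Cup w i j) (hik : i < k) (hkj : k < j) (hk : w k = .up) :
    ∃ l, Cup w l k ∧ i < l := by
  cases h with
  | join hij hi hj partner between jd ju =>
    exact ⟨_, ju k hik hkj hk, (between k hik hkj).1⟩

theorem Cup.unique (h : Cup w i j) :
    (∀ j', Cup w i j' → j' = j) ∧ ∀ i', Cup w i' j → i' = i := by
  induction h with
  | @join i j hij hi hj partner between jd ju ihd ihu =>
    have h : Cup w i j := .join hij hi hj partner between jd ju
    have hA : ∀ j', Cup w i j' → ¬ j' < j := fun j' h' hlt =>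
      absurd ((ihu j' h'.lt hlt h'.up).2 i h') (between j' h'.lt hlt).1.ne
    have hB : ∀ i', Cup w i' j → ¬ i < i' := fun i' h' hlt =>
      absurd ((ihd i' hlt h'.lt h'.down).1 j h') (between i' hlt h'.lt).2.ne'
    constructor
    · intro j' h'
      rcases lt_trichotomy j' j with hlt | heq | hgt
      · exact absurd hlt (hA j' h')
      · exact heq
      · obtain ⟨l, hl, hil⟩ := h'.exists_of_up hij hgt hj
        exact absurd hil (hB l hl)
    · intro i' h'
      rcases lt_trichotomy i' i with hlt | heq | hgt
      · obtain ⟨l, hl, hlj⟩ := h'.exists_of_down hlt hij hi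
        exact absurd hlj (hA l hl)
      · exact heq
      · exact absurd hgt (hB i' h')

theorem Cup.right_unique (h : Cup w i j) (h' : Cup w i k) : j = k := h'.unique.1 _ h

theorem Cup.left_unique (h : Cup w i k) (h' : Cup w j k) : i = j := h'.unique.2 _ h

theorem Cup.false_of_left_right (h : Cup w i j) (h' : Cup w k i) : False := by
  have := h.down.symm.trans h'.up
  cases this

open Classical in
/-- The vertex joined to `v` by a cup of the cup diagram of `w`, or `v` itself if there is none. -/
noncomputable def mate (w : V → Label) (v : V) : V :=
  if h : ∃ j, Cup w v j ∨ Cup w j v then h.choose else v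

theorem Cup.mate_left (h : Cup w i j) : mate w i = j := by
  have h' : ∃ j, Cup w i j ∨ Cup w j i := ⟨j, Or.inl h⟩
  rw [mate, dif_pos h']
  rcases h'.choose_spec with h1 | h1
  · exact h1.right_unique h
  · exact (h.false_of_left_right h1).elim

theorem Cup.mate_right (h : Cup w i j) : mate w j = i := by
  have h' : ∃ k, Cup w j k ∨ Cup w k j := ⟨i, Or.inr h⟩
  rw [mate, dif_pos h']
  rcases h'.choose_spec with h1 | h1
  · exact (h1.false_of_left_right h).elim
  · exact h1.left_unique h

theorem mate_eq_self (h : ∀ j, ¬ (Cup w i j ∨ Cup w j i)) : mate w i = i := by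
  rw [mate, dif_neg (by simpa using h)]

theorem mate_mate (w : V → Label) (v : V) : mate w (mate w v) = v := by
  by_cases h : ∃ j, Cup w v j ∨ Cup w j v
  · obtain ⟨j, h | h⟩ := h
    · rw [h.mate_left, h.mate_right]
    · rw [h.mate_right, h.mate_left]
  · have : mate w v = v := mate_eq_self (by simpa using h)
    rw [this, this]

/-- The mate of a vertex under a cup lies under that cup. -/
theorem Cup.mate_mem_Ioo (h : Cup w i j) (hk : k ∈ Set.Ioo i j) : mate w k ∈ Set.Ioo i j := by
  by_cases h' : ∃ l, Cup w k l ∨ Cup w l k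
  · obtain ⟨l, h' | h'⟩ := h'
    · obtain ⟨m, hm, hmj⟩ := h.exists_of_down hk.1 hk.2 h'.down
      rw [h'.mate_left, h'.right_unique hm]
      exact ⟨hk.1.trans hm.lt, hmj⟩
    · obtain ⟨m, hm, hmi⟩ := h.exists_of_up hk.1 hk.2 h'.up
      rw [h'.mate_right, h'.left_unique hm]
      exact ⟨hmi, hm.lt.trans hk.2⟩
  · rwa [mate_eq_self (by simpa using h')]

/-- A cup is determined by the labels between its ends. -/
theorem Cup.transfer {W : Type*} [LinearOrder W] {u : W → Label} (h : Cup w i j)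
    (g : V → W) (f : W → V) (hg : StrictMonoOn g (Set.Icc i j))
    (hgf : ∀ k ∈ Set.Icc (g i) (g j), f k ∈ Set.Icc i j ∧ g (f k) = k)
    (hu : ∀ k ∈ Set.Icc i j, u (g k) = w k) : Cup u (g i) (g j) := by
  induction h with
  | @join i j hij hi hj partner between jd ju ihd ihu =>
    have hmi : i ∈ Set.Icc i j := ⟨le_rfl, hij.le⟩
    have hmj : j ∈ Set.Icc i j := ⟨hij.le, le_rfl⟩
    have hlt : ∀ {x y}, x ∈ Set.Icc i j → y ∈ Set.Icc i j → (g x < g y ↔ x < y) :=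
      fun hx hy => hg.lt_iff_lt hx hy
    have hle : ∀ {x y}, x ∈ Set.Icc i j → y ∈ Set.Icc i j → (g x ≤ g y ↔ x ≤ y) :=
      fun hx hy => hg.le_iff_le hx hy
    have key : ∀ k, g i < k → k < g j → ∃ k', g k' = k ∧ f k = k' ∧ i < k' ∧ k' < j := by
      intro k hk1 hk2
      obtain ⟨h1, h2⟩ := hgf k ⟨hk1.le, hk2.le⟩
      refine ⟨f k, h2, rfl, ?_, ?_⟩
      · rwa [← hlt hmi h1, h2]
      · rwa [← hlt h1 hmj, h2]
    have hsub : ∀ {x y}, i < x → x < y → y < j → Set.Icc x y ⊆ Set.Icc i j :=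
      fun h1 _ h2 => Set.Icc_subset_Icc h1.le h2.le
    have hgf' : ∀ {x y}, i < x → x < y → y < j →
        ∀ k ∈ Set.Icc (g x) (g y), f k ∈ Set.Icc x y ∧ g (f k) = k := by
      intro x y h1 h2 h3 k hk
      have hx : x ∈ Set.Icc i j := ⟨h1.le, (h2.trans h3).le⟩
      have hy : y ∈ Set.Icc i j := ⟨(h1.trans h2).le, h3.le⟩
      obtain ⟨h4, h5⟩ := hgf k ⟨((hle hmi hx).2 hx.1).trans hk.1, hk.2.trans ((hle hy hmj).2 hy.2)⟩
      rw [← h5] at hk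
      exact ⟨⟨(hle hx h4).1 hk.1, (hle h4 hy).1 hk.2⟩, h5⟩
    refine .join ((hlt hmi hmj).2 hij) ((hu i hmi).trans hi) ((hu j hmj).trans hj)
      (fun k => g (partner (f k))) ?_ ?_ ?_
    · intro k hk1 hk2
      obtain ⟨k', rfl, hfk, hk3, hk4⟩ := key k hk1 hk2
      obtain ⟨h1, h2⟩ := between k' hk3 hk4
      have hp : partner k' ∈ Set.Icc i j := ⟨h1.le, h2.le⟩
      simp only [hfk]
      exact ⟨(hlt hmi hp).2 h1, (hlt hp hmj).2 h2⟩
    · intro k hk1 hk2 hk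
      obtain ⟨k', rfl, hfk, hk3, hk4⟩ := key k hk1 hk2
      rw [hu k' ⟨hk3.le, hk4.le⟩] at hk
      have hc := jd k' hk3 hk4 hk
      have hs := hsub hk3 hc.lt (between k' hk3 hk4).2
      simp only [hfk]
      exact ihd k' hk3 hk4 hk (hg.mono hs) (hgf' hk3 hc.lt (between k' hk3 hk4).2)
        (fun m hm => hu m (hs hm))
    · intro k hk1 hk2 hk
      obtain ⟨k', rfl, hfk, hk3, hk4⟩ := key k hk1 hk2
      rw [hu k' ⟨hk3.le, hk4.le⟩] at hk
      have hc := ju k' hk3 hk4 hk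
      have hs := hsub (between k' hk3 hk4).1 hc.lt hk4
      simp only [hfk]
      exact ihu k' hk3 hk4 hk (hg.mono hs) (hgf' (between k' hk3 hk4).1 hc.lt hk4)
        (fun m hm => hu m (hs hm))

/-- A `down` and an `up` on its right cannot both be left unjoined. -/
theorem exists_cup_of_down_up [LocallyFiniteOrder V] (hij : i < j) (hi : w i = .down)
    (hj : w j = .up) : (∃ k, Cup w i k) ∨ ∃ k, Cup w k j := by
  induction hn : (Finset.Ioo i j).card using Nat.strong_induction_on generalizing i j with
  | _ n ih =>
    subst hn
    by_contra hcon
    push Not at hcon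
    obtain ⟨h1, h2⟩ := hcon
    have hsub : ∀ {a b}, i ≤ a → b ≤ j → a < b → (i < a ∨ b < j) →
        (Finset.Ioo a b).card < (Finset.Ioo i j).card := by
      intro a b hia hbj hab h
      refine Finset.card_lt_card ⟨Finset.Ioo_subset_Ioo hia hbj, fun hs => ?_⟩
      rcases h with h | h
      · exact lt_irrefl _ (Finset.mem_Ioo.1 (hs (Finset.mem_Ioo.2 ⟨h, hab.trans_le hbj⟩))).1
      · exact lt_irrefl _ (Finset.mem_Ioo.1 (hs (Finset.mem_Ioo.2 ⟨hia.trans_lt hab, h⟩))).2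
    have hd : ∀ k, i < k → k < j → w k = .down → ∃ l, Cup w k l := by
      intro k hik hkj hk
      rcases ih _ (hsub hik.le le_rfl hkj (Or.inl hik)) hkj hk hj rfl with h | ⟨l, h⟩
      · exact h
      · exact absurd h (h2 l)
    have hu : ∀ k, i < k → k < j → w k = .up → ∃ l, Cup w l k := by
      intro k hik hkj hk
      rcases ih _ (hsub le_rfl hkj.le hik (Or.inr hkj)) hik hi hk rfl with ⟨l, h⟩ | h
      · exact absurd h (h1 l)
      · exact h
    refine h1 j (.join hij hi hj (mate w) ?_ ?_ ?_)
    · intro k hik hkj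
      by_cases h : ∃ l, Cup w k l ∨ Cup w l k
      · obtain ⟨l, h | h⟩ := h
        · rw [h.mate_left]
          refine ⟨hik.trans h.lt, ?_⟩
          rcases lt_trichotomy l j with hl | rfl | hl
          · exact hl
          · exact absurd h (h2 k)
          · obtain ⟨m, hm, -⟩ := h.exists_of_up hkj hl hj
            exact absurd hm (h2 m)
        · rw [h.mate_right]
          refine ⟨?_, h.lt.trans hkj⟩
          rcases lt_trichotomy i l with hl | rfl | hl
          · exact hl
          · exact absurd h (h1 k)
          · obtain ⟨m, hm, -⟩ := h.exists_of_down hl hik hi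
            exact absurd hm (h1 m)
      · rw [mate_eq_self (by simpa using h)]
        exact ⟨hik, hkj⟩
    · intro k hik hkj hk
      obtain ⟨l, h⟩ := hd k hik hkj hk
      rwa [h.mate_left]
    · intro k hik hkj hk
      obtain ⟨l, h⟩ := hu k hik hkj hk
      rwa [h.mate_right]

end Cups

/-! ### Signs -/

/-- The sign of a label. -/
def Label.sgn : Label → ℤ
  | .down => 1
  | .up => -1
  | _ => 0

theorem Label.sgn_eq_zero {s : Label} : s.sgn = 0 ↔ ¬ (s = .down ∨ s = .up) := by
  cases s <;> simp [Label.sgn]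

theorem Label.sgn_eq_one {s : Label} : s.sgn = 1 ↔ s = .down := by
  cases s <;> simp [Label.sgn]

theorem Label.sgn_injOn {s t : Label} (hs : s = .down ∨ s = .up) (h : s.sgn = t.sgn) : s = t := by
  cases s <;> cases t <;> simp_all [Label.sgn]

theorem Label.opposite_iff {s t : Label} (hs : s = .down ∨ s = .up) :
    ((s = .down ∧ t = .up) ∨ (s = .up ∧ t = .down)) ↔ t.sgn = -s.sgn := by
  cases s <;> cases t <;> simp_all [Label.sgn]

section Parity

variable {V : Type*} [LinearOrder V] {w : V → Label} {i j : V}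

/-- The parity of the number of elements of `C` to the left of `v`. -/
def par (C : Finset V) (v : V) : ℤ :=
  (-1) ^ (C.filter (· < v)).card

theorem par_eq_or (C : Finset V) (v : V) : par C v = 1 ∨ par C v = -1 :=
  neg_one_pow_eq_or ℤ _

theorem even_card_of_involutive {α : Type*} (s : Finset α) (f : α → α)
    (hf : ∀ x ∈ s, f x ∈ s) (hff : ∀ x ∈ s, f (f x) = x) (hne : ∀ x ∈ s, f x ≠ x) :
    Even s.card := by
  have h : ∑ _x ∈ s, (1 : ZMod 2) = 0 :=
    Finset.sum_involution (fun x _ => f x) (fun _ _ => by decide) (fun x hx _ => hne x hx)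
      hf hff
  rw [Finset.sum_const, nsmul_one] at h
  exact (ZMod.natCast_eq_zero_iff_even).1 h

/-- The ends of a cup have opposite parities, with respect to any set of vertices that is a union of
ends of cups. -/
theorem Cup.par_eq {C : Finset V} (h : Cup w i j) (hi : i ∈ C)
    (hC : ∀ v ∈ C, mate w v ∈ C ∧ mate w v ≠ v) : par C j = - par C i := by
  have hsplit : C.filter (· < j) =
      insert i (C.filter (· < i) ∪ C.filter (fun u => i < u ∧ u < j)) := by
    ext u
    simp only [Finset.mem_filter, Finset.mem_insert, Finset.mem_union]
    have := h.lt
    constructor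
    · rintro ⟨hu, huj⟩
      rcases lt_trichotomy u i with h1 | h1 | h1
      · exact Or.inr (Or.inl ⟨hu, h1⟩)
      · exact Or.inl h1
      · exact Or.inr (Or.inr ⟨hu, h1, huj⟩)
    · rintro (rfl | ⟨hu, h1⟩ | ⟨hu, -, h1⟩)
      · exact ⟨hi, this⟩
      · exact ⟨hu, h1.trans this⟩
      · exact ⟨hu, h1⟩
  have hdisj : Disjoint (C.filter (· < i)) (C.filter (fun u => i < u ∧ u < j)) :=
    Finset.disjoint_filter.2 fun u _ h1 h2 => lt_asymm h1 h2.1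
  have heven : Even (C.filter (fun u => i < u ∧ u < j)).card := by
    refine even_card_of_involutive _ (mate w) ?_ (fun x _ => mate_mate w x) ?_
    · intro x hx
      rw [Finset.mem_filter] at hx ⊢
      exact ⟨(hC x hx.1).1, h.mate_mem_Ioo hx.2⟩
    · intro x hx
      exact (hC x (Finset.mem_filter.1 hx).1).2
  rw [par, hsplit, Finset.card_insert_of_notMem (by simp), Finset.card_union_of_disjoint hdisj,
    pow_succ, pow_add, heven.neg_one_pow, par]
  ring

end Parity

/-! ### Leftmost representatives of classes -/

section Reps

variable {X L : Type*} [LinearOrder L] (key : X → L) (r : X → X → Prop)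

/-- `u` is the first element of its class. -/
def IsRep (u : X) : Prop := ∀ v, r u v → key u ≤ key v

open Classical in
/-- The first elements of the classes. -/
noncomputable def reps [Fintype X] : Finset X := Finset.univ.filter (IsRep key r)

variable {key r}

theorem mem_reps [Fintype X] {u : X} : u ∈ reps key r ↔ IsRep key r u := by
  simp [reps]

theorem exists_isRep [Finite X] (hr : Equivalence r) (p : X) : ∃ u, r p u ∧ IsRep key r u := by
  obtain ⟨u, hu, hmin⟩ := Set.exists_min_image {v | r p v} key (Set.toFinite _) ⟨p, hr.refl p⟩
  exact ⟨u, hu, fun v hv => hmin v (hr.trans hu hv)⟩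

theorem IsRep.eq (hr : Equivalence r) (hkey : Function.Injective key) {u v : X}
    (hu : IsRep key r u) (hv : IsRep key r v) (h : r u v) : u = v :=
  hkey (le_antisymm (hu v h) (hv u (hr.symm h)))

/-- The change of the first elements when two classes are merged. -/
theorem reps_merge [Fintype X] [DecidableEq X] {r' : X → X → Prop} (hkey : Function.Injective key)
    (hr : Equivalence r) (hr' : Equivalence r') {p q p₀ q₀ p₁ : X} (hpq : ¬ r p q)
    (hrr' : ∀ x y, r' x y ↔ r x y ∨ ((r p x ∨ r q x) ∧ (r p y ∨ r q y)))
    (hp₀ : r p p₀) (hp₀' : IsRep key r p₀) (hq₀ : r q q₀) (hq₀' : IsRep key r q₀)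
    (hp₁ : r' p p₁) (hp₁' : IsRep key r' p₁) :
    ∃ T : Finset X, (∀ u ∈ T, ¬ r' p u) ∧
      reps key r = insert p₀ (insert q₀ T) ∧ p₀ ∉ insert q₀ T ∧ q₀ ∉ T ∧
        reps key r' = insert p₁ T ∧ p₁ ∉ T := by
  classical
  have hpp : ∀ u, r' p u ↔ r p u ∨ r q u := by
    intro u
    rw [hrr']
    constructor
    · rintro (h | ⟨-, h⟩)
      · exact Or.inl h
      · exact h
    · exact fun h => Or.inr ⟨Or.inl (hr.refl p), h⟩
  have hout : ∀ u, ¬ r' p u → ∀ v, r' u v ↔ r u v := by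
    intro u hu v
    rw [hpp] at hu
    rw [hrr']
    exact ⟨fun h => h.resolve_right fun h => hu h.1, Or.inl⟩
  have hrep : ∀ u, ¬ r' p u → (IsRep key r' u ↔ IsRep key r u) := fun u hu =>
    forall_congr' fun v => by rw [hout u hu v]
  have hne : p₀ ≠ q₀ := fun h => hpq (hr.trans hp₀ (h ▸ hr.symm hq₀))
  refine ⟨Finset.univ.filter fun u => IsRep key r u ∧ ¬ r' p u, ?_, ?_, ?_, ?_, ?_, ?_⟩
  · intro u hu
    exact (Finset.mem_filter.1 hu).2.2
  · ext u
    simp only [mem_reps, Finset.mem_insert, Finset.mem_filter, Finset.mem_univ, true_and]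
    constructor
    · intro h
      by_cases hu : r' p u
      · rcases (hpp u).1 hu with hu | hu
        · exact Or.inl (h.eq hr hkey hp₀' (hr.trans (hr.symm hu) hp₀))
        · exact Or.inr (Or.inl (h.eq hr hkey hq₀' (hr.trans (hr.symm hu) hq₀)))
      · exact Or.inr (Or.inr ⟨h, hu⟩)
    · rintro (rfl | rfl | h)
      · exact hp₀'
      · exact hq₀'
      · exact h.1
  · simp [hne, (hpp _).2 (Or.inl hp₀)]
  · simp [(hpp _).2 (Or.inr hq₀)]
  · ext u
    simp only [mem_reps, Finset.mem_insert, Finset.mem_filter, Finset.mem_univ, true_and]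
    constructor
    · intro h
      by_cases hu : r' p u
      · exact Or.inl (h.eq hr' hkey hp₁' (hr'.trans (hr'.symm hu) hp₁))
      · exact Or.inr ⟨(hrep u hu).1 h, hu⟩
    · rintro (rfl | h)
      · exact hp₁'
      · exact (hrep u h.2).2 h.1
  · simp [hp₁]

end Reps

/-! ### Circles made of two matchings -/

section Circles

variable {X : Type*}

open Equiv

/-- Composing with a transposition merges or splits cycles. -/
theorem sameCycle_mul_swap [Finite X] [DecidableEq X] (f : Perm X) {p s : X} (hps : p ≠ s) :
    f.SameCycle p s ↔ ¬ (f * swap p s).SameCycle p s := by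
  set g := f * swap p s with hg
  have hgp : g p = f s := by simp [hg]
  have hgs : g s = f p := by simp [hg]
  have hgo : ∀ x, x ≠ p → x ≠ s → g x = f x := fun x h1 h2 => by
    simp [hg, swap_apply_of_ne_of_ne h1 h2]
  constructor
  · intro h h'
    have hex : ∃ k, (f ^ k) p = s := h.exists_nat_pow_eq
    classical
    let k := Nat.find hex
    have hk : (f ^ k) p = s := Nat.find_spec hex
    have hmin : ∀ t < k, (f ^ t) p ≠ s := fun t ht => Nat.find_min hex ht
    have hnp : ∀ t, 1 ≤ t → t ≤ k → (f ^ t) p ≠ p := by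
      intro t h1 h2 h3
      refine hmin (k - t) (by omega) ?_
      rw [← hk]
      conv_rhs => rw [show k = k - t + t by omega, pow_add, Perm.mul_apply, h3]
    have hmem : ∀ n : ℕ, ∃ t, 1 ≤ t ∧ t ≤ k ∧ (g ^ n) s = (f ^ t) p := by
      intro n
      induction n with
      | zero =>
        refine ⟨k, ?_, le_rfl, by simp [hk]⟩
        by_contra h0
        have : k = 0 := by omega
        rw [this] at hk
        exact hps hk
      | succ n ih =>
        obtain ⟨t, h1, h2, h3⟩ := ih
        rw [pow_succ', Perm.mul_apply, h3]
        rcases h2.lt_or_eq with h2 | h2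
        · exact ⟨t + 1, by omega, h2, by
            rw [hgo _ (hnp t h1 h2.le) (hmin t h2), pow_succ', Perm.mul_apply]⟩
        · exact ⟨1, le_rfl, by omega, by rw [h2, hk, hgs, pow_one]⟩
    obtain ⟨n, hn⟩ := h'.symm.exists_nat_pow_eq
    obtain ⟨t, h1, h2, h3⟩ := hmem n
    exact hnp t h1 h2 (h3 ▸ hn)
  · intro h'
    by_contra h
    have hns : ∀ t : ℕ, (f ^ t) p ≠ s := fun t ht => h ⟨t, by simpa using ht⟩
    have hex : ∃ k, 0 < k ∧ (f ^ k) p = p :=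
      ⟨orderOf f, orderOf_pos f, by simp [pow_orderOf_eq_one]⟩
    classical
    let k := Nat.find hex
    obtain ⟨hk0, hk⟩ : 0 < k ∧ (f ^ k) p = p := Nat.find_spec hex
    have hmin : ∀ t < k, 0 < t → (f ^ t) p ≠ p := fun t ht h0 h1 => Nat.find_min hex ht ⟨h0, h1⟩
    have hpow : ∀ t, t + 1 ≤ k → (g ^ (t + 1)) s = (f ^ (t + 1)) p := by
      intro t
      induction t with
      | zero => intro _; simp [hgs]
      | succ t ih =>
        intro ht
        rw [pow_succ', Perm.mul_apply, ih (by omega),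
          hgo _ (hmin _ (by omega) (by omega)) (hns _), ← Perm.mul_apply, ← pow_succ']
    refine h' (Perm.SameCycle.symm ⟨((k - 1 + 1 : ℕ) : ℤ), ?_⟩)
    rw [zpow_natCast, hpow (k - 1) (by omega), Nat.sub_add_cancel hk0, hk]

/-- Being connected by edges `x — A x` and `x — B x`. -/
def Conn (A B : X → X) : X → X → Prop :=
  Relation.EqvGen fun u v => v = A u ∨ v = B u

theorem Conn.equivalence (A B : X → X) : Equivalence (Conn A B) :=
  Relation.EqvGen.is_equivalence _

theorem conn_left (A B : X → X) (u : X) : Conn A B u (A u) := .rel _ _ (Or.inl rfl)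

theorem conn_right (A B : X → X) (u : X) : Conn A B u (B u) := .rel _ _ (Or.inr rfl)

theorem Conn.le {A B : X → X} {r : X → X → Prop} (hr : Equivalence r) (hA : ∀ u, r u (A u))
    (hB : ∀ u, r u (B u)) {u v : X} (h : Conn A B u v) : r u v := by
  induction h with
  | rel x y h => rcases h with rfl | rfl; exacts [hA x, hB x]
  | refl x => exact hr.refl x
  | symm x y _ ih => exact hr.symm ih
  | trans x y z _ _ ih1 ih2 => exact hr.trans ih1 ih2

variable {A B B' : X → X} {τ : X → Prop}

theorem conn_iff_sameCycle [Finite X] (hA : Function.Involutive A) (hB : Function.Involutive B)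
    (hτA : ∀ x, τ (A x) ↔ ¬ τ x) (hτB : ∀ x, τ (B x) ↔ ¬ τ x) {p s : X} (hps : τ p ↔ τ s) :
    Conn A B p s ↔ (hA.toPerm A * hB.toPerm B).SameCycle p s := by
  set f := hA.toPerm A * hB.toPerm B with hf
  have hfx : ∀ x, f x = A (B x) := fun x => rfl
  constructor
  · intro h
    have hstep : ∀ x y, Conn A B x y → ((f.SameCycle p x ∨ f.SameCycle p (A x)) ↔
        (f.SameCycle p y ∨ f.SameCycle p (A y))) := by
      intro x y hxy
      refine hxy.le (r := fun x y => ((f.SameCycle p x ∨ f.SameCycle p (A x)) ↔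
        (f.SameCycle p y ∨ f.SameCycle p (A y)))) ?_ ?_ ?_
      · exact ⟨fun _ => Iff.rfl, fun h => h.symm, fun h1 h2 => h1.trans h2⟩
      · intro u
        rw [hA u, or_comm]
      · intro u
        have h1 : f.SameCycle p (A (B u)) ↔ f.SameCycle p u := by
          rw [← hfx]; exact Perm.sameCycle_apply_right
        have h2 : f.SameCycle p (A u) ↔ f.SameCycle p (B u) := by
          rw [← Perm.sameCycle_apply_right (f := f) (y := B u), hfx, hB u]
        rw [h1, h2, or_comm]
    rcases (hstep p s h).1 (Or.inl (Perm.SameCycle.refl _ _)) with h1 | h1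
    · exact h1
    · exfalso
      obtain ⟨n, hn⟩ := h1.exists_nat_pow_eq
      have hpow : ∀ n : ℕ, τ ((f ^ n) p) ↔ τ p := by
        intro n
        induction n with
        | zero => rfl
        | succ n ih => rw [pow_succ', Perm.mul_apply, hfx, hτA, hτB, not_not, ih]
      have := hpow n
      rw [hn, hτA] at this
      tauto
  · intro h
    obtain ⟨n, rfl⟩ := h.exists_nat_pow_eq
    clear hps h
    induction n with
    | zero => exact (Conn.equivalence A B).refl _
    | succ n ih =>
      rw [pow_succ', Perm.mul_apply, hfx]
      exact (Conn.equivalence A B).trans ih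
        ((Conn.equivalence A B).trans (conn_right A B _) (conn_left A B _))

theorem sameCycle_congr [Finite X] {f g : Perm X} {Z : X → Prop} (hf : ∀ x, Z x → Z (f x))
    (hfg : ∀ x, Z x → f x = g x) {p s : X} (hp : Z p) : f.SameCycle p s ↔ g.SameCycle p s := by
  have hpow : ∀ n : ℕ, Z ((f ^ n) p) ∧ (f ^ n) p = (g ^ n) p := by
    intro n
    induction n with
    | zero => exact ⟨hp, rfl⟩
    | succ n ih =>
      rw [pow_succ', pow_succ', Perm.mul_apply, Perm.mul_apply]
      exact ⟨hf _ ih.1, by rw [hfg _ ih.1, ih.2]⟩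
  constructor
  · intro h
    obtain ⟨n, hn⟩ := h.exists_nat_pow_eq
    exact ⟨n, by rw [zpow_natCast, ← (hpow n).2, hn]⟩
  · intro h
    obtain ⟨n, hn⟩ := h.exists_nat_pow_eq
    exact ⟨n, by rw [zpow_natCast, (hpow n).2, hn]⟩

/-- The matching `B'` is obtained from `B` by a surgery: the edges `p — B p` and `s — B s` are
replaced by `p — B s` and `s — B p`. -/
structure Reconnects (B B' : X → X) (p s : X) : Prop where
  left : B' p = B s
  right : B' s = B p
  left' : B' (B p) = s
  right' : B' (B s) = p
  off : ∀ x, x ≠ p → x ≠ s → x ≠ B p → x ≠ B s → B' x = B x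

theorem Reconnects.symm {p s : X} (hB : Function.Involutive B) (h : Reconnects B B' p s) :
    Reconnects B' B p s where
  left := h.right.symm
  right := h.left.symm
  left' := by rw [h.left, hB]
  right' := by rw [h.right, hB]
  off x h1 h2 h3 h4 := by
    rw [h.left] at h3
    rw [h.right] at h4
    exact (h.off x h1 h2 h4 h3).symm

/-- A surgery either merges two circles or splits a circle. -/
theorem Reconnects.conn_iff [Finite X] {p s : X} (h : Reconnects B B' p s)
    (hA : Function.Involutive A) (hB : Function.Involutive B) (hB' : Function.Involutive B')
    (hτA : ∀ x, τ (A x) ↔ ¬ τ x) (hτB : ∀ x, τ (B x) ↔ ¬ τ x) (hτB' : ∀ x, τ (B' x) ↔ ¬ τ x)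
    (hps : τ p ↔ τ s) (hne : p ≠ s) : Conn A B p s ↔ ¬ Conn A B' p s := by
  classical
  rw [conn_iff_sameCycle hA hB hτA hτB hps, conn_iff_sameCycle hA hB' hτA hτB' hps,
    sameCycle_mul_swap _ hne, not_iff_not]
  refine (sameCycle_congr (Z := fun x => τ x ↔ τ p) ?_ ?_ Iff.rfl).symm
  · intro x hx
    change τ (A (B' x)) ↔ τ p
    rw [hτA, hτB', not_not, hx]
  · intro x hx
    change A (B' x) = A (B (swap p s x))
    congr 1
    by_cases h1 : x = p
    · rw [h1, swap_apply_left, h.left]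
    by_cases h2 : x = s
    · rw [h2, swap_apply_right, h.right]
    rw [swap_apply_of_ne_of_ne h1 h2]
    refine h.off x h1 h2 ?_ ?_
    · rintro rfl
      rw [hτB] at hx
      tauto
    · rintro rfl
      rw [hτB] at hx
      tauto

/-- The effect of merging two circles on the relation of being connected. -/
theorem Reconnects.conn_merge {p s : X} (h : Reconnects B B' p s) (hB : Function.Involutive B)
    (hps : Conn A B' p s) (x y : X) :
    Conn A B' x y ↔ Conn A B x y ∨
      ((Conn A B p x ∨ Conn A B s x) ∧ (Conn A B p y ∨ Conn A B s y)) := by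
  have hr := Conn.equivalence A B
  have hr' := Conn.equivalence A B'
  have hle : ∀ {x y}, Conn A B x y → Conn A B' x y := by
    intro x y hxy
    refine hxy.le hr' (conn_left A B') fun u => ?_
    by_cases h1 : u = p
    · subst h1
      exact hr'.trans hps (h.right ▸ conn_right A B' s)
    by_cases h2 : u = s
    · subst h2
      exact hr'.trans (hr'.symm hps) (h.left ▸ conn_right A B' p)
    by_cases h3 : u = B p
    · subst h3
      rw [hB]
      have := conn_right A B' (B p)
      rw [h.left'] at this
      exact hr'.trans this (hr'.symm hps)
    by_cases h4 : u = B s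
    · subst h4
      rw [hB]
      have := conn_right A B' (B s)
      rw [h.right'] at this
      exact hr'.trans this hps
    rw [← h.off u h1 h2 h3 h4]
    exact conn_right A B' u
  constructor
  · intro hxy
    refine hxy.le (r := fun x y => Conn A B x y ∨
      ((Conn A B p x ∨ Conn A B s x) ∧ (Conn A B p y ∨ Conn A B s y))) ?_ ?_ ?_
    · refine ⟨fun x => Or.inl (hr.refl x), fun h => ?_, fun h1 h2 => ?_⟩
      · rcases h with h | h
        · exact Or.inl (hr.symm h)
        · exact Or.inr h.symm
      · rcases h1 with h1 | ⟨h1, h1'⟩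
        · rcases h2 with h2 | ⟨h2, h2'⟩
          · exact Or.inl (hr.trans h1 h2)
          · exact Or.inr ⟨h2.imp (fun h => hr.trans h (hr.symm h1))
              (fun h => hr.trans h (hr.symm h1)), h2'⟩
        · rcases h2 with h2 | ⟨h2, h2'⟩
          · exact Or.inr ⟨h1, h1'.imp (fun h => hr.trans h h2) (fun h => hr.trans h h2)⟩
          · exact Or.inr ⟨h1, h2'⟩
    · exact fun u => Or.inl (conn_left A B u)
    · intro u
      have e1 := hr.refl p
      have e2 := hr.refl s
      have e3 := conn_right A B p
      have e4 := conn_right A B s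
      by_cases h1 : u = p
      · subst h1; rw [h.left]; exact Or.inr ⟨Or.inl e1, Or.inr e4⟩
      by_cases h2 : u = s
      · subst h2; rw [h.right]; exact Or.inr ⟨Or.inr e2, Or.inl e3⟩
      by_cases h3 : u = B p
      · subst h3; rw [h.left']; exact Or.inr ⟨Or.inl e3, Or.inr e2⟩
      by_cases h4 : u = B s
      · subst h4; rw [h.right']; exact Or.inr ⟨Or.inr e4, Or.inl e1⟩
      rw [h.off u h1 h2 h3 h4]
      exact Or.inl (conn_right A B u)
  · rintro (hxy | ⟨h1, h2⟩)
    · exact hle hxy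
    · have aux : ∀ z, (Conn A B p z ∨ Conn A B s z) → Conn A B' p z := fun z hz =>
        hz.elim hle fun h => hr'.trans hps (hle h)
      exact hr'.trans (hr'.symm (aux x h1)) (aux y h2)

end Circles

/-! ### Circle diagrams without rays -/

section Diagrams

variable {V : Type*} [LinearOrder V]

/-- The weight `w` is active exactly at the vertices in `N`, it has the labels `f` elsewhere, and its
cup diagram has no rays. -/
structure Compat (N : Finset V) (f w : V → Label) : Prop where
  off : ∀ v ∉ N, w v = f v
  free : ∀ v ∉ N, (f v).sgn = 0
  full : ∀ v ∈ N, ∃ j, Cup w v j ∨ Cup w j v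

variable {N : Finset V} {f a b d w : V → Label} {S : List (V × V)} {i j : V}

theorem Compat.left_mem (hw : Compat N f w) (h : Cup w i j) : i ∈ N := by
  by_contra hi
  have h1 := hw.free i hi
  rw [← hw.off i hi, h.down] at h1
  cases h1

theorem Compat.right_mem (hw : Compat N f w) (h : Cup w i j) : j ∈ N := by
  by_contra hi
  have h1 := hw.free j hi
  rw [← hw.off j hi, h.up] at h1
  cases h1

theorem Compat.mate_mem (hw : Compat N f w) {v : V} (hv : v ∈ N) : mate w v ∈ N ∧ mate w v ≠ v := by
  obtain ⟨j, h | h⟩ := hw.full v hv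
  · rw [h.mate_left]
    exact ⟨hw.right_mem h, h.lt.ne'⟩
  · rw [h.mate_right]
    exact ⟨hw.left_mem h, h.lt.ne⟩

theorem Compat.par_eq (hw : Compat N f w) (h : Cup w i j) : par N j = - par N i :=
  h.par_eq (hw.left_mem h) fun _ hv => hw.mate_mem hv

theorem Compat.par_mate (hw : Compat N f w) {v : V} (hv : v ∈ N) :
    par N (mate w v) = - par N v := by
  obtain ⟨j, h | h⟩ := hw.full v hv
  · rw [h.mate_left, hw.par_eq h]
  · rw [h.mate_right, hw.par_eq h, neg_neg]

/-- The vertex joined to a vertex by a bottom cup or a top cap; the two copies of a free vertex are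
considered as joined. -/
noncomputable def outer (N : Finset V) (a d : V → Label) (u : V × Bool) : V × Bool :=
  if u.1 ∈ N then (mate (if u.2 then d else a) u.1, u.2) else (u.1, !u.2)

open Classical in
/-- The vertex joined to a vertex in the middle section. -/
noncomputable def inner (b : V → Label) (S : List (V × V)) (u : V × Bool) : V × Bool :=
  if Vertical S u.1 then (u.1, !u.2) else (mate b u.1, u.2)

/-- `S` is a list of distinct cups of the cup diagram of `b`. -/
structure CupsOf (b : V → Label) (S : List (V × V)) : Prop where
  cup : ∀ p ∈ S, Cup b p.1 p.2
  nodup : S.Nodup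

theorem CupsOf.tail {p : V × V} (h : CupsOf b (p :: S)) : CupsOf b S :=
  ⟨fun q hq => h.cup q (List.mem_cons_of_mem _ hq), (List.nodup_cons.1 h.nodup).2⟩

theorem CupsOf.head (h : CupsOf b ((i, j) :: S)) : Cup b i j := h.cup (i, j) List.mem_cons_self

theorem CupsOf.vertical_left (h : CupsOf b ((i, j) :: S)) : Vertical S i := by
  rintro ⟨k, l⟩ hp
  have hkl := h.tail.cup _ hp
  refine ⟨?_, ?_⟩
  · rintro rfl
    obtain rfl := hkl.right_unique h.head
    exact (List.nodup_cons.1 h.nodup).1 hp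
  · rintro rfl
    exact h.head.false_of_left_right hkl

theorem CupsOf.vertical_right (h : CupsOf b ((i, j) :: S)) : Vertical S j := by
  rintro ⟨k, l⟩ hp
  have hkl := h.tail.cup _ hp
  refine ⟨?_, ?_⟩
  · rintro rfl
    exact hkl.false_of_left_right h.head
  · rintro rfl
    obtain rfl := hkl.left_unique h.head
    exact (List.nodup_cons.1 h.nodup).1 hp

theorem CupsOf.exists_of_not_vertical (h : CupsOf b S) {v : V} (hv : ¬ Vertical S v) :
    ((v, mate b v) ∈ S ∧ Cup b v (mate b v)) ∨ ((mate b v, v) ∈ S ∧ Cup b (mate b v) v) := by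
  unfold Vertical at hv
  push Not at hv
  obtain ⟨⟨k, l⟩, hp, hv⟩ := hv
  have hkl := h.cup _ hp
  by_cases hk : k = v
  · subst hk
    rw [hkl.mate_left]
    exact Or.inl ⟨hp, hkl⟩
  · have hl : l = v := hv hk
    subst hl
    rw [hkl.mate_right]
    exact Or.inr ⟨hp, hkl⟩

theorem CupsOf.not_vertical_mate (h : CupsOf b S) {v : V} (hv : ¬ Vertical S v) :
    ¬ Vertical S (mate b v) := by
  rcases h.exists_of_not_vertical hv with h1 | h1
  · exact fun h2 => (h2 _ h1.1).2 rfl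
  · exact fun h2 => (h2 _ h1.1).1 rfl

theorem outer_involutive (ha : Compat N f a) (hd : Compat N f d) :
    Function.Involutive (outer N a d) := by
  rintro ⟨v, s⟩
  by_cases hv : v ∈ N
  · have hm : mate (if s then d else a) v ∈ N := by
      cases s
      exacts [(ha.mate_mem hv).1, (hd.mate_mem hv).1]
    simp only [outer, hv, if_true, hm, mate_mate]
  · simp [outer, hv]

theorem inner_involutive (hS : CupsOf b S) : Function.Involutive (inner b S) := by
  rintro ⟨v, s⟩
  by_cases hv : Vertical S v
  · simp [inner, hv]
  · simp [inner, hv, hS.not_vertical_mate hv, mate_mate]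

theorem sameCircle_equivalence (a d : V → Label) (S : List (V × V)) :
    Equivalence (SameCircle a d S) := Relation.EqvGen.is_equivalence _

theorem sameCircle_iff_conn (ha : Compat N f a) (hd : Compat N f d) (hb : Compat N f b)
    (hS : CupsOf b S) {u v : V × Bool} :
    SameCircle a d S u v ↔ Conn (outer N a d) (inner b S) u v := by
  have hr := Conn.equivalence (outer N a d) (inner b S)
  have hs := sameCircle_equivalence a d S
  have hadj : ∀ {u v}, Adjacent a d S u v → SameCircle a d S u v := fun h => .rel _ _ h
  constructor
  · intro h
    induction h with
    | refl x => exact hr.refl x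
    | symm x y _ ih => exact hr.symm ih
    | trans x y z _ _ ih1 ih2 => exact hr.trans ih1 ih2
    | rel x y h =>
      rcases h with h | ⟨h1, h2, h3, h4⟩
      · cases h with
        | @bottomCup i j h =>
          refine Relation.EqvGen.rel _ _ (Or.inl ?_)
          simp [outer, ha.left_mem h, h.mate_left]
        | @topCap i j h =>
          refine Relation.EqvGen.rel _ _ (Or.inl ?_)
          simp [outer, hd.left_mem h, h.mate_left]
        | @middleCap i j h =>
          refine Relation.EqvGen.rel _ _ (Or.inr ?_)
          have : ¬ Vertical S i := fun hv => (hv _ h).1 rfl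
          simp [inner, this, (hS.cup _ h).mate_left]
        | @middleCup i j h =>
          refine Relation.EqvGen.rel _ _ (Or.inr ?_)
          have : ¬ Vertical S i := fun hv => (hv _ h).1 rfl
          simp [inner, this, (hS.cup _ h).mate_left]
      · refine Relation.EqvGen.rel _ _ (Or.inr ?_)
        obtain ⟨v, s⟩ := x
        obtain ⟨v', s'⟩ := y
        simp only at h1 h2 h3 h4
        subst h2 h3 h4
        simp [inner, h1]
  · have hvert : ∀ v s, Vertical S v → SameCircle a d S (v, s) (v, !s) := by
      intro v s hv
      cases s
      · exact hadj (Or.inr ⟨hv, rfl, rfl, rfl⟩)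
      · exact hs.symm (hadj (Or.inr ⟨hv, rfl, rfl, rfl⟩))
    intro h
    refine h.le hs ?_ ?_
    · rintro ⟨v, s⟩
      by_cases hv : v ∈ N
      · cases s
        · simp only [outer, hv, if_true, Bool.false_eq_true, if_false]
          obtain ⟨j, h | h⟩ := ha.full v hv
          · rw [h.mate_left]; exact hadj (Or.inl (.bottomCup h))
          · rw [h.mate_right]; exact hs.symm (hadj (Or.inl (.bottomCup h)))
        · simp only [outer, hv, if_true]
          obtain ⟨j, h | h⟩ := hd.full v hv
          · rw [h.mate_left]; exact hadj (Or.inl (.topCap h))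
          · rw [h.mate_right]; exact hs.symm (hadj (Or.inl (.topCap h)))
      · simp only [outer, hv, if_false]
        refine hvert v s fun p hp => ⟨?_, ?_⟩
        · rintro rfl; exact hv (hb.left_mem (hS.cup p hp))
        · rintro rfl; exact hv (hb.right_mem (hS.cup p hp))
    · rintro ⟨v, s⟩
      by_cases hv : Vertical S v
      · simp only [inner, hv, if_true]
        exact hvert v s hv
      · simp only [inner, hv, if_false]
        rcases hS.exists_of_not_vertical hv with ⟨h, -⟩ | ⟨h, -⟩ <;> cases s
        · exact hadj (Or.inl (.middleCap h))
        · exact hadj (Or.inl (.middleCup h))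
        · exact hs.symm (hadj (Or.inl (.middleCap h)))
        · exact hs.symm (hadj (Or.inl (.middleCup h)))

/-- The sign of a vertex of a diagram with two number lines; adjacent vertices have opposite
signs. -/
def Positive (N : Finset V) (u : V × Bool) : Prop := par N u.1 = if u.2 then -1 else 1

theorem neg_ite_iff {x : ℤ} (hx : x = 1 ∨ x = -1) (s : Bool) :
    (-x = if s then -1 else 1) ↔ ¬ (x = if s then -1 else 1) := by
  rcases hx with rfl | rfl <;> cases s <;> simp

theorem ite_not_iff {x : ℤ} (hx : x = 1 ∨ x = -1) (s : Bool) :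
    (x = if (!s) then -1 else 1) ↔ ¬ (x = if s then -1 else 1) := by
  rcases hx with rfl | rfl <;> cases s <;> simp

theorem positive_outer (ha : Compat N f a) (hd : Compat N f d) (u : V × Bool) :
    Positive N (outer N a d u) ↔ ¬ Positive N u := by
  obtain ⟨v, s⟩ := u
  by_cases hv : v ∈ N
  · have : par N (mate (if s then d else a) v) = - par N v := by
      cases s
      exacts [ha.par_mate hv, hd.par_mate hv]
    simp only [Positive, outer, hv, if_true, this]
    exact neg_ite_iff (par_eq_or _ _) s
  · simp only [Positive, outer, hv, if_false]
    exact ite_not_iff (par_eq_or _ _) s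

theorem positive_inner (hb : Compat N f b) (hS : CupsOf b S) (u : V × Bool) :
    Positive N (inner b S u) ↔ ¬ Positive N u := by
  obtain ⟨v, s⟩ := u
  by_cases hv : Vertical S v
  · simp only [Positive, inner, hv, if_true]
    exact ite_not_iff (par_eq_or _ _) s
  · have : par N (mate b v) = - par N v := by
      rcases hS.exists_of_not_vertical hv with h | h
      · exact hb.par_mate (hb.left_mem h.2)
      · exact hb.par_mate (hb.right_mem h.2)
    simp only [Positive, inner, hv, if_false, this]
    exact neg_ite_iff (par_eq_or _ _) s

theorem CupsOf.reconnects (hS : CupsOf b ((i, j) :: S)) :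
    Reconnects (inner b ((i, j) :: S)) (inner b S) (i, false) (j, true) := by
  have hi := hS.vertical_left
  have hj := hS.vertical_right
  have hi' : ¬ Vertical ((i, j) :: S) i := fun h => (h (i, j) List.mem_cons_self).1 rfl
  have hj' : ¬ Vertical ((i, j) :: S) j := fun h => (h (i, j) List.mem_cons_self).2 rfl
  have hmi := hS.head.mate_left
  have hmj := hS.head.mate_right
  refine ⟨?_, ?_, ?_, ?_, ?_⟩
  · simp [inner, hi, hj', hmj]
  · simp [inner, hj, hi', hmi]
  · simp [inner, hi', hj, hmi]
  · simp [inner, hj', hi, hmj]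
  · rintro ⟨v, s⟩ h1 h2 h3 h4
    simp only [inner, hi', hj', if_false, hmi, hmj] at h3 h4
    have hvi : v ≠ i := by
      rintro rfl
      cases s
      exacts [h1 rfl, h4 rfl]
    have hvj : v ≠ j := by
      rintro rfl
      cases s
      exacts [h3 rfl, h2 rfl]
    have : Vertical ((i, j) :: S) v ↔ Vertical S v := by
      simp only [Vertical, List.mem_cons, forall_eq_or_imp]
      exact ⟨fun h => h.2, fun h => ⟨⟨hvi.symm, hvj.symm⟩, h⟩⟩
    by_cases hv : Vertical S v
    · simp [inner, hv, this.2 hv]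
    · simp [inner, hv, mt this.1 hv]

/-- The data of a diagram with two number lines: the cup diagrams of `a` and `d` at the bottom and at
the top, and the cups in `S` of the cup diagram of `b` in the middle section. -/
structure Diagram (N : Finset V) (f a b d : V → Label) (S : List (V × V)) : Prop where
  bot : Compat N f a
  mid : Compat N f b
  top : Compat N f d
  cups : CupsOf b S

theorem Diagram.tail {p : V × V} (h : Diagram N f a b d (p :: S)) : Diagram N f a b d S :=
  ⟨h.bot, h.mid, h.top, h.cups.tail⟩

theorem Diagram.conn (h : Diagram N f a b d S) {u v : V × Bool} :
    SameCircle a d S u v ↔ Conn (outer N a d) (inner b S) u v :=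
  sameCircle_iff_conn h.bot h.top h.mid h.cups

theorem sameCircle_cap (a d : V → Label) (S : List (V × V)) (i j : V) (s : Bool) :
    SameCircle a d ((i, j) :: S) (i, s) (j, s) := by
  cases s
  · exact .rel _ _ (Or.inl (.middleCap List.mem_cons_self))
  · exact .rel _ _ (Or.inl (.middleCup List.mem_cons_self))

theorem sameCircle_vertical (a d : V → Label) (hi : Vertical S i) :
    SameCircle a d S (i, false) (i, true) :=
  .rel _ _ (Or.inr ⟨hi, rfl, rfl, rfl⟩)

theorem sameCircle_cap_iff {x : V × Bool} :
    SameCircle a d ((i, j) :: S) (j, true) x ↔ SameCircle a d ((i, j) :: S) (i, true) x :=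
  have hr := sameCircle_equivalence a d ((i, j) :: S)
  ⟨fun hx => hr.trans (sameCircle_cap a d S i j true) hx,
    fun hx => hr.trans (hr.symm (sameCircle_cap a d S i j true)) hx⟩

theorem Diagram.vertical_iff (h : Diagram N f a b d ((i, j) :: S)) {x : V × Bool} :
    SameCircle a d S (j, true) x ↔ SameCircle a d S (j, false) x :=
  have hr := sameCircle_equivalence a d S
  have hj := sameCircle_vertical a d h.cups.vertical_right
  ⟨fun hx => hr.trans hj hx, fun hx => hr.trans (hr.symm hj) hx⟩

theorem Diagram.same_iff [Finite V] (h : Diagram N f a b d ((i, j) :: S)) :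
    SameCircle a d ((i, j) :: S) (i, false) (i, true) ↔
      ¬ SameCircle a d S (i, false) (j, false) := by
  have hr := sameCircle_equivalence a d ((i, j) :: S)
  have hr' := sameCircle_equivalence a d S
  have e1 : SameCircle a d ((i, j) :: S) (i, false) (i, true) ↔
      SameCircle a d ((i, j) :: S) (i, false) (j, true) :=
    ⟨fun hx => hr.symm (sameCircle_cap_iff.2 (hr.symm hx)), fun hx => hr.symm (sameCircle_cap_iff.1 (hr.symm hx))⟩
  have e2 : SameCircle a d S (i, false) (j, false) ↔ SameCircle a d S (i, false) (j, true) :=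
    ⟨fun hx => hr'.symm (h.vertical_iff.2 (hr'.symm hx)),
      fun hx => hr'.symm (h.vertical_iff.1 (hr'.symm hx))⟩
  rw [e1, e2, h.conn, h.tail.conn]
  refine h.cups.reconnects.conn_iff (outer_involutive h.bot h.top) (inner_involutive h.cups)
    (inner_involutive h.cups.tail) (positive_outer h.bot h.top) (positive_inner h.mid h.cups)
    (positive_inner h.mid h.cups.tail) ?_ (by simp)
  simp only [Positive, h.mid.par_eq h.cups.head]
  rcases par_eq_or N i with h | h <;> rw [h] <;> simp

theorem Diagram.merge [Finite V] (h : Diagram N f a b d ((i, j) :: S))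
    (hne : ¬ SameCircle a d ((i, j) :: S) (i, false) (i, true)) (x y : V × Bool) :
    SameCircle a d S x y ↔ SameCircle a d ((i, j) :: S) x y ∨
      ((SameCircle a d ((i, j) :: S) (i, false) x ∨ SameCircle a d ((i, j) :: S) (i, true) x) ∧
        (SameCircle a d ((i, j) :: S) (i, false) y ∨
          SameCircle a d ((i, j) :: S) (i, true) y)) := by
  have hr' := sameCircle_equivalence a d S
  rw [h.same_iff, not_not] at hne
  have hne := hr'.symm (h.vertical_iff.2 (hr'.symm hne))
  rw [h.tail.conn] at hne
  have := h.cups.reconnects.conn_merge (inner_involutive h.cups) hne x y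
  simpa only [← h.conn, ← h.tail.conn, sameCircle_cap_iff] using this

theorem Diagram.split [Finite V] (h : Diagram N f a b d ((i, j) :: S))
    (hne : SameCircle a d ((i, j) :: S) (i, false) (i, true)) (x y : V × Bool) :
    SameCircle a d ((i, j) :: S) x y ↔ SameCircle a d S x y ∨
      ((SameCircle a d S (i, false) x ∨ SameCircle a d S (j, false) x) ∧
        (SameCircle a d S (i, false) y ∨ SameCircle a d S (j, false) y)) := by
  have hr := sameCircle_equivalence a d ((i, j) :: S)
  have hne := hr.symm (sameCircle_cap_iff.2 (hr.symm hne))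
  rw [h.conn] at hne
  have := (h.cups.reconnects.symm (inner_involutive h.cups)).conn_merge
    (inner_involutive h.cups.tail) hne x y
  simpa only [← h.conn, ← h.tail.conn, h.vertical_iff] using this

/-! ### Orientations and colours -/

/-- The colour of a vertex in an oriented diagram; it is constant along circles. -/
def colour (N : Finset V) (o : V × Bool → Label) (u : V × Bool) : ℤ :=
  par N u.1 * (o u).sgn

theorem colour_eq_of_sgn {o : V × Bool → Label} {u v : V × Bool} (hp : par N v.1 = - par N u.1)
    (hs : (o v).sgn = - (o u).sgn) : colour N o u = colour N o v := by
  rw [colour, colour, hp, hs, neg_mul_neg]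

theorem opposite_sgn {s t : Label} (h : (s = .down ∧ t = .up) ∨ (s = .up ∧ t = .down)) :
    t.sgn = - s.sgn := by
  rcases h with ⟨rfl, rfl⟩ | ⟨rfl, rfl⟩ <;> rfl

theorem Diagram.arc_par (h : Diagram N f a b d S) {u v : V × Bool} (hu : Arc a d S u v) :
    par N v.1 = - par N u.1 ∧ u.1 ∈ N ∧ v.1 ∈ N := by
  cases hu with
  | bottomCup h' => exact ⟨h.bot.par_eq h', h.bot.left_mem h', h.bot.right_mem h'⟩
  | topCap h' => exact ⟨h.top.par_eq h', h.top.left_mem h', h.top.right_mem h'⟩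
  | middleCap h' =>
    have h' := h.cups.cup _ h'
    exact ⟨h.mid.par_eq h', h.mid.left_mem h', h.mid.right_mem h'⟩
  | middleCup h' =>
    have h' := h.cups.cup _ h'
    exact ⟨h.mid.par_eq h', h.mid.left_mem h', h.mid.right_mem h'⟩

theorem SameCircle.le {r : V × Bool → V × Bool → Prop} (hr : Equivalence r)
    (harc : ∀ u v, Arc a d S u v → r u v) (hvert : ∀ v, Vertical S v → r (v, false) (v, true))
    {u v : V × Bool} (h : SameCircle a d S u v) : r u v := by
  induction h with
  | refl x => exact hr.refl x
  | symm x y _ ih => exact hr.symm ih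
  | trans x y z _ _ ih1 ih2 => exact hr.trans ih1 ih2
  | rel x y h =>
    rcases h with h | ⟨h1, h2, h3, h4⟩
    · exact harc _ _ h
    · obtain ⟨v, s⟩ := x
      obtain ⟨v', s'⟩ := y
      simp only at h1 h2 h3 h4
      subst h2 h3 h4
      exact hvert v h1

theorem eq_equivalence {α β : Type*} (g : α → β) : Equivalence fun x y => g x = g y :=
  ⟨fun _ => rfl, Eq.symm, Eq.trans⟩

theorem Diagram.colour_eq (h : Diagram N f a b d S) {o : V × Bool → Label}
    (ho : IsOrientation a d S o) {u v : V × Bool} (huv : SameCircle a d S u v) :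
    colour N o u = colour N o v := by
  refine huv.le (eq_equivalence _) (fun u v h' => ?_) fun v hv => ?_
  · exact colour_eq_of_sgn (h.arc_par h').1 (opposite_sgn (ho.arc _ _ h'))
  · simp only [colour, ho.vertical v hv]

theorem Diagram.mem_iff (h : Diagram N f a b d S) {u v : V × Bool}
    (huv : SameCircle a d S u v) : u.1 ∈ N ↔ v.1 ∈ N := by
  refine huv.le (r := fun u v => u.1 ∈ N ↔ v.1 ∈ N)
    ⟨fun _ => Iff.rfl, Iff.symm, Iff.trans⟩ (fun u v h' => ?_) fun v hv => Iff.rfl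
  simp [h.arc_par h']

theorem Diagram.active (h : Diagram N f a b d S) {o : V × Bool → Label}
    (ho : IsOrientation a d S o) {u : V × Bool} (hu : u.1 ∈ N) : o u = .down ∨ o u = .up := by
  have key : ∀ {x y : Label}, (x = .down ∧ y = .up) ∨ (x = .up ∧ y = .down) →
    (x = .down ∨ x = .up) ∧ (y = .down ∨ y = .up) := by
    rintro x y (⟨rfl, rfl⟩ | ⟨rfl, rfl⟩) <;> simp
  obtain ⟨v, s⟩ := u
  cases s
  · obtain ⟨j, h' | h'⟩ := h.bot.full v hu
    · exact (key (ho.arc _ _ (.bottomCup h'))).1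
    · exact (key (ho.arc _ _ (.bottomCup h'))).2
  · obtain ⟨j, h' | h'⟩ := h.top.full v hu
    · exact (key (ho.arc _ _ (.topCap h'))).1
    · exact (key (ho.arc _ _ (.topCap h'))).2

/-- An orientation with the prescribed labels at the free vertices. -/
structure Good (N : Finset V) (f a d : V → Label) (S : List (V × V)) (o : V × Bool → Label) :
    Prop where
  ori : IsOrientation a d S o
  off : ∀ u, u.1 ∉ N → o u = f u.1

/-- The diagram with a prescribed set of coloured vertices. -/
def ofColour (N : Finset V) (f : V → Label) (g : V × Bool → ℤ) (u : V × Bool) : Label :=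
  if u.1 ∈ N then (if par N u.1 * g u = 1 then .down else .up) else f u.1

theorem colour_ofColour {g : V × Bool → ℤ} {u : V × Bool} (hu : u.1 ∈ N)
    (hg : g u = 1 ∨ g u = -1) : colour N (ofColour N f g) u = g u := by
  simp only [colour, ofColour, hu, if_true]
  rcases par_eq_or N u.1 with h | h <;> rcases hg with h' | h' <;> simp [h, h', Label.sgn]

theorem ofColour_active {g : V × Bool → ℤ} {u : V × Bool} (hu : u.1 ∈ N) :
    ofColour N f g u = .down ∨ ofColour N f g u = .up := by
  simp only [ofColour, hu, if_true]
  split_ifs <;> simp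

theorem sgn_eq_neg_of_colour {o : V × Bool → Label} {u v : V × Bool} (hp : par N v.1 = - par N u.1)
    (hc : colour N o u = colour N o v) : (o v).sgn = - (o u).sgn := by
  simp only [colour, hp] at hc
  rcases par_eq_or N u.1 with h | h <;> rw [h] at hc <;> linarith

theorem sgn_eq_of_colour {o o' : V × Bool → Label} {u : V × Bool}
    (hc : colour N o u = colour N o' u) : (o u).sgn = (o' u).sgn := by
  simp only [colour] at hc
  rcases par_eq_or N u.1 with h | h <;> rw [h] at hc <;> linarith

theorem colour_eq_or {o : V × Bool → Label} {u : V × Bool} (hu : o u = .down ∨ o u = .up) :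
    colour N o u = 1 ∨ colour N o u = -1 := by
  rcases par_eq_or N u.1 with h | h <;> rcases hu with h' | h' <;>
    simp [colour, h, h', Label.sgn]

theorem Diagram.good_ofColour (h : Diagram N f a b d S) {g : V × Bool → ℤ}
    (hg : ∀ u, u.1 ∈ N → g u = 1 ∨ g u = -1)
    (hgc : ∀ u v, u.1 ∈ N → SameCircle a d S u v → g u = g v) :
    Good N f a d S (ofColour N f g) := by
  refine ⟨⟨fun u v huv => ?_, fun v hv => ?_⟩, fun u hu => by simp [ofColour, hu]⟩
  · obtain ⟨hp, hu, hv⟩ := h.arc_par huv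
    rw [Label.opposite_iff (ofColour_active hu)]
    refine sgn_eq_neg_of_colour hp ?_
    rw [colour_ofColour hu (hg u hu), colour_ofColour hv (hg v hv)]
    exact hgc u v hu (.rel _ _ (Or.inl huv))
  · by_cases hN : v ∈ N
    · simp only [ofColour, hN, if_true]
      rw [hgc (v, false) (v, true) hN (sameCircle_vertical a d hv)]
    · simp [ofColour, hN]

/-- Reorienting some of the circles. -/
theorem Diagram.exists_recolour (h : Diagram N f a b d S) [Finite V] {P : V × Bool → Prop}
    (hP : ∀ u v, SameCircle a d S u v → (P u ↔ P v)) (hPN : ∀ u, P u → u.1 ∈ N)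
    {o : V × Bool → Label} (hoff : ∀ u, u.1 ∉ N → o u = f u.1)
    (hact : ∀ u, u.1 ∈ N → o u = .down ∨ o u = .up)
    (hcol : ∀ u v, ¬ P u → SameCircle a d S u v → colour N o u = colour N o v)
    {t : V × Bool → Label} (ht : ∀ u, t u = .down ∨ t u = .up)
    (htc : ∀ u v, P u → SameCircle a d S u v → t u = t v) :
    ∃ o₁, Good N f a d S o₁ ∧ ∀ o', (IsOrientation a d S o' ∧ (∀ u, ¬ P u → o' u = o u) ∧
      ∀ u, P u → IsRep toLex (SameCircle a d S) u → o' u = t u) ↔ o' = o₁ := by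
  classical
  have hr := sameCircle_equivalence a d S
  have hrep : ∀ u, ∃ u₀, SameCircle a d S u u₀ ∧ IsRep toLex (SameCircle a d S) u₀ :=
    exists_isRep hr
  choose ρ hρ hρ' using hrep
  have hρeq : ∀ {u v}, SameCircle a d S u v → ρ u = ρ v := fun huv =>
    (hρ' _).eq hr toLex.injective (hρ' _)
      (hr.trans (hr.symm (hρ _)) (hr.trans huv (hρ _)))
  let g : V × Bool → ℤ := fun u => if P u then par N (ρ u).1 * (t u).sgn else colour N o u
  have hg : ∀ u, u.1 ∈ N → g u = 1 ∨ g u = -1 := by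
    intro u hu
    by_cases hPu : P u
    · simp only [g, hPu, if_true]
      rcases par_eq_or N (ρ u).1 with h | h <;> rcases ht u with h' | h' <;>
        simp [h, h', Label.sgn]
    · simp only [g, hPu, if_false]
      exact colour_eq_or (hact u hu)
  have hgc : ∀ u v, u.1 ∈ N → SameCircle a d S u v → g u = g v := by
    intro u v _ huv
    by_cases hPu : P u
    · have hPv := (hP u v huv).1 hPu
      simp only [g, hPu, hPv, if_true, hρeq huv, htc u v hPu huv]
    · have hPv := mt (hP u v huv).2 hPu
      simp only [g, hPu, hPv, if_false, hcol u v hPu huv]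
  have hgood := h.good_ofColour hg hgc
  have h1 : ∀ u, ¬ P u → ofColour N f g u = o u := by
    intro u hu
    by_cases huN : u.1 ∈ N
    · refine Label.sgn_injOn (ofColour_active huN) (sgn_eq_of_colour (N := N) ?_)
      rw [colour_ofColour huN (hg u huN)]
      simp only [g, hu, if_false]
    · rw [hgood.off u huN, hoff u huN]
  have h2 : ∀ u, P u → IsRep toLex (SameCircle a d S) u → ofColour N f g u = t u := by
    intro u hu hrepu
    have huN := hPN u hu
    refine Label.sgn_injOn (ofColour_active huN) ?_
    have e : ρ u = u := ((hρ' u).eq hr toLex.injective hrepu (hr.symm (hρ u)))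
    have hgu : g u = par N u.1 * (t u).sgn := by simp only [g, hu, if_true, e]
    have := colour_ofColour (f := f) huN (hg u huN)
    rw [hgu, colour] at this
    rcases par_eq_or N u.1 with h | h <;> rw [h] at this <;> linarith
  refine ⟨ofColour N f g, hgood, fun o' => ⟨?_, ?_⟩⟩
  · rintro ⟨ho', h3, h4⟩
    funext u
    by_cases hu : P u
    · have huN := hPN u hu
      refine (Label.sgn_injOn (ofColour_active huN) (sgn_eq_of_colour (N := N) ?_)).symm
      have hPρ := (hP _ _ (hρ u)).1 hu
      rw [h.colour_eq hgood.ori (hρ u), h.colour_eq ho' (hρ u), colour, colour,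
        h2 _ hPρ (hρ' u), h4 _ hPρ (hρ' u)]
    · rw [h3 u hu, h1 u hu]
  · rintro rfl
    exact ⟨hgood.ori, h1, h2⟩

/-- The type of a circle, read off from the label of its first vertex. -/
def Label.type (s : Label) : CircleType := if s = .down then .one else .x

theorem Diagram.circleType_eq (h : Diagram N f a b d S) {o : V × Bool → Label}
    (ho : Good N f a d S o) {u u₀ : V × Bool} (hu : SameCircle a d S u u₀)
    (hu₀ : IsRep toLex (SameCircle a d S) u₀) : circleType a d S o u = (o u₀).type := by
  have hr := sameCircle_equivalence a d S
  have hle : ∀ {x y : V × Bool}, toLex x ≤ toLex y → x.1 ≤ y.1 := by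
    intro x y hxy
    rcases Prod.Lex.le_iff.1 hxy with h | h
    · exact h.le
    · exact h.1.le
  rw [circleType, Label.type]
  congr 1
  rw [eq_iff_iff]
  constructor
  · rintro ⟨v, hv, hmin, hdown⟩
    have huv : SameCircle a d S u₀ v := hr.trans (hr.symm hu) hv
    have heq : u₀.1 = v.1 := le_antisymm (hle (hu₀ v huv)) (hmin u₀ hu)
    have hc := h.colour_eq ho.ori huv
    rw [colour, colour, heq] at hc
    rw [← Label.sgn_eq_one] at hdown ⊢
    rcases par_eq_or N v.1 with h | h <;> rw [h] at hc <;> linarith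
  · exact fun hdown => ⟨u₀, hu, fun w hw => hle (hu₀ w (hr.trans (hr.symm hu) hw)), hdown⟩

end Diagrams

/-! ### The surgery procedure in the basis of colourings -/

/-- A square root of `2 c`. -/
noncomputable def theta (c : ℤ) : ℂ :=
  if c = -1 then (Real.sqrt 2 : ℂ) * Complex.I else (Real.sqrt 2 : ℂ)

theorem theta_ne_zero (c : ℤ) : theta c ≠ 0 := by
  have : (Real.sqrt 2 : ℂ) ≠ 0 := by
    rw [Complex.ofReal_ne_zero]
    positivity
  unfold theta
  split_ifs
  · exact mul_ne_zero this Complex.I_ne_zero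
  · exact this

theorem theta_sq {c : ℤ} (hc : c = 1 ∨ c = -1) : theta c * theta c = 2 * c := by
  have : (Real.sqrt 2 : ℂ) * (Real.sqrt 2 : ℂ) = 2 := by
    rw [← Complex.ofReal_mul, Real.mul_self_sqrt (by norm_num)]
    norm_num
  rcases hc with rfl | rfl
  · simp [theta, this]
  · simp only [theta, if_true]
    rw [mul_mul_mul_comm, this, Complex.I_mul_I]
    simp

/-- The factor of a circle of colour `c` whose first vertex has the label `s`. -/
noncomputable def phi (s : Label) (c : ℤ) : ℂ :=
  match s with
  | .down => (theta c)⁻¹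
  | .up => c * (theta c)⁻¹
  | _ => 1

theorem phi_down (c : ℤ) : phi .down c = (theta c)⁻¹ := rfl

theorem phi_up (c : ℤ) : phi .up c = c * (theta c)⁻¹ := rfl

section Surgery

variable {V : Type*} [LinearOrder V]

open Classical in
/-- The function on colourings given by an oriented diagram. -/
noncomputable def weightFun [Fintype V] (a d : V → Label) (S : List (V × V))
    (o : V × Bool → Label) (c : V × Bool → ℤ) : ℂ :=
  if ∀ u v, SameCircle a d S u v → c u = c v then
    ∏ u ∈ reps toLex (SameCircle a d S), phi (o u) (c u) else 0

/-- The number of clockwise circles minus the number of anti-clockwise circles. -/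
noncomputable def circleDegree [Fintype V] (a d : V → Label) (S : List (V × V))
    (o : V × Bool → Label) : ℤ :=
  - ∑ u ∈ reps toLex (SameCircle a d S), (o u).sgn

/-- A colouring that is constant on the circles of the diagram obtained by all the surgeries. -/
structure FinalColouring (N : Finset V) (a d : V → Label) (c : V × Bool → ℤ) : Prop where
  mem : ∀ u, u.1 ∈ N → c u = 1 ∨ c u = -1
  bot : ∀ i j, Cup a i j → c (i, false) = c (j, false)
  top : ∀ i j, Cup d i j → c (i, true) = c (j, true)
  line : ∀ v, c (v, false) = c (v, true)

variable {N : Finset V} {f a b d w : V → Label} {S : List (V × V)} {i j : V}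

theorem FinalColouring.const_tail {c : V × Bool → ℤ} (hc : FinalColouring N a d c) {p : V × V}
    (h : ∀ u v, SameCircle a d (p :: S) u v → c u = c v) :
    ∀ u v, SameCircle a d S u v → c u = c v := by
  refine fun u v huv => huv.le (eq_equivalence _) (fun u v h' => ?_) fun v _ => hc.line v
  cases h' with
  | bottomCup h' => exact hc.bot _ _ h'
  | topCap h' => exact hc.top _ _ h'
  | middleCap h' =>
    exact h _ _ (.rel _ _ (Or.inl (.middleCap (List.mem_cons_of_mem _ h'))))
  | middleCup h' =>
    exact h _ _ (.rel _ _ (Or.inl (.middleCup (List.mem_cons_of_mem _ h'))))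

theorem Diagram.surgery_good (h : Diagram N f a b d ((i, j) :: S)) {o o' : V × Bool → Label}
    (ho : Good N f a d ((i, j) :: S) o) (hs : Surgery a d i j S o o') : Good N f a d S o' := by
  refine ⟨hs.1, fun u hu => ?_⟩
  have hi := h.mid.left_mem h.cups.head
  rw [hs.2.1 u, ho.off u hu]
  · exact fun h' => hu ((h.mem_iff h').1 hi)
  · exact fun h' => hu ((h.mem_iff h').1 hi)

/-- The possible results of a surgery that merges two circles. -/
theorem Diagram.surgery_merge [Fintype V] (h : Diagram N f a b d ((i, j) :: S))
    {o : V × Bool → Label} (ho : Good N f a d ((i, j) :: S) o)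
    (hne : ¬ SameCircle a d ((i, j) :: S) (i, false) (i, true)) :
    ∃ (p₀ q₀ p₁ : V × Bool) (T : Finset (V × Bool)) (F : Label → V × Bool → Label),
      (SameCircle a d ((i, j) :: S) (i, false) p₀ ∧ SameCircle a d ((i, j) :: S) (i, true) q₀ ∧
        SameCircle a d S (i, false) p₁) ∧
      (reps toLex (SameCircle a d ((i, j) :: S)) = insert p₀ (insert q₀ T) ∧
        p₀ ∉ insert q₀ T ∧ q₀ ∉ T ∧ reps toLex (SameCircle a d S) = insert p₁ T ∧ p₁ ∉ T) ∧
      (∀ t, t = .down ∨ t = .up → Good N f a d S (F t) ∧ F t p₁ = t ∧ ∀ u ∈ T, F t u = o u) ∧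
      ∀ o', Surgery a d i j S o o' ↔ ∃ t, (t = .down ∨ t = .up) ∧
        mergeRule (o p₀).type (o q₀).type = some t.type ∧ o' = F t := by
  classical
  have hr := sameCircle_equivalence a d ((i, j) :: S)
  have hr' := sameCircle_equivalence a d S
  have hmerge := h.merge hne
  have hi := h.mid.left_mem h.cups.head
  obtain ⟨p₀, hp₀, hp₀'⟩ := exists_isRep (key := toLex) hr (i, false)
  obtain ⟨q₀, hq₀, hq₀'⟩ := exists_isRep (key := toLex) hr (i, true)
  obtain ⟨p₁, hp₁, hp₁'⟩ := exists_isRep (key := toLex) hr' (i, false)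
  obtain ⟨T, hT, hreps⟩ :=
    reps_merge toLex.injective hr hr' hne hmerge hp₀ hp₀' hq₀ hq₀' hp₁ hp₁'
  have hle : ∀ {x y}, SameCircle a d ((i, j) :: S) x y → SameCircle a d S x y :=
    fun hxy => (hmerge _ _).2 (Or.inl hxy)
  have hP : ∀ u, SameCircle a d S (i, false) u ↔ SameCircle a d ((i, j) :: S) (i, false) u ∨
      SameCircle a d ((i, j) :: S) (i, true) u := by
    intro u
    rw [hmerge]
    exact ⟨fun h => h.elim Or.inl And.right, fun h => Or.inr ⟨Or.inl (hr.refl _), h⟩⟩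
  have hcol : ∀ u v, ¬ SameCircle a d S (i, false) u → SameCircle a d S u v →
      colour N o u = colour N o v := by
    intro u v hu huv
    refine h.colour_eq ho.ori (((hmerge u v).1 huv).resolve_right fun h' => hu ?_)
    exact (hP u).2 h'.1
  have hex : ∀ t : Label, ∃ o₁, (t = .down ∨ t = .up) → Good N f a d S o₁ ∧
      ∀ o', (IsOrientation a d S o' ∧ (∀ u, ¬ SameCircle a d S (i, false) u → o' u = o u) ∧
        ∀ u, SameCircle a d S (i, false) u → IsRep toLex (SameCircle a d S) u → o' u = t) ↔
          o' = o₁ := by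
    intro t
    by_cases ht : t = .down ∨ t = .up
    · obtain ⟨o₁, h1⟩ := h.tail.exists_recolour (P := SameCircle a d S (i, false))
        (fun u v huv => ⟨fun h => hr'.trans h huv, fun h => hr'.trans h (hr'.symm huv)⟩)
        (fun u hu => (h.tail.mem_iff hu).1 hi) ho.off (fun u hu => h.active ho.ori hu) hcol
        (t := fun _ => t) (fun _ => ht) (fun _ _ _ _ => rfl)
      exact ⟨o₁, fun _ => h1⟩
    · exact ⟨o, fun h => absurd h ht⟩
  choose F hF using hex
  have hFs : ∀ t, t = .down ∨ t = .up → (IsOrientation a d S (F t) ∧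
      (∀ u, ¬ SameCircle a d S (i, false) u → F t u = o u) ∧
      ∀ u, SameCircle a d S (i, false) u → IsRep toLex (SameCircle a d S) u → F t u = t) :=
    fun t ht => ((hF t ht).2 _).2 rfl
  refine ⟨p₀, q₀, p₁, T, F, ⟨hp₀, hq₀, hp₁⟩, hreps, fun t ht => ⟨(hF t ht).1,
    (hFs t ht).2.2 p₁ hp₁ hp₁', fun u hu => (hFs t ht).2.1 u (hT u hu)⟩, fun o' => ⟨?_, ?_⟩⟩
  · intro hs
    have hgood := h.surgery_good ho hs
    have hp₁N : p₁.1 ∈ N := (h.tail.mem_iff hp₁).1 hi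
    have ht := h.tail.active hgood.ori hp₁N
    refine ⟨o' p₁, ht, ?_, ((hF _ ht).2 o').1 ⟨hs.1, fun u hu => ?_, fun u hu hu' => ?_⟩⟩
    · rw [← h.circleType_eq ho hp₀ hp₀', ← h.circleType_eq ho hq₀ hq₀',
        ← h.tail.circleType_eq hgood hp₁ hp₁']
      exact hs.2.2.1 hne
    · rw [hP, not_or] at hu
      exact hs.2.1 u hu.1 hu.2
    · rw [hu'.eq hr' toLex.injective hp₁' (hr'.trans (hr'.symm hu) hp₁)]
  · rintro ⟨t, ht, htype, rfl⟩
    refine ⟨(hFs t ht).1, fun u h1 h2 => (hFs t ht).2.1 u fun h3 => ?_, fun _ => ?_,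
      fun h' => absurd h' hne⟩
    · exact ((hP u).1 h3).elim h1 h2
    · rw [h.circleType_eq ho hp₀ hp₀', h.circleType_eq ho hq₀ hq₀',
        h.tail.circleType_eq (hF t ht).1 hp₁ hp₁', (hFs t ht).2.2 p₁ hp₁ hp₁', htype]

/-- The possible results of a surgery that splits a circle. -/
theorem Diagram.surgery_split [Fintype V] (h : Diagram N f a b d ((i, j) :: S))
    {o : V × Bool → Label} (ho : Good N f a d ((i, j) :: S) o)
    (hne : SameCircle a d ((i, j) :: S) (i, false) (i, true)) :
    ∃ (p₀ p₁ q₁ : V × Bool) (T : Finset (V × Bool)) (F : Label → Label → V × Bool → Label),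
      (SameCircle a d ((i, j) :: S) (i, false) p₀ ∧ SameCircle a d S (i, false) p₁ ∧
        SameCircle a d S (j, false) q₁) ∧
      (reps toLex (SameCircle a d S) = insert p₁ (insert q₁ T) ∧
        p₁ ∉ insert q₁ T ∧ q₁ ∉ T ∧ reps toLex (SameCircle a d ((i, j) :: S)) = insert p₀ T ∧
        p₀ ∉ T) ∧
      (∀ s t, s = .down ∨ s = .up → t = .down ∨ t = .up →
        Good N f a d S (F s t) ∧ F s t p₁ = s ∧ F s t q₁ = t ∧ ∀ u ∈ T, F s t u = o u) ∧
      ∀ o', Surgery a d i j S o o' ↔ ∃ s t, (s = .down ∨ s = .up) ∧ (t = .down ∨ t = .up) ∧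
        (s.type, t.type) ∈ splitRule (o p₀).type ∧ o' = F s t := by
  classical
  have hr := sameCircle_equivalence a d ((i, j) :: S)
  have hr' := sameCircle_equivalence a d S
  have hsplit := h.split hne
  have hne' : ¬ SameCircle a d S (i, false) (j, false) := h.same_iff.1 hne
  have hi := h.mid.left_mem h.cups.head
  have hj := h.mid.right_mem h.cups.head
  obtain ⟨p₀, hp₀, hp₀'⟩ := exists_isRep (key := toLex) hr (i, false)
  obtain ⟨p₁, hp₁, hp₁'⟩ := exists_isRep (key := toLex) hr' (i, false)
  obtain ⟨q₁, hq₁, hq₁'⟩ := exists_isRep (key := toLex) hr' (j, false)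
  obtain ⟨T, hT, hreps⟩ :=
    reps_merge toLex.injective hr' hr hne' hsplit hp₁ hp₁' hq₁ hq₁' hp₀ hp₀'
  have hle : ∀ {x y}, SameCircle a d S x y → SameCircle a d ((i, j) :: S) x y :=
    fun hxy => (hsplit _ _).2 (Or.inl hxy)
  have hP : ∀ u, SameCircle a d ((i, j) :: S) (i, false) u ↔ SameCircle a d S (i, false) u ∨
      SameCircle a d S (j, false) u := by
    intro u
    rw [hsplit]
    exact ⟨fun h => h.elim Or.inl And.right, fun h => Or.inr ⟨Or.inl (hr'.refl _), h⟩⟩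
  have hex : ∀ s t : Label, ∃ o₁, (s = .down ∨ s = .up) → (t = .down ∨ t = .up) →
      Good N f a d S o₁ ∧ ∀ o', (IsOrientation a d S o' ∧
        (∀ u, ¬ SameCircle a d ((i, j) :: S) (i, false) u → o' u = o u) ∧
        ∀ u, SameCircle a d ((i, j) :: S) (i, false) u → IsRep toLex (SameCircle a d S) u →
          o' u = if SameCircle a d S (i, false) u then s else t) ↔ o' = o₁ := by
    intro s t
    by_cases ht : (s = .down ∨ s = .up) ∧ (t = .down ∨ t = .up)
    · obtain ⟨o₁, h1⟩ := h.tail.exists_recolour (P := SameCircle a d ((i, j) :: S) (i, false))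
        (fun u v huv => ⟨fun h => hr.trans h (hle huv), fun h => hr.trans h (hr.symm (hle huv))⟩)
        (fun u hu => (h.mem_iff hu).1 hi) ho.off (fun u hu => h.active ho.ori hu)
        (fun u v _ huv => h.colour_eq ho.ori (hle huv))
        (t := fun u => if SameCircle a d S (i, false) u then s else t)
        (fun u => by by_cases hu : SameCircle a d S (i, false) u
                     · simpa [hu] using ht.1
                     · simpa [hu] using ht.2)
        (fun u v _ huv => by
          have : SameCircle a d S (i, false) u ↔ SameCircle a d S (i, false) v :=
            ⟨fun h => hr'.trans h huv, fun h => hr'.trans h (hr'.symm huv)⟩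
          simp only [this])
      exact ⟨o₁, fun _ _ => h1⟩
    · exact ⟨o, fun h1 h2 => absurd ⟨h1, h2⟩ ht⟩
  choose F hF using hex
  have hq₁n : ¬ SameCircle a d S (i, false) q₁ := fun h' => hne' (hr'.trans h' (hr'.symm hq₁))
  have hFs : ∀ s t, s = .down ∨ s = .up → t = .down ∨ t = .up → (IsOrientation a d S (F s t) ∧
      (∀ u, ¬ SameCircle a d ((i, j) :: S) (i, false) u → F s t u = o u) ∧
      ∀ u, SameCircle a d ((i, j) :: S) (i, false) u → IsRep toLex (SameCircle a d S) u →
        F s t u = if SameCircle a d S (i, false) u then s else t) :=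
    fun s t hs ht => ((hF s t hs ht).2 _).2 rfl
  have hFp : ∀ s t, s = .down ∨ s = .up → t = .down ∨ t = .up → F s t p₁ = s :=
    fun s t hs ht => by
      rw [(hFs s t hs ht).2.2 p₁ ((hP _).2 (Or.inl hp₁)) hp₁', if_pos hp₁]
  have hFq : ∀ s t, s = .down ∨ s = .up → t = .down ∨ t = .up → F s t q₁ = t :=
    fun s t hs ht => by
      rw [(hFs s t hs ht).2.2 q₁ ((hP _).2 (Or.inr hq₁)) hq₁', if_neg hq₁n]
  refine ⟨p₀, p₁, q₁, T, F, ⟨hp₀, hp₁, hq₁⟩, hreps, fun s t hs ht => ⟨(hF s t hs ht).1,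
    hFp s t hs ht, hFq s t hs ht, fun u hu => (hFs s t hs ht).2.1 u (hT u hu)⟩,
    fun o' => ⟨?_, ?_⟩⟩
  · intro hsur
    have hgood := h.surgery_good ho hsur
    have hs := h.tail.active hgood.ori ((h.tail.mem_iff hp₁).1 hi)
    have ht := h.tail.active hgood.ori ((h.tail.mem_iff hq₁).1 hj)
    refine ⟨o' p₁, o' q₁, hs, ht, ?_,
      ((hF _ _ hs ht).2 o').1 ⟨hsur.1, fun u hu => ?_, fun u hu hu' => ?_⟩⟩
    · rw [← h.circleType_eq ho hp₀ hp₀', ← h.tail.circleType_eq hgood hp₁ hp₁',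
        ← h.tail.circleType_eq hgood hq₁ hq₁']
      exact hsur.2.2.2 hne
    · exact hsur.2.1 u hu fun h' => hu (hr.trans hne h')
    · rcases (hP u).1 hu with h1 | h1
      · rw [if_pos h1, hu'.eq hr' toLex.injective hp₁' (hr'.trans (hr'.symm h1) hp₁)]
      · rw [if_neg fun h2 => hne' (hr'.trans h2 (hr'.symm h1)),
          hu'.eq hr' toLex.injective hq₁' (hr'.trans (hr'.symm h1) hq₁)]
  · rintro ⟨s, t, hs, ht, htype, rfl⟩
    refine ⟨(hFs s t hs ht).1, fun u h1 _ => (hFs s t hs ht).2.1 u h1, fun h' => absurd hne h',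
      fun _ => ?_⟩
    rw [h.circleType_eq ho hp₀ hp₀', h.tail.circleType_eq (hF s t hs ht).1 hp₁ hp₁',
      h.tail.circleType_eq (hF s t hs ht).1 hq₁ hq₁', hFp s t hs ht, hFq s t hs ht]
    exact htype

/-- A surgery raises the degree by one. -/
theorem Diagram.surgery_degree [Fintype V] (h : Diagram N f a b d ((i, j) :: S))
    {o o' : V × Bool → Label} (ho : Good N f a d ((i, j) :: S) o)
    (hs : Surgery a d i j S o o') :
    circleDegree a d S o' = circleDegree a d ((i, j) :: S) o + 1 := by
  classical
  have hi := h.mid.left_mem h.cups.head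
  by_cases hne : SameCircle a d ((i, j) :: S) (i, false) (i, true)
  · obtain ⟨p₀, p₁, q₁, T, F, ⟨hp₀, -, -⟩, ⟨e1, e2, e3, e4, e5⟩, hF, hsur⟩ := h.surgery_split ho hne
    obtain ⟨s, t, hs', ht, hst, rfl⟩ := (hsur o').1 hs
    obtain ⟨-, f1, f2, f3⟩ := hF s t hs' ht
    rw [circleDegree, circleDegree, e1, e4, Finset.sum_insert e2, Finset.sum_insert e3,
      Finset.sum_insert e5, f1, f2, Finset.sum_congr rfl fun u hu => by rw [f3 u hu]]
    have := h.active ho.ori ((h.mem_iff hp₀).1 hi)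
    rcases this with h0 | h0 <;> rcases hs' with rfl | rfl <;> rcases ht with rfl | rfl <;>
      simp [h0, Label.type, splitRule, Label.sgn] at hst ⊢
  · obtain ⟨p₀, q₀, p₁, T, F, ⟨hp₀, hq₀, -⟩, ⟨e1, e2, e3, e4, e5⟩, hF, hsur⟩ := h.surgery_merge ho hne
    obtain ⟨t, ht, hst, rfl⟩ := (hsur o').1 hs
    obtain ⟨-, f1, f3⟩ := hF t ht
    rw [circleDegree, circleDegree, e1, e4, Finset.sum_insert e2, Finset.sum_insert e3,
      Finset.sum_insert e5, f1, Finset.sum_congr rfl fun u hu => by rw [f3 u hu]]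
    have h1 := h.active ho.ori ((h.mem_iff hp₀).1 hi)
    have h2 := h.active ho.ori ((h.mem_iff hq₀).1 hi)
    rcases h1 with h0 | h0 <;> rcases h2 with h1 | h1 <;> rcases ht with rfl | rfl <;>
      simp [h0, h1, Label.type, mergeRule, Label.sgn] at hst ⊢

end Surgery

section Surgery

variable {V : Type*} [LinearOrder V] {N : Finset V} {f a b d w : V → Label} {S : List (V × V)}
  {i j : V}

theorem theta_relations {c : ℤ} (hc : c = 1 ∨ c = -1) :
    ((c : ℂ) * c = 1) ∧ 2 * ((theta c)⁻¹ * (theta c)⁻¹) = c ∧ theta c * (theta c)⁻¹ = 1 := by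
  have h1 : (c : ℂ) * c = 1 := by rcases hc with rfl | rfl <;> norm_num
  have h2 := theta_sq hc
  have h3 := mul_inv_cancel₀ (theta_ne_zero c)
  refine ⟨h1, ?_, h3⟩
  linear_combination (-2 * ((theta c)⁻¹ * (theta c)⁻¹)) * h1 - c * ((theta c)⁻¹ * (theta c)⁻¹) * h2 +
    c * (theta c * (theta c)⁻¹ + 1) * h3

theorem weightFun_eq_zero [Fintype V] {o : V × Bool → Label} {c : V × Bool → ℤ}
    (hK : ¬ ∀ u v, SameCircle a d S u v → c u = c v) : weightFun a d S o c = 0 := by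
  rw [weightFun, if_neg hK]

open Classical in
/-- The effect of a splitting surgery on functions on colourings, up to terms of lower degree. -/
theorem Diagram.surgery_sum_split [Fintype V] (h : Diagram N f a b d ((i, j) :: S))
    {o : V × Bool → Label} (ho : Good N f a d ((i, j) :: S) o)
    (hne : SameCircle a d ((i, j) :: S) (i, false) (i, true)) :
    ∃ (κ : ℂ) (o₂ : V × Bool → Label), (κ ≠ 0 → Good N f a d S o₂ ∧
        circleDegree a d S o₂ < circleDegree a d ((i, j) :: S) o + 1) ∧
      ∀ c, FinalColouring N a d c →
        theta (c (i, false)) * weightFun a d ((i, j) :: S) o c =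
          (∑ o' : V × Bool → Label, if Surgery a d i j S o o' then weightFun a d S o' c else 0) +
            κ * weightFun a d S o₂ c := by
  have hi := h.mid.left_mem h.cups.head
  have hj := h.mid.right_mem h.cups.head
  obtain ⟨p₀, p₁, q₁, T, F, ⟨hp₀, hp₁, hq₁⟩, ⟨e1, e2, e3, e4, e5⟩, hF, hsur⟩ :=
    h.surgery_split ho hne
  have hsplit := h.split hne
  have hD : ∀ {c : V × Bool → ℤ}, (∀ u v, SameCircle a d ((i, j) :: S) u v → c u = c v) →
      weightFun a d ((i, j) :: S) o c =
        phi (o p₀) (c (i, false)) * ∏ u ∈ T, phi (o u) (c u) := by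
    intro c hK
    rw [weightFun, if_pos hK, e4, Finset.prod_insert e5, hK _ _ hp₀]
  have hS : ∀ {c : V × Bool → ℤ} {s t}, (∀ u v, SameCircle a d S u v → c u = c v) →
      s = .down ∨ s = .up → t = .down ∨ t = .up → weightFun a d S (F s t) c =
        phi s (c (i, false)) * (phi t (c (j, false)) * ∏ u ∈ T, phi (o u) (c u)) := by
    intro c s t hK hs ht
    obtain ⟨-, f1, f2, f3⟩ := hF s t hs ht
    rw [weightFun, if_pos hK, e1, Finset.prod_insert e2, Finset.prod_insert e3, f1, f2,
      hK _ _ hp₁, hK _ _ hq₁, Finset.prod_congr rfl fun u hu => by rw [f3 u hu]]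
  have hDK : ∀ {c : V × Bool → ℤ}, FinalColouring N a d c →
      ¬ (∀ u v, SameCircle a d ((i, j) :: S) u v → c u = c v) →
      (∀ u v, SameCircle a d S u v → c u = c v) → c (i, false) = - c (j, false) := by
    intro c hc hK hK'
    have : c (i, false) ≠ c (j, false) := by
      refine fun heq => hK fun u v huv => ?_
      have aux : ∀ x, (SameCircle a d S (i, false) x ∨ SameCircle a d S (j, false) x) →
          c (i, false) = c x := fun x hx =>
        hx.elim (fun h => hK' _ _ h) fun h => heq.trans (hK' _ _ h)
      rcases (hsplit u v).1 huv with h' | ⟨h1, h2⟩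
      · exact hK' u v h'
      · rw [← aux u h1, ← aux v h2]
    rcases hc.mem (i, false) hi with h1 | h1 <;> rcases hc.mem (j, false) hj with h2 | h2 <;>
      rw [h1, h2] at this ⊢ <;> simp at this ⊢
  have hd : (Label.down = .down ∨ Label.down = .up) := Or.inl rfl
  have hu : (Label.up = .down ∨ Label.up = .up) := Or.inr rfl
  rcases h.active ho.ori ((h.mem_iff hp₀).1 hi) with h0 | h0
  · have hne2 : F .down .up ≠ F .up .down := by
      intro heq
      have h1 := (hF _ _ hd hu).2.1
      rw [heq, (hF _ _ hu hd).2.1] at h1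
      cases h1
    have hiff : ∀ o', Surgery a d i j S o o' ↔ o' = F .down .up ∨ o' = F .up .down := by
      intro o'
      rw [hsur, h0]
      constructor
      · rintro ⟨s, t, rfl | rfl, rfl | rfl, hst, rfl⟩ <;>
          simp [Label.type, splitRule] at hst ⊢
      · rintro (rfl | rfl)
        · exact ⟨_, _, hd, hu, by simp [Label.type, splitRule], rfl⟩
        · exact ⟨_, _, hu, hd, by simp [Label.type, splitRule], rfl⟩
    refine ⟨0, o, fun h => absurd rfl h, fun c hc => ?_⟩
    have hsum : (∑ o' : V × Bool → Label,
        if Surgery a d i j S o o' then weightFun a d S o' c else 0) =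
          weightFun a d S (F .down .up) c + weightFun a d S (F .up .down) c := by
      rw [← Finset.sum_filter, ← Finset.sum_pair (f := fun o' => weightFun a d S o' c) hne2]
      refine Finset.sum_congr ?_ fun _ _ => rfl
      ext o'
      simp [hiff]
    rw [hsum, zero_mul, add_zero]
    by_cases hK' : ∀ u v, SameCircle a d S u v → c u = c v
    · rw [hS hK' hd hu, hS hK' hu hd]
      by_cases hK : ∀ u v, SameCircle a d ((i, j) :: S) u v → c u = c v
      · rw [hD hK, h0, ← hK _ _ (sameCircle_cap a d S i j false)]
        obtain ⟨c1, c2, c3⟩ := theta_relations (hc.mem (i, false) hi)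
        simp only [phi_down, phi_up]
        linear_combination (∏ u ∈ T, phi (o u) (c u)) * (c3 - c (i, false) * c2 - c1)
      · rw [weightFun_eq_zero hK, hDK hc hK hK']
        simp only [phi_down, phi_up]
        push_cast
        ring
    · rw [weightFun_eq_zero hK', weightFun_eq_zero hK',
        weightFun_eq_zero fun hK => hK' (hc.const_tail hK)]
      simp
  · have hiff : ∀ o', Surgery a d i j S o o' ↔ o' = F .up .up := by
      intro o'
      rw [hsur, h0]
      constructor
      · rintro ⟨s, t, rfl | rfl, rfl | rfl, hst, rfl⟩ <;>
          simp [Label.type, splitRule] at hst ⊢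
      · rintro rfl
        exact ⟨_, _, hu, hu, by simp [Label.type, splitRule], rfl⟩
    obtain ⟨g1, g2, g3, g4⟩ := hF _ _ hd hd
    refine ⟨1, F .down .down, fun _ => ⟨g1, ?_⟩, fun c hc => ?_⟩
    · rw [circleDegree, circleDegree, e1, e4, Finset.sum_insert e2, Finset.sum_insert e3,
        Finset.sum_insert e5, g2, g3, Finset.sum_congr rfl fun u hu => by rw [g4 u hu], h0]
      simp only [Label.sgn]
      linarith
    have hsum : (∑ o' : V × Bool → Label,
        if Surgery a d i j S o o' then weightFun a d S o' c else 0) =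
          weightFun a d S (F .up .up) c := by
      simp only [hiff, Finset.sum_ite_eq', Finset.mem_univ, if_true]
    rw [hsum, one_mul]
    by_cases hK' : ∀ u v, SameCircle a d S u v → c u = c v
    · rw [hS hK' hu hu, hS hK' hd hd]
      by_cases hK : ∀ u v, SameCircle a d ((i, j) :: S) u v → c u = c v
      · rw [hD hK, h0, ← hK _ _ (sameCircle_cap a d S i j false)]
        obtain ⟨c1, c2, c3⟩ := theta_relations (hc.mem (i, false) hi)
        simp only [phi_down, phi_up]
        linear_combination (∏ u ∈ T, phi (o u) (c u)) * (c (i, false) * c3 -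
          (theta (c (i, false)))⁻¹ * (theta (c (i, false)))⁻¹ * c1 - c2)
      · rw [weightFun_eq_zero hK, hDK hc hK hK']
        obtain ⟨c1, -, -⟩ := theta_relations (hc.mem (j, false) hj)
        simp only [phi_down, phi_up]
        push_cast
        linear_combination (theta (-c (j, false)))⁻¹ * (theta (c (j, false)))⁻¹ *
          (∏ u ∈ T, phi (o u) (c u)) * c1
    · rw [weightFun_eq_zero hK', weightFun_eq_zero hK',
        weightFun_eq_zero fun hK => hK' (hc.const_tail hK)]
      simp

open Classical in
/-- The effect of a merging surgery on functions on colourings, up to terms of lower degree. -/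
theorem Diagram.surgery_sum_merge [Fintype V] (h : Diagram N f a b d ((i, j) :: S))
    {o : V × Bool → Label} (ho : Good N f a d ((i, j) :: S) o)
    (hne : ¬ SameCircle a d ((i, j) :: S) (i, false) (i, true)) :
    ∃ (κ : ℂ) (o₂ : V × Bool → Label), (κ ≠ 0 → Good N f a d S o₂ ∧
        circleDegree a d S o₂ < circleDegree a d ((i, j) :: S) o + 1) ∧
      ∀ c, FinalColouring N a d c →
        theta (c (i, false)) * weightFun a d ((i, j) :: S) o c =
          (∑ o' : V × Bool → Label, if Surgery a d i j S o o' then weightFun a d S o' c else 0) +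
            κ * weightFun a d S o₂ c := by
  have hi := h.mid.left_mem h.cups.head
  obtain ⟨p₀, q₀, p₁, T, F, ⟨hp₀, hq₀, hp₁⟩, ⟨e1, e2, e3, e4, e5⟩, hF, hsur⟩ :=
    h.surgery_merge ho hne
  have hmerge := h.merge hne
  have hKK : ∀ {c : V × Bool → ℤ}, (∀ u v, SameCircle a d S u v → c u = c v) →
      ∀ u v, SameCircle a d ((i, j) :: S) u v → c u = c v :=
    fun hK u v huv => hK u v ((hmerge u v).2 (Or.inl huv))
  have hii : SameCircle a d S (i, false) (i, true) :=
    sameCircle_vertical a d h.cups.vertical_left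
  have hD : ∀ {c : V × Bool → ℤ}, (∀ u v, SameCircle a d S u v → c u = c v) →
      weightFun a d ((i, j) :: S) o c =
        phi (o p₀) (c (i, false)) * (phi (o q₀) (c (i, false)) * ∏ u ∈ T, phi (o u) (c u)) := by
    intro c hK
    rw [weightFun, if_pos (hKK hK), e1, Finset.prod_insert e2, Finset.prod_insert e3,
      ← hKK hK _ _ hp₀, ← hKK hK _ _ hq₀, ← hK _ _ hii]
  have hS : ∀ {c : V × Bool → ℤ} {t}, (∀ u v, SameCircle a d S u v → c u = c v) →
      t = .down ∨ t = .up → weightFun a d S (F t) c =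
        phi t (c (i, false)) * ∏ u ∈ T, phi (o u) (c u) := by
    intro c t hK ht
    obtain ⟨-, f1, f3⟩ := hF t ht
    rw [weightFun, if_pos hK, e4, Finset.prod_insert e5, f1,
      hK _ _ hp₁, Finset.prod_congr rfl fun u hu => by rw [f3 u hu]]
  have hD0 : ∀ {c : V × Bool → ℤ}, FinalColouring N a d c →
      ¬ (∀ u v, SameCircle a d S u v → c u = c v) →
      weightFun a d ((i, j) :: S) o c = 0 := fun hc hK =>
    weightFun_eq_zero fun hK' => hK (hc.const_tail hK')
  have hd : (Label.down = .down ∨ Label.down = .up) := Or.inl rfl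
  have hu : (Label.up = .down ∨ Label.up = .up) := Or.inr rfl
  have hone : ∀ {t}, t = .down ∨ t = .up →
      mergeRule (o p₀).type (o q₀).type = some t.type →
      (∀ c : ℤ, c = 1 ∨ c = -1 → theta c * (phi (o p₀) c * phi (o q₀) c) = phi t c) →
      ∃ (κ : ℂ) (o₂ : V × Bool → Label), (κ ≠ 0 → Good N f a d S o₂ ∧
        circleDegree a d S o₂ < circleDegree a d ((i, j) :: S) o + 1) ∧
      ∀ c, FinalColouring N a d c →
        theta (c (i, false)) * weightFun a d ((i, j) :: S) o c =
          (∑ o' : V × Bool → Label, if Surgery a d i j S o o' then weightFun a d S o' c else 0) +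
            κ * weightFun a d S o₂ c := by
    intro t ht htt hphi
    have hiff : ∀ o', Surgery a d i j S o o' ↔ o' = F t := by
      intro o'
      rw [hsur]
      constructor
      · rintro ⟨t', ht', htt', rfl⟩
        rw [htt] at htt'
        rcases ht with rfl | rfl <;> rcases ht' with rfl | rfl <;> simp [Label.type] at htt' ⊢
      · rintro rfl
        exact ⟨t, ht, htt, rfl⟩
    refine ⟨0, o, fun h => absurd rfl h, fun c hc => ?_⟩
    simp only [hiff, Finset.sum_ite_eq', Finset.mem_univ, if_true, zero_mul, add_zero]
    by_cases hK : ∀ u v, SameCircle a d S u v → c u = c v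
    · rw [hS hK ht, hD hK, ← hphi _ (hc.mem (i, false) hi)]
      ring
    · rw [weightFun_eq_zero hK, hD0 hc hK, mul_zero]
  rcases h.active ho.ori ((h.mem_iff hp₀).1 hi) with h0 | h0 <;>
    rcases h.active ho.ori ((h.mem_iff hq₀).1 hi) with h1 | h1
  · refine hone hd (by simp [h0, h1, Label.type, mergeRule]) fun c hc => ?_
    have := theta_ne_zero c
    simp only [h0, h1, phi_down]
    field_simp
  · refine hone hu (by simp [h0, h1, Label.type, mergeRule]) fun c hc => ?_
    have := theta_ne_zero c
    simp only [h0, h1, phi_down, phi_up]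
    field_simp
  · refine hone hu (by simp [h0, h1, Label.type, mergeRule]) fun c hc => ?_
    have := theta_ne_zero c
    simp only [h0, h1, phi_down, phi_up]
    field_simp
  · have hiff : ∀ o', ¬ Surgery a d i j S o o' := by
      intro o' hs
      obtain ⟨t, -, ht, -⟩ := (hsur o').1 hs
      simp [h0, h1, Label.type, mergeRule] at ht
    obtain ⟨g1, g2, g3⟩ := hF _ hd
    refine ⟨1, F .down, fun _ => ⟨g1, ?_⟩, fun c hc => ?_⟩
    · rw [circleDegree, circleDegree, e1, e4, Finset.sum_insert e2, Finset.sum_insert e3,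
        Finset.sum_insert e5, g2, Finset.sum_congr rfl fun u hu => by rw [g3 u hu], h0, h1]
      simp only [Label.sgn]
      linarith
    simp only [hiff, if_false, Finset.sum_const_zero, zero_add, one_mul]
    by_cases hK : ∀ u v, SameCircle a d S u v → c u = c v
    · rw [hS hK hd, hD hK, h0, h1]
      obtain ⟨c1, c2, c3⟩ := theta_relations (hc.mem (i, false) hi)
      simp only [phi_down, phi_up]
      field_simp
      rw [sq, c1, one_mul]
    · rw [weightFun_eq_zero hK, hD0 hc hK, mul_zero]

open Classical in
/-- The effect of a surgery on functions on colourings, up to terms of lower degree. -/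
theorem Diagram.surgery_sum [Fintype V] (h : Diagram N f a b d ((i, j) :: S))
    {o : V × Bool → Label} (ho : Good N f a d ((i, j) :: S) o) :
    ∃ (κ : ℂ) (o₂ : V × Bool → Label), (κ ≠ 0 → Good N f a d S o₂ ∧
        circleDegree a d S o₂ < circleDegree a d ((i, j) :: S) o + 1) ∧
      ∀ c, FinalColouring N a d c →
        theta (c (i, false)) * weightFun a d ((i, j) :: S) o c =
          (∑ o' : V × Bool → Label, if Surgery a d i j S o o' then weightFun a d S o' c else 0) +
            κ * weightFun a d S o₂ c := by
  by_cases hne : SameCircle a d ((i, j) :: S) (i, false) (i, true)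
  · exact h.surgery_sum_split ho hne
  · exact h.surgery_sum_merge ho hne

theorem Diagram.surgeryCount_good [Fintype V] (h : Diagram N f a b d S)
    {o o' : V × Bool → Label} (ho : Good N f a d S o) (hc : surgeryCount a d S o o' ≠ 0) :
    Good N f a d [] o' ∧ circleDegree a d [] o' = circleDegree a d S o + S.length := by
  classical
  induction S generalizing o with
  | nil =>
    rw [surgeryCount] at hc
    have : o = o' := by
      by_contra h'
      simp [h'] at hc
    subst this
    simpa using ho
  | cons p S ih =>
    obtain ⟨i, j⟩ := p
    rw [surgeryCount] at hc
    obtain ⟨o₁, -, h1⟩ := Finset.exists_ne_zero_of_sum_ne_zero hc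
    have hs : Surgery a d i j S o o₁ := by
      by_contra h'
      simp [h'] at h1
    rw [if_pos hs] at h1
    obtain ⟨h2, h3⟩ := ih h.tail (h.surgery_good ho hs) h1
    refine ⟨h2, ?_⟩
    rw [h3, h.surgery_degree ho hs, List.length_cons]
    push_cast
    ring

/-- The surgery procedure computes products of functions on colourings, up to terms of lower
degree. -/
theorem Diagram.surgeryCount_sum [Fintype V] (h : Diagram N f a b d S)
    {o : V × Bool → Label} (ho : Good N f a d S o) :
    ∃ ρ : (V × Bool → Label) → ℂ, (∀ o', ρ o' ≠ 0 → Good N f a d [] o' ∧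
        circleDegree a d [] o' < circleDegree a d S o + S.length) ∧
      ∀ c, FinalColouring N a d c →
        (S.map fun p => theta (c (p.1, false))).prod * weightFun a d S o c =
          ∑ o', (surgeryCount a d S o o' + ρ o') * weightFun a d [] o' c := by
  classical
  induction S generalizing o with
  | nil =>
    refine ⟨0, fun _ h => absurd rfl h, fun c _ => ?_⟩
    simp only [List.map_nil, List.prod_nil, one_mul, surgeryCount, Pi.zero_apply, add_zero]
    push_cast
    simp
  | cons p S ih =>
    obtain ⟨i, j⟩ := p
    have ih' : ∀ o₁, ∃ ρ : (V × Bool → Label) → ℂ, Good N f a d S o₁ →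
        (∀ o', ρ o' ≠ 0 → Good N f a d [] o' ∧
          circleDegree a d [] o' < circleDegree a d S o₁ + S.length) ∧
        ∀ c, FinalColouring N a d c →
          (S.map fun p => theta (c (p.1, false))).prod * weightFun a d S o₁ c =
            ∑ o', (surgeryCount a d S o₁ o' + ρ o') * weightFun a d [] o' c := by
      intro o₁
      by_cases h1 : Good N f a d S o₁
      · obtain ⟨ρ, hρ⟩ := ih h.tail h1
        exact ⟨ρ, fun _ => hρ⟩
      · exact ⟨0, fun h' => absurd h' h1⟩
    choose ρ hρ using ih'
    obtain ⟨κ, o₂, hκ, hsum⟩ := h.surgery_sum ho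
    refine ⟨fun o' => (∑ o₁, if Surgery a d i j S o o₁ then ρ o₁ o' else 0) +
      κ * (surgeryCount a d S o₂ o' + ρ o₂ o'), fun o' h0 => ?_, fun c hc => ?_⟩
    · by_cases h1 : κ * (surgeryCount a d S o₂ o' + ρ o₂ o') = 0
      · simp only [h1, add_zero] at h0
        obtain ⟨o₁, -, h2⟩ := Finset.exists_ne_zero_of_sum_ne_zero h0
        have hs : Surgery a d i j S o o₁ := by
          by_contra h'
          simp [h'] at h2
        rw [if_pos hs] at h2
        obtain ⟨h3, h4⟩ := (hρ o₁ (h.surgery_good ho hs)).1 o' h2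
        refine ⟨h3, ?_⟩
        rw [h.surgery_degree ho hs] at h4
        rw [List.length_cons]
        push_cast
        linarith
      · obtain ⟨hκ0, h2⟩ := mul_ne_zero_iff.1 h1
        obtain ⟨hg, hdeg⟩ := hκ hκ0
        rw [List.length_cons]
        push_cast
        by_cases h3 : ρ o₂ o' = 0
        · rw [h3, add_zero, Nat.cast_ne_zero] at h2
          obtain ⟨h4, h5⟩ := h.tail.surgeryCount_good hg h2
          exact ⟨h4, by linarith⟩
        · obtain ⟨h4, h5⟩ := (hρ o₂ hg).1 o' h3
          exact ⟨h4, by linarith⟩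
    · rw [List.map_cons, List.prod_cons, mul_comm (theta _), mul_assoc, hsum c hc, mul_add,
        Finset.mul_sum]
      have e1 : ∀ o₁, (S.map fun p => theta (c (p.1, false))).prod *
          (if Surgery a d i j S o o₁ then weightFun a d S o₁ c else 0) =
          ∑ o', (if Surgery a d i j S o o₁ then (surgeryCount a d S o₁ o' + ρ o₁ o' : ℂ) else 0) *
            weightFun a d [] o' c := by
        intro o₁
        by_cases hs : Surgery a d i j S o o₁
        · simp only [hs, if_true]
          exact (hρ o₁ (h.surgery_good ho hs)).2 c hc
        · simp [hs]
      have e2 : (S.map fun p => theta (c (p.1, false))).prod * (κ * weightFun a d S o₂ c) =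
          ∑ o', κ * (surgeryCount a d S o₂ o' + ρ o₂ o') * weightFun a d [] o' c := by
        by_cases hκ0 : κ = 0
        · simp [hκ0]
        · rw [mul_left_comm, (hρ o₂ (hκ hκ0).1).2 c hc, Finset.mul_sum]
          simp only [mul_assoc]
      rw [e2, Finset.sum_congr rfl fun o₁ _ => e1 o₁, Finset.sum_comm, ← Finset.sum_add_distrib]
      refine Finset.sum_congr rfl fun o' _ => ?_
      rw [← Finset.sum_mul, ← add_mul]
      congr 1
      rw [surgeryCount]
      push_cast
      rw [← add_assoc, ← Finset.sum_add_distrib]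
      congr 1
      refine Finset.sum_congr rfl fun o₁ _ => ?_
      split_ifs <;> simp

end Surgery

/-! ### The degree of a circle -/

section ConnOn

variable {V : Type*}

/-- Being connected by edges `x — α x` and `x — β x` with ends in `N`. -/
def ConnOn (N : Finset V) (α β : V → V) : V → V → Prop :=
  Relation.EqvGen fun u v => u ∈ N ∧ (v = α u ∨ v = β u)

theorem ConnOn.equivalence (N : Finset V) (α β : V → V) : Equivalence (ConnOn N α β) :=
  Relation.EqvGen.is_equivalence _

theorem ConnOn.le {N : Finset V} {α β : V → V} {r : V → V → Prop} (hr : Equivalence r)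
    (h : ∀ u ∈ N, r u (α u) ∧ r u (β u)) {u v : V} (huv : ConnOn N α β u v) : r u v := by
  induction huv with
  | rel x y h' =>
    obtain ⟨hx, rfl | rfl⟩ := h'
    exacts [(h x hx).1, (h x hx).2]
  | refl x => exact hr.refl x
  | symm x y _ ih => exact hr.symm ih
  | trans x y z _ _ ih1 ih2 => exact hr.trans ih1 ih2

end ConnOn

section Degree

variable {V : Type*} [LinearOrder V]

/-- `α` is a crossingless matching of the vertices in `N`. -/
structure Crossingless (N : Finset V) (α : V → V) : Prop where
  mem : ∀ v ∈ N, α v ∈ N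
  ne : ∀ v ∈ N, α v ≠ v
  invol : ∀ v ∈ N, α (α v) = v
  inside : ∀ p ∈ N, ∀ u ∈ N, u ≠ p → u ≠ α p →
    ((p < u ↔ α p < u) ↔ (p < α u ↔ α p < α u))

theorem ConnOn.mem {N : Finset V} {α β : V → V} (hα : Crossingless N α) (hβ : Crossingless N β)
    {u v : V} (h : ConnOn N α β u v) : u = v ∨ (u ∈ N ∧ v ∈ N) := by
  refine h.le (r := fun u v => u = v ∨ (u ∈ N ∧ v ∈ N)) ⟨fun _ => Or.inl rfl, ?_, ?_⟩ ?_
  · rintro x y (h | h)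
    exacts [Or.inl h.symm, Or.inr h.symm]
  · rintro x y z (rfl | h1) (rfl | h2)
    exacts [Or.inl rfl, Or.inr h2, Or.inr h1, Or.inr ⟨h1.1, h2.2⟩]
  · exact fun u hu => ⟨Or.inr ⟨hu, hα.mem u hu⟩, Or.inr ⟨hu, hβ.mem u hu⟩⟩

theorem iff_iff_iff_trans {A B C A' B' C' : Prop} (h : (A ↔ C) ↔ (A' ↔ C'))
    (h' : (B ↔ C) ↔ (B' ↔ C')) : (A ↔ B) ↔ (A' ↔ B') := by
  by_cases hC : C <;> by_cases hC' : C' <;> simp only [hC, hC', iff_true, iff_false] at h h' <;>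
    tauto

/-- The matching obtained from `β` by joining `k` and `l`. -/
def rejoin (β : V → V) (k l v : V) : V := if v = k then l else if v = l then k else β v

theorem Crossingless.rejoin {N M : Finset V} {β : V → V} (hβ : Crossingless N β) {i j : V}
    (hi : i ∈ N) (hj : j ∈ N) (hij : i < j) (hM : ∀ v, v ∈ M ↔ v ∈ N ∧ v ≠ i ∧ v ≠ j)
    (hadj : ∀ u ∈ M, i < u ↔ j < u) (hne : β i ≠ j) :
    Crossingless M (rejoin β (β i) (β j)) := by
  set k := β i with hk
  set l := β j with hl
  have hki : β k = i := hβ.invol i hi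
  have hlj : β l = j := hβ.invol j hj
  have hli : l ≠ i := fun h => hne (by rw [hk, ← h, hlj])
  have hkl : k ≠ l := fun h => hij.ne (by rw [← hki, h, hlj])
  have hkM : k ∈ M := (hM k).2 ⟨hβ.mem i hi, hβ.ne i hi, hne⟩
  have hlM : l ∈ M := (hM l).2 ⟨hβ.mem j hj, hli, hβ.ne j hj⟩
  have hN : ∀ {v}, v ∈ M → v ∈ N := fun hv => ((hM _).1 hv).1
  have rk : ArcAlgebra.rejoin β k l k = l := by simp [ArcAlgebra.rejoin]
  have rl : ArcAlgebra.rejoin β k l l = k := by simp [ArcAlgebra.rejoin, hkl.symm]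
  have ro : ∀ {v}, v ≠ k → v ≠ l → ArcAlgebra.rejoin β k l v = β v := fun h1 h2 => by
    simp [ArcAlgebra.rejoin, h1, h2]
  have hout : ∀ {v}, v ∈ M → v ≠ k → v ≠ l → β v ∈ M ∧ β v ≠ k ∧ β v ≠ l := by
    intro v hv h1 h2
    obtain ⟨hvN, hvi, hvj⟩ := (hM v).1 hv
    refine ⟨(hM _).2 ⟨hβ.mem v hvN, fun h => h1 ?_, fun h => h2 ?_⟩, fun h => hvi ?_,
      fun h => hvj ?_⟩
    · rw [hk, ← h, hβ.invol v hvN]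
    · rw [hl, ← h, hβ.invol v hvN]
    · rw [← hki, ← h, hβ.invol v hvN]
    · rw [← hlj, ← h, hβ.invol v hvN]
  have hadj' : ∀ u ∈ M, u < i ↔ u < j := by
    intro u hu
    obtain ⟨-, hui, huj⟩ := (hM u).1 hu
    rw [← not_iff_not, not_lt, not_lt, hui.symm.le_iff_lt, huj.symm.le_iff_lt]
    exact hadj u hu
  have hchord : ∀ u ∈ M, u ≠ k → u ≠ l → ((k < u ↔ l < u) ↔ (k < β u ↔ l < β u)) := by
    intro u hu h1 h2
    obtain ⟨huN, hui, huj⟩ := (hM u).1 hu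
    have e1 := hβ.inside k (hN hkM) u huN h1 (by rwa [hki])
    have e2 := hβ.inside l (hN hlM) u huN h2 (by rwa [hlj])
    rw [hki] at e1
    rw [hlj] at e2
    have e3 := hadj u hu
    have e4 := hadj _ (hout hu h1 h2).1
    rw [e3, e4] at e1
    exact iff_iff_iff_trans e1 e2
  refine ⟨fun v hv => ?_, fun v hv => ?_, fun v hv => ?_, fun p hp u hu hup huq => ?_⟩
  · by_cases h1 : v = k
    · rwa [h1, rk]
    by_cases h2 : v = l
    · rwa [h2, rl]
    rw [ro h1 h2]
    exact (hout hv h1 h2).1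
  · by_cases h1 : v = k
    · rw [h1, rk]; exact hkl.symm
    by_cases h2 : v = l
    · rwa [h2, rl]
    rw [ro h1 h2]
    exact hβ.ne v (hN hv)
  · by_cases h1 : v = k
    · rw [h1, rk, rl]
    by_cases h2 : v = l
    · rw [h2, rl, rk]
    obtain ⟨-, h3, h4⟩ := hout hv h1 h2
    rw [ro h1 h2, ro h3 h4, hβ.invol v (hN hv)]
  · by_cases p1 : p = k
    · subst p1
      rw [rk] at huq ⊢
      rw [ro hup huq]
      exact hchord u hu hup huq
    by_cases p2 : p = l
    · subst p2
      rw [rl] at huq ⊢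
      rw [ro huq hup]
      have := hchord u hu huq hup
      rwa [iff_comm (a := k < u), iff_comm (a := k < β u)] at this
    obtain ⟨pM, pk, pl⟩ := hout hp p1 p2
    rw [ro p1 p2] at huq ⊢
    obtain ⟨hpN, hpi, hpj⟩ := (hM p).1 hp
    obtain ⟨-, hpi', hpj'⟩ := (hM _).1 pM
    have e1 := hβ.inside p hpN k (hN hkM) (Ne.symm p1) (Ne.symm pk)
    have e2 := hβ.inside p hpN l (hN hlM) (Ne.symm p2) (Ne.symm pl)
    rw [hki] at e1
    rw [hlj] at e2
    have e3 := hadj' p hp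
    have e4 := hadj' _ pM
    by_cases u1 : u = k
    · subst u1
      rw [rk, e1, e3, e4, ← e2]
    by_cases u2 : u = l
    · subst u2
      rw [rl, e2, ← e3, ← e4, ← e1]
    rw [ro u1 u2]
    exact hβ.inside p hpN u (hN hu) hup huq

open Classical in
/-- The labels of the left ends of the arcs of a system of crossingless circles, added up, give twice
the sum of the labels of the leftmost vertices of the circles. -/
theorem sum_left_ends {N : Finset V} {α β : V → V} (hα : Crossingless N α)
    (hβ : Crossingless N β) (x : V → ℤ) (hxα : ∀ v ∈ N, x (α v) = - x v)
    (hxβ : ∀ v ∈ N, x (β v) = - x v) :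
    (∑ v ∈ N, if v < α v then x v else 0) + (∑ v ∈ N, if v < β v then x v else 0) =
      2 * ∑ v ∈ N, if ∀ u, ConnOn N α β v u → v ≤ u then x v else 0 := by
  induction hn : N.card using Nat.strong_induction_on generalizing N β with
  | _ n ih =>
  subst hn
  rcases N.eq_empty_or_nonempty with rfl | ⟨v₀, hv₀⟩
  · simp
  have hr := ConnOn.equivalence N α β
  obtain ⟨i, hi, hmax⟩ : ∃ i ∈ N.filter (fun v => v < α v), ∀ v ∈ N.filter (fun v => v < α v),
      v ≤ i := by
    refine Finset.exists_max_image _ id ?_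
    rcases lt_or_gt_of_ne (hα.ne v₀ hv₀) with h | h
    · exact ⟨α v₀, Finset.mem_filter.2 ⟨hα.mem _ hv₀, by rwa [hα.invol _ hv₀]⟩⟩
    · exact ⟨v₀, Finset.mem_filter.2 ⟨hv₀, h⟩⟩
  obtain ⟨hiN, hij⟩ := Finset.mem_filter.1 hi
  set j := α i with hj
  have hjN : j ∈ N := hα.mem i hiN
  have hji : α j = i := hα.invol i hiN
  have hmax' : ∀ v ∈ N, v ≤ i ∨ α v ≤ i := by
    intro v hv
    rcases lt_or_gt_of_ne (hα.ne v hv) with h | h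
    · exact Or.inr (hmax _ (Finset.mem_filter.2 ⟨hα.mem v hv, by rwa [hα.invol v hv]⟩))
    · exact Or.inl (hmax v (Finset.mem_filter.2 ⟨hv, h⟩))
  set M := (N.erase i).erase j with hMdef
  have hM : ∀ v, v ∈ M ↔ v ∈ N ∧ v ≠ i ∧ v ≠ j := by
    intro v
    simp only [hMdef, Finset.mem_erase]
    tauto
  have hcard : M.card < N.card :=
    Finset.card_lt_card ⟨fun v hv => ((hM v).1 hv).1, fun h => ((hM i).1 (h hiN)).2.1 rfl⟩
  have hsum : ∀ g : V → ℤ, ∑ v ∈ N, g v = g i + g j + ∑ v ∈ M, g v := by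
    intro g
    rw [hMdef, ← Finset.add_sum_erase N g hiN,
      ← Finset.add_sum_erase (N.erase i) g (Finset.mem_erase.2 ⟨hij.ne', hjN⟩), add_assoc]
  have hαM : Crossingless M α := by
    refine ⟨fun v hv => ?_, fun v hv => hα.ne v ((hM v).1 hv).1,
      fun v hv => hα.invol v ((hM v).1 hv).1,
      fun p hp u hu => hα.inside p ((hM p).1 hp).1 u ((hM u).1 hu).1⟩
    obtain ⟨h1, h2, h3⟩ := (hM v).1 hv
    refine (hM _).2 ⟨hα.mem v h1, fun h => h3 ?_, fun h => h2 ?_⟩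
    · rw [hj, ← h, hα.invol v h1]
    · rw [← hji, ← h, hα.invol v h1]
  have hadj : ∀ u ∈ M, i < u ↔ j < u := by
    intro u hu
    obtain ⟨huN, hui, huj⟩ := (hM u).1 hu
    refine ⟨fun h => ?_, fun h => hij.trans h⟩
    by_contra h'
    have h1 := hα.inside i hiN u huN hui huj
    rw [← hj] at h1
    have h2 : j < α u → i < α u := fun h => hij.trans h
    rcases hmax' u huN with h3 | h3
    · exact absurd h (not_lt.2 h3)
    · have := not_lt.2 h3
      tauto
  have hxj : x j = - x i := hxα i hiN
  have hj_rep : ¬ ∀ u, ConnOn N α β j u → j ≤ u := fun h =>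
    absurd (h i (.rel _ _ ⟨hjN, Or.inl hji.symm⟩)) (not_le.2 hij)
  have hα_sum : (∑ v ∈ N, if v < α v then x v else 0) =
      x i + ∑ v ∈ M, if v < α v then x v else 0 := by
    rw [hsum, if_pos hij, hji, if_neg (not_lt.2 hij.le), add_zero]
  by_cases hβij : β i = j
  · have hβji : β j = i := by rw [← hβij, hβ.invol i hiN]
    have hβM : Crossingless M β := by
      refine ⟨fun v hv => ?_, fun v hv => hβ.ne v ((hM v).1 hv).1,
        fun v hv => hβ.invol v ((hM v).1 hv).1,
        fun p hp u hu => hβ.inside p ((hM p).1 hp).1 u ((hM u).1 hu).1⟩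
      obtain ⟨h1, h2, h3⟩ := (hM v).1 hv
      refine (hM _).2 ⟨hβ.mem v h1, fun h => h3 ?_, fun h => h2 ?_⟩
      · rw [← hβij, ← h, hβ.invol v h1]
      · rw [← hβji, ← h, hβ.invol v h1]
    have hIH := ih M.card hcard hαM hβM (fun v hv => hxα v ((hM v).1 hv).1)
      (fun v hv => hxβ v ((hM v).1 hv).1) rfl
    have hrM := ConnOn.equivalence M α β
    let ρ : V → V := fun v => if v = j then i else v
    have hρj : ρ j = i := by simp [ρ]
    have hρ : ∀ {v}, v ≠ j → ρ v = v := fun h => by simp [ρ, h]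
    have hretract : ∀ {u v}, ConnOn N α β u v → ConnOn M α β (ρ u) (ρ v) := by
      intro u v huv
      refine huv.le (r := fun u v => ConnOn M α β (ρ u) (ρ v))
        ⟨fun _ => hrM.refl _, fun h => hrM.symm h, fun h1 h2 => hrM.trans h1 h2⟩ fun u hu => ?_
      by_cases h1 : u = i
      · subst h1
        rw [← hj, hβij, hρj, hρ hij.ne]
        exact ⟨hrM.refl _, hrM.refl _⟩
      by_cases h2 : u = j
      · subst h2
        rw [hji, hβji, hρj, hρ hij.ne]
        exact ⟨hrM.refl _, hrM.refl _⟩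
      have hu' : u ∈ M := (hM u).2 ⟨hu, h1, h2⟩
      rw [hρ h2, hρ ((hM _).1 (hαM.mem u hu')).2.2, hρ ((hM _).1 (hβM.mem u hu')).2.2]
      exact ⟨.rel _ _ ⟨hu', Or.inl rfl⟩, .rel _ _ ⟨hu', Or.inr rfl⟩⟩
    have hi_notin : i ∉ M := fun h => ((hM i).1 h).2.1 rfl
    have hi_rep : ∀ u, ConnOn N α β i u → i ≤ u := by
      intro u hu
      have h1 := (hretract hu).mem hαM hβM
      rw [hρ hij.ne] at h1
      by_cases h2 : u = j
      · rw [h2]; exact hij.le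
      rw [hρ h2] at h1
      rcases h1 with h1 | h1
      exacts [h1.le, absurd h1.1 hi_notin]
    have hrep : ∀ v ∈ M, (∀ u, ConnOn N α β v u → v ≤ u) ↔ ∀ u, ConnOn M α β v u → v ≤ u := by
      intro v hv
      obtain ⟨hvN, hvi, hvj⟩ := (hM v).1 hv
      constructor
      · intro h u hu
        refine h u (hu.le hr fun w hw => ?_)
        have hw := ((hM w).1 hw).1
        exact ⟨.rel _ _ ⟨hw, Or.inl rfl⟩, .rel _ _ ⟨hw, Or.inr rfl⟩⟩
      · intro h u hu
        have h1 := hretract hu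
        rw [hρ hvj] at h1
        have h3 : ρ u ≠ i := fun h' => by
          rw [h'] at h1
          rcases h1.mem hαM hβM with h2 | h2
          exacts [hvi h2, hi_notin h2.2]
        have h2 : u ≠ j := fun h' => h3 (h' ▸ hρj)
        rw [hρ h2] at h1
        exact h u h1
    rw [hα_sum, hsum (fun v => if v < β v then x v else 0),
      hsum (fun v => if ∀ u, ConnOn N α β v u → v ≤ u then x v else 0), if_neg hj_rep,
      if_pos hi_rep, hβij, hβji, if_pos hij, if_neg (not_lt.2 hij.le),
      Finset.sum_congr (s₁ := M) rfl fun v hv => if_congr (hrep v hv) rfl rfl]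
    linarith
  · set k := β i with hk
    set l := β j with hl
    have hki : β k = i := hβ.invol i hiN
    have hlj : β l = j := hβ.invol j hjN
    have hli : l ≠ i := fun h => hβij ((congrArg β h).symm.trans hlj)
    have hkl : k ≠ l := fun h => hij.ne (by rw [← hki, h, hlj])
    have hkM : k ∈ M := (hM k).2 ⟨hβ.mem i hiN, hβ.ne i hiN, hβij⟩
    have hlM : l ∈ M := (hM l).2 ⟨hβ.mem j hjN, hli, hβ.ne j hjN⟩
    have hki' : k ≠ i := hβ.ne i hiN
    have hlj' : l ≠ j := hβ.ne j hjN
    have hxk : x k = - x i := hxβ i hiN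
    have hxl : x l = x i := by rw [hl, hxβ j hjN, hxj, neg_neg]
    set γ := rejoin β k l with hγ
    have rk : γ k = l := by simp [hγ, rejoin]
    have rl : γ l = k := by simp [hγ, rejoin, hkl.symm]
    have ro : ∀ {v}, v ≠ k → v ≠ l → γ v = β v := fun h1 h2 => by simp [hγ, rejoin, h1, h2]
    have hγM : Crossingless M γ := hβ.rejoin hiN hjN hij hM hadj hβij
    have hxγ : ∀ v ∈ M, x (γ v) = - x v := by
      intro v hv
      by_cases h1 : v = k
      · rw [h1, rk, hxl, hxk, neg_neg]
      by_cases h2 : v = l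
      · rw [h2, rl, hxl, hxk]
      rw [ro h1 h2, hxβ v ((hM v).1 hv).1]
    have hIH := ih M.card hcard hαM hγM (fun v hv => hxα v ((hM v).1 hv).1) hxγ rfl
    have hrM := ConnOn.equivalence M α γ
    have hi_rep : ¬ ∀ u, ConnOn N α β i u → i ≤ u := by
      intro h
      have h1 : ConnOn N α β i k := .rel _ _ ⟨hiN, Or.inr rfl⟩
      have h2 : ConnOn N α β i (α k) :=
        hr.trans h1 (.rel _ _ ⟨hβ.mem i hiN, Or.inl rfl⟩)
      rcases hmax' k (hβ.mem i hiN) with h3 | h3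
      · exact hki' (le_antisymm h3 (h k h1))
      · refine hβij ?_
        have := le_antisymm h3 (h _ h2)
        rw [← hα.invol k (hβ.mem i hiN), this]
    let ρ : V → V := fun v => if v = i then k else if v = j then l else v
    have hρi : ρ i = k := by simp [ρ]
    have hρj : ρ j = l := by simp [ρ, hij.ne']
    have hρ : ∀ {v}, v ∈ M → ρ v = v := fun h => by
      simp [ρ, ((hM _).1 h).2.1, ((hM _).1 h).2.2]
    have hkl_conn : ConnOn M α γ k l := .rel _ _ ⟨hkM, Or.inr rk.symm⟩
    have hretract : ∀ {u v}, ConnOn N α β u v → ConnOn M α γ (ρ u) (ρ v) := by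
      intro u v huv
      refine huv.le (r := fun u v => ConnOn M α γ (ρ u) (ρ v))
        ⟨fun _ => hrM.refl _, fun h => hrM.symm h, fun h1 h2 => hrM.trans h1 h2⟩ fun u hu => ?_
      by_cases h1 : u = i
      · subst h1
        rw [← hj, ← hk, hρj, hρi, hρ hkM]
        exact ⟨hkl_conn, hrM.refl _⟩
      by_cases h2 : u = j
      · subst h2
        rw [hji, ← hl, hρj, hρi, hρ hlM]
        exact ⟨hrM.symm hkl_conn, hrM.refl _⟩
      have hu' : u ∈ M := (hM u).2 ⟨hu, h1, h2⟩
      rw [hρ hu', hρ (hαM.mem u hu')]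
      refine ⟨.rel _ _ ⟨hu', Or.inl rfl⟩, ?_⟩
      by_cases h3 : u = k
      · subst h3
        rw [hki, hρi]
        exact hrM.refl _
      by_cases h4 : u = l
      · subst h4
        rw [hlj, hρj]
        exact hrM.refl _
      have := hγM.mem u hu'
      rw [ro h3 h4] at this
      rw [hρ this]
      exact .rel _ _ ⟨hu', Or.inr (ro h3 h4).symm⟩
    have hleMN : ∀ {u v}, ConnOn M α γ u v → ConnOn N α β u v := by
      intro u v huv
      refine huv.le hr fun w hw => ?_
      have hwN := ((hM w).1 hw).1
      refine ⟨.rel _ _ ⟨hwN, Or.inl rfl⟩, ?_⟩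
      have hik : ConnOn N α β i k := .rel _ _ ⟨hiN, Or.inr rfl⟩
      have hjl : ConnOn N α β j l := .rel _ _ ⟨hjN, Or.inr rfl⟩
      have hijc : ConnOn N α β i j := .rel _ _ ⟨hiN, Or.inl rfl⟩
      have hklc : ConnOn N α β k l := hr.trans (hr.symm hik) (hr.trans hijc hjl)
      by_cases h3 : w = k
      · rw [h3, rk]; exact hklc
      by_cases h4 : w = l
      · rw [h4, rl]; exact hr.symm hklc
      rw [ro h3 h4]
      exact .rel _ _ ⟨hwN, Or.inr rfl⟩
    have hrep : ∀ v ∈ M, (∀ u, ConnOn N α β v u → v ≤ u) ↔ ∀ u, ConnOn M α γ v u → v ≤ u := by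
      intro v hv
      obtain ⟨hvN, hvi, hvj⟩ := (hM v).1 hv
      refine ⟨fun h u hu => h u (hleMN hu), fun h => ?_⟩
      obtain ⟨v₁, hv₁, hmin⟩ := Finset.exists_min_image (N.filter fun u => ConnOn N α β v u) id
        ⟨v, Finset.mem_filter.2 ⟨hvN, hr.refl v⟩⟩
      obtain ⟨hv₁N, hvv₁⟩ := Finset.mem_filter.1 hv₁
      have hmin' : ∀ u, ConnOn N α β v u → v₁ ≤ u := by
        intro u hu
        rcases hu.mem hα hβ with h1 | h1
        · exact hmin u (Finset.mem_filter.2 ⟨h1 ▸ hvN, hu⟩)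
        · exact hmin u (Finset.mem_filter.2 ⟨h1.2, hu⟩)
      have hv₁M : v₁ ∈ M := by
        refine (hM _).2 ⟨hv₁N, ?_, ?_⟩
        · rintro rfl
          exact hi_rep fun u hu => hmin' u (hr.trans hvv₁ hu)
        · rintro rfl
          exact hj_rep fun u hu => hmin' u (hr.trans hvv₁ hu)
      have h1 := hretract hvv₁
      rw [hρ hv, hρ hv₁M] at h1
      exact fun u hu => (h _ h1).trans (hmin' u hu)
    have hsumM : ∀ g : V → ℤ, ∑ v ∈ M, g v = g k + g l + ∑ v ∈ (M.erase k).erase l, g v := by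
      intro g
      rw [← Finset.add_sum_erase M g hkM,
        ← Finset.add_sum_erase (M.erase k) g (Finset.mem_erase.2 ⟨hkl.symm, hlM⟩), add_assoc]
    have hrest : (∑ v ∈ (M.erase k).erase l, if v < β v then x v else 0) =
        ∑ v ∈ (M.erase k).erase l, if v < γ v then x v else 0 := by
      refine Finset.sum_congr rfl fun v hv => ?_
      obtain ⟨h1, h2, -⟩ := by simpa only [Finset.mem_erase] using hv
      rw [ro h2 h1]
    have horder : x i + (if i < k then x i else 0) + (if j < l then x j else 0) +
        (if k < i then x k else 0) + (if l < j then x l else 0) =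
        (if k < l then x k else 0) + (if l < k then x l else 0) := by
      have hnest := hβ.inside i hiN j hjN hij.ne' (Ne.symm hβij)
      rw [← hk, ← hl] at hnest
      have ak := hadj k hkM
      have al := hadj l hlM
      have ek : i < k ↔ ¬ k < i := by rw [not_lt, hki'.symm.le_iff_lt]
      have el : j < l ↔ ¬ l < j := by rw [not_lt, hlj'.symm.le_iff_lt]
      have ekl : l < k ↔ ¬ k < l := by rw [not_lt, hkl.symm.le_iff_lt]
      have ekj : k < j ↔ k < i := by rw [← not_iff_not, ← ek, ak, not_lt, (Ne.symm hβij).le_iff_lt]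
      simp only [hij, true_iff, ekj, al, el] at hnest
      have htrans : l < j → k < l → k < i := fun h1 h2 => ekj.1 (h2.trans h1)
      simp only [ek, el, ekl, hxj, hxk, hxl]
      by_cases h1 : k < i <;> by_cases h2 : l < j <;> by_cases h3 : k < l <;>
        simp only [h1, h2, h3, not_true, not_false_iff, if_true, if_false, iff_true,
          iff_false, forall_true_left] at hnest htrans ⊢ <;> ring
    rw [hα_sum, hsum (fun v => if v < β v then x v else 0),
      hsum (fun v => if ∀ u, ConnOn N α β v u → v ≤ u then x v else 0), if_neg hj_rep,
      if_neg hi_rep, Finset.sum_congr (s₁ := M) rfl fun v hv => if_congr (hrep v hv) rfl rfl,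
      add_zero, zero_add, ← hIH, hsumM (fun v => if v < β v then x v else 0),
      hsumM (fun v => if v < γ v then x v else 0), hrest, rk, rl, hki, hlj, ← hk, ← hl]
    linarith

end Degree

/-! ### Circle diagrams with one number line -/

section Lines

variable {V : Type*} [LinearOrder V] {N : Finset V} {f a b d l : V → Label} {i j : V}

/-- Two vertices lie on the same circle of the circle diagram made of the cup diagrams of `a` and
`b`. -/
def Loop (a b : V → Label) : V → V → Prop :=
  Relation.EqvGen fun u v => Cup a u v ∨ Cup b u v

theorem Loop.equivalence (a b : V → Label) : Equivalence (Loop a b) :=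
  Relation.EqvGen.is_equivalence _

theorem Cup.loop_left (h : Cup a i j) : Loop a b i j := .rel _ _ (Or.inl h)

theorem Cup.loop_right (h : Cup b i j) : Loop a b i j := .rel _ _ (Or.inr h)

theorem Loop.le {r : V → V → Prop} (hr : Equivalence r) (ha : ∀ i j, Cup a i j → r i j)
    (hb : ∀ i j, Cup b i j → r i j) {u v : V} (h : Loop a b u v) : r u v := by
  induction h with
  | refl x => exact hr.refl x
  | symm x y _ ih => exact hr.symm ih
  | trans x y z _ _ ih1 ih2 => exact hr.trans ih1 ih2
  | rel x y h => exact h.elim (ha x y) (hb x y)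

theorem Compat.mem_iff_of_cup (ha : Compat N f a) (h : Cup a i j) : i ∈ N ↔ j ∈ N :=
  iff_of_true (ha.left_mem h) (ha.right_mem h)

theorem Loop.mem_iff (ha : Compat N f a) (hb : Compat N f b) {u v : V} (h : Loop a b u v) :
    u ∈ N ↔ v ∈ N :=
  h.le (r := fun u v => u ∈ N ↔ v ∈ N) ⟨fun _ => Iff.rfl, Iff.symm, Iff.trans⟩
    (fun _ _ => ha.mem_iff_of_cup) fun _ _ => hb.mem_iff_of_cup

theorem Compat.cup_mate (ha : Compat N f a) {v : V} (hv : v ∈ N) :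
    (v < mate a v ∧ Cup a v (mate a v)) ∨ (mate a v < v ∧ Cup a (mate a v) v) := by
  obtain ⟨j, h | h⟩ := ha.full v hv
  · rw [h.mate_left]; exact Or.inl ⟨h.lt, h⟩
  · rw [h.mate_right]; exact Or.inr ⟨h.lt, h⟩

theorem Cup.inside_iff (h : Cup a i j) {u : V} (hui : u ≠ i) (huj : u ≠ j) :
    (i < u ↔ j < u) ↔ (i < mate a u ↔ j < mate a u) := by
  have key : ∀ {x}, x ≠ i → x ≠ j → ((i < x ↔ j < x) ↔ x ∉ Set.Ioo i j) := by
    intro x _ hj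
    simp only [Set.mem_Ioo, not_and, not_lt]
    constructor
    · exact fun h1 h2 => (h1.1 h2).le
    · exact fun h1 => ⟨fun h2 => lt_of_le_of_ne (h1 h2) hj.symm, fun h2 => h.lt.trans h2⟩
  have h1 : mate a u ≠ i := fun h' => huj (by rw [← mate_mate a u, h', h.mate_left])
  have h2 : mate a u ≠ j := fun h' => hui (by rw [← mate_mate a u, h', h.mate_right])
  rw [key hui huj, key h1 h2, not_iff_not]
  refine ⟨h.mate_mem_Ioo, fun hm => ?_⟩
  have := h.mate_mem_Ioo hm
  rwa [mate_mate] at this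

theorem Compat.crossingless (ha : Compat N f a) : Crossingless N (mate a) where
  mem v hv := (ha.mate_mem hv).1
  ne v hv := (ha.mate_mem hv).2
  invol v _ := mate_mate a v
  inside p hp u _ hup hump := by
    rcases ha.cup_mate hp with ⟨-, h⟩ | ⟨-, h⟩
    · exact h.inside_iff hup hump
    · rw [iff_comm (a := p < u), iff_comm (a := p < mate a u)]
      exact h.inside_iff hump hup

theorem connOn_iff_loop (ha : Compat N f a) (hb : Compat N f b) {u v : V} :
    ConnOn N (mate a) (mate b) u v ↔ Loop a b u v := by
  have hr := Loop.equivalence a b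
  constructor
  · refine fun h => h.le hr fun w hw => ⟨?_, ?_⟩
    · rcases ha.cup_mate hw with ⟨-, h⟩ | ⟨-, h⟩
      exacts [h.loop_left, hr.symm h.loop_left]
    · rcases hb.cup_mate hw with ⟨-, h⟩ | ⟨-, h⟩
      exacts [h.loop_right, hr.symm h.loop_right]
  · refine fun h => h.le (ConnOn.equivalence _ _ _) (fun i j h => ?_) fun i j h => ?_
    · exact .rel _ _ ⟨ha.left_mem h, Or.inl h.mate_left.symm⟩
    · exact .rel _ _ ⟨hb.left_mem h, Or.inr h.mate_left.symm⟩

/-- The weight `l` is an orientation of the cup diagram of `a`, with the prescribed labels at the free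
vertices. -/
structure Fits (N : Finset V) (f a l : V → Label) : Prop where
  off : ∀ v ∉ N, l v = f v
  cup : ∀ i j, Cup a i j → (l i = .down ∧ l j = .up) ∨ (l i = .up ∧ l j = .down)

theorem Compat.fits_self (ha : Compat N f a) : Fits N f a a :=
  ⟨ha.off, fun _ _ h => Or.inl ⟨h.down, h.up⟩⟩

theorem Fits.sgn_eq (hl : Fits N f a l) (h : Cup a i j) : (l j).sgn = - (l i).sgn :=
  opposite_sgn (hl.cup i j h)

theorem Fits.active (ha : Compat N f a) (hl : Fits N f a l) {v : V} (hv : v ∈ N) :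
    l v = .down ∨ l v = .up := by
  obtain ⟨j, h | h⟩ := ha.full v hv <;> rcases hl.cup _ _ h with h' | h' <;> simp [h']

theorem Fits.sgn_mate (ha : Compat N f a) (hl : Fits N f a l) {v : V} (hv : v ∈ N) :
    (l (mate a v)).sgn = - (l v).sgn := by
  obtain ⟨j, h | h⟩ := ha.full v hv
  · rw [h.mate_left, hl.sgn_eq h]
  · rw [h.mate_right, hl.sgn_eq h, neg_neg]

theorem Fits.sgn_eq_zero (ha : Compat N f a) (hl : Fits N f a l) {v : V} (hv : v ∉ N) :
    (l v).sgn = 0 := by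
  rw [hl.off v hv, ha.free v hv]

/-- The number of clockwise circles minus the number of anti-clockwise circles. -/
noncomputable def lineDegree [Fintype V] (a b l : V → Label) : ℤ :=
  - ∑ v ∈ reps id (Loop a b), (l v).sgn

theorem mem_cupList [Fintype V] {p : V × V} : p ∈ cupList b ↔ Cup b p.1 p.2 := by
  classical
  simp only [cupList, List.mem_map, Finset.mem_sort, Finset.mem_filter, Finset.mem_univ, true_and]
  exact ⟨fun ⟨q, hq, h⟩ => h ▸ hq, fun h => ⟨toLex p, h, rfl⟩⟩

theorem nodup_cupList [Fintype V] (b : V → Label) : (cupList b).Nodup :=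
  (Finset.sort_nodup _ _).map ofLex.injective

theorem cupsOf_cupList [Fintype V] (b : V → Label) : CupsOf b (cupList b) :=
  ⟨fun _ h => mem_cupList.1 h, nodup_cupList b⟩

theorem sum_cupList [Fintype V] {M : Type*} [AddCommMonoid M] (ha : Compat N f a) (x : V → M) :
    ((cupList a).map fun p => x p.1).sum = ∑ v ∈ N, if v < mate a v then x v else 0 := by
  classical
  rw [← List.sum_toFinset _ (nodup_cupList a), ← Finset.sum_filter]
  refine Finset.sum_bij (fun p _ => p.1) ?_ ?_ ?_ fun _ _ => rfl
  · intro p hp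
    have hp := mem_cupList.1 (List.mem_toFinset.1 hp)
    refine Finset.mem_filter.2 ⟨ha.left_mem hp, ?_⟩
    rw [hp.mate_left]
    exact hp.lt
  · intro p hp q hq h
    have hp := mem_cupList.1 (List.mem_toFinset.1 hp)
    have hq := mem_cupList.1 (List.mem_toFinset.1 hq)
    refine Prod.ext h (hp.right_unique ?_)
    rw [h]
    exact hq
  · intro v hv
    obtain ⟨hvN, hv⟩ := Finset.mem_filter.1 hv
    rcases ha.cup_mate hvN with ⟨-, h⟩ | ⟨h, -⟩
    · exact ⟨(v, mate a v), List.mem_toFinset.2 (mem_cupList.2 h), rfl⟩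
    · exact absurd h hv.asymm

/-- The number of cups. -/
theorem two_mul_length_cupList [Fintype V] (ha : Compat N f a) :
    2 * (cupList a).length = N.card := by
  classical
  have h1 : (cupList a).length = (N.filter fun v => v < mate a v).card := by
    have := sum_cupList ha fun _ => 1
    rw [Finset.card_filter, ← this]
    simp
  have h2 : (N.filter fun v => v < mate a v).card = (N.filter fun v => ¬ v < mate a v).card := by
    refine Finset.card_bij (fun v _ => mate a v) ?_ ?_ ?_
    · intro v hv
      obtain ⟨hvN, hv⟩ := Finset.mem_filter.1 hv
      refine Finset.mem_filter.2 ⟨(ha.mate_mem hvN).1, ?_⟩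
      rw [mate_mate]
      exact hv.asymm
    · intro v _ w _ h
      rw [← mate_mate a v, h, mate_mate]
    · intro v hv
      obtain ⟨hvN, hv⟩ := Finset.mem_filter.1 hv
      refine ⟨mate a v, Finset.mem_filter.2 ⟨(ha.mate_mem hvN).1, ?_⟩, mate_mate a v⟩
      rw [mate_mate]
      exact lt_of_le_of_ne (not_lt.1 hv) (ha.mate_mem hvN).2
  have := Finset.card_filter_add_card_filter_not (s := N) fun v => v < mate a v
  omega

theorem cupDegree_eq [Fintype V] (ha : Compat N f a) (hl : Fits N f a l) :
    (cupList a).length - 2 * (cupDegree a l : ℤ) =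
      ∑ v ∈ N, if v < mate a v then (l v).sgn else 0 := by
  classical
  have h1 : cupDegree a l = ((cupList a).filter fun p => l p.1 = .up).length := by
    rw [cupDegree, ← List.toFinset_card_of_nodup ((nodup_cupList a).filter _),
      ← Set.ncard_coe_finset]
    congr 1
    ext p
    simp [mem_cupList]
  have h2 : ∀ L : List (V × V), (∀ p ∈ L, l p.1 = .down ∨ l p.1 = .up) →
      (L.length - 2 * ((L.filter fun p => l p.1 = .up).length : ℤ)) =
        (L.map fun p => (l p.1).sgn).sum := by
    intro L hL
    induction L with
    | nil => simp
    | cons p L ih =>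
      have := ih fun q hq => hL q (List.mem_cons_of_mem _ hq)
      rcases hL p List.mem_cons_self with h | h <;>
        simp only [List.length_cons, List.filter_cons, h, List.map_cons, List.sum_cons, ← this] <;>
        simp [Label.sgn] <;> ring
  rw [h1, h2, sum_cupList ha fun v => (l v).sgn]
  exact fun p hp => hl.active ha (ha.left_mem (mem_cupList.1 hp))

/-- The degree of an oriented circle diagram. -/
theorem cupDegree_add_cupDegree [Fintype V] (ha : Compat N f a) (hb : Compat N f b)
    (hla : Fits N f a l) (hlb : Fits N f b l) :
    (cupDegree a l + cupDegree b l : ℤ) = (cupList b).length + lineDegree a b l := by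
  classical
  have h1 := cupDegree_eq ha hla
  have h2 := cupDegree_eq hb hlb
  have h3 : (cupList a).length = (cupList b).length := by
    have := two_mul_length_cupList ha
    have := two_mul_length_cupList hb
    omega
  have h4 := sum_left_ends ha.crossingless hb.crossingless (fun v => (l v).sgn)
    (fun v hv => hla.sgn_mate ha hv) (fun v hv => hlb.sgn_mate hb hv)
  rw [← h1, ← h2, h3] at h4
  have h5 : ∀ Q : ℤ, ((cupList b).length - 2 * (cupDegree a l : ℤ)) +
      ((cupList b).length - 2 * (cupDegree b l : ℤ)) = 2 * Q → Q = - lineDegree a b l →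
      (cupDegree a l + cupDegree b l : ℤ) = (cupList b).length + lineDegree a b l := by
    intro Q h6 h7
    linarith
  refine h5 _ h4 ?_
  rw [lineDegree, neg_neg]
  have h6 : ∀ v, (∀ u, ConnOn N (mate a) (mate b) v u → v ≤ u) ↔ v ∈ reps id (Loop a b) := by
    simp only [mem_reps, IsRep, connOn_iff_loop ha hb, id, implies_true]
  simp only [h6]
  rw [Finset.sum_ite_mem]
  refine Finset.sum_subset Finset.inter_subset_right fun v hv hv' => ?_
  exact hla.sgn_eq_zero ha fun hvN => hv' (Finset.mem_inter.2 ⟨hvN, hv⟩)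

end Lines

section Lines

variable {V : Type*} [LinearOrder V] {N : Finset V} {f a b d l m n μ : V → Label} {i j : V}

/-- The colour of a vertex in an oriented diagram with one number line. -/
def lineColour (N : Finset V) (l : V → Label) (v : V) : ℤ := par N v * (l v).sgn

theorem Fits.lineColour_eq_or (ha : Compat N f a) (hl : Fits N f a l) {v : V} (hv : v ∈ N) :
    lineColour N l v = 1 ∨ lineColour N l v = -1 := by
  rcases hl.active ha hv with h | h <;> rcases par_eq_or N v with h' | h' <;>
    simp [lineColour, h, h', Label.sgn]

theorem Fits.lineColour_eq (ha : Compat N f a) (hl : Fits N f a l) (h : Cup a i j) :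
    lineColour N l i = lineColour N l j := by
  rw [lineColour, lineColour, ha.par_eq h, hl.sgn_eq h, neg_mul_neg]

theorem Fits.of_lineColour (ha : Compat N f a) (hb : Compat N f b) (hl : Fits N f a l)
    (h : ∀ i j, Cup b i j → lineColour N l i = lineColour N l j) : Fits N f b l := by
  refine ⟨hl.off, fun i j hij => ?_⟩
  rw [Label.opposite_iff (hl.active ha (hb.left_mem hij))]
  have := h i j hij
  rw [lineColour, lineColour, hb.par_eq hij] at this
  rcases par_eq_or N i with h | h <;> rw [h] at this <;> linarith

theorem Loop.lineColour_eq (ha : Compat N f a) (hb : Compat N f b) (hla : Fits N f a l)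
    (hlb : Fits N f b l) {u v : V} (h : Loop a b u v) : lineColour N l u = lineColour N l v :=
  h.le (eq_equivalence _) (fun _ _ => hla.lineColour_eq ha) fun _ _ => hlb.lineColour_eq hb

theorem Compat.vertical_iff [Fintype V] (hb : Compat N f b) {v : V} :
    Vertical (cupList b) v ↔ v ∉ N := by
  constructor
  · intro hv hN
    obtain ⟨j, h | h⟩ := hb.full v hN
    · exact (hv (v, j) (mem_cupList.2 h)).1 rfl
    · exact (hv (j, v) (mem_cupList.2 h)).2 rfl
  · refine fun hv p hp => ⟨?_, ?_⟩
    · rintro rfl; exact hv (hb.left_mem (mem_cupList.1 hp))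
    · rintro rfl; exact hv (hb.right_mem (mem_cupList.1 hp))

theorem diagram_cupList [Fintype V] (ha : Compat N f a) (hb : Compat N f b) (hd : Compat N f d) :
    Diagram N f a b d (cupList b) :=
  ⟨ha, hb, hd, cupsOf_cupList b⟩

theorem sameCircle_cupList [Fintype V] (ha : Compat N f a) (hb : Compat N f b) (hd : Compat N f d)
    {v w : V} {s t : Bool} (hv : v ∈ N) : SameCircle a d (cupList b) (v, s) (w, t) ↔
      s = t ∧ if s then Loop b d v w else Loop a b v w := by
  constructor
  · intro h
    have h' := h.le (r := fun x y => (x.1 ∈ N ↔ y.1 ∈ N) ∧ (x.1 ∈ N →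
        x.2 = y.2 ∧ if x.2 then Loop b d x.1 y.1 else Loop a b x.1 y.1)) ⟨?_, ?_, ?_⟩ ?_ ?_
    · exact h'.2 hv
    · rintro ⟨x, s⟩
      refine ⟨Iff.rfl, fun _ => ⟨rfl, ?_⟩⟩
      cases s
      exacts [(Loop.equivalence a b).refl x, (Loop.equivalence b d).refl x]
    · rintro ⟨x, s⟩ ⟨y, t⟩ ⟨h1, h2⟩
      refine ⟨h1.symm, fun hy => ?_⟩
      obtain ⟨h3, h4⟩ := h2 (h1.2 hy)
      simp only at h3 h4 ⊢
      subst h3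
      refine ⟨rfl, ?_⟩
      cases s
      exacts [(Loop.equivalence a b).symm h4, (Loop.equivalence b d).symm h4]
    · rintro ⟨x, s⟩ ⟨y, t⟩ ⟨z, r⟩ ⟨h1, h2⟩ ⟨h1', h2'⟩
      refine ⟨h1.trans h1', fun hx => ?_⟩
      obtain ⟨h3, h4⟩ := h2 hx
      obtain ⟨h5, h6⟩ := h2' (h1.1 hx)
      simp only at h3 h4 h5 h6 ⊢
      subst h3 h5
      refine ⟨rfl, ?_⟩
      cases s
      exacts [(Loop.equivalence a b).trans h4 h6, (Loop.equivalence b d).trans h4 h6]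
    · intro x y hxy
      obtain ⟨-, h1, h2⟩ := (diagram_cupList ha hb hd).arc_par hxy
      refine ⟨iff_of_true h1 h2, fun _ => ?_⟩
      cases hxy with
      | bottomCup h => exact ⟨rfl, h.loop_left⟩
      | topCap h => exact ⟨rfl, h.loop_right⟩
      | middleCap h => exact ⟨rfl, (mem_cupList.1 h).loop_right⟩
      | middleCup h => exact ⟨rfl, (mem_cupList.1 h).loop_left⟩
    · intro x hx
      have := hb.vertical_iff.1 hx
      exact ⟨Iff.rfl, fun h => absurd h this⟩
  · have hr := sameCircle_equivalence a d (cupList b)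
    have hr' : ∀ s : Bool, Equivalence fun x y => SameCircle a d (cupList b) (x, s) (y, s) :=
      fun s => ⟨fun _ => hr.refl _, hr.symm, hr.trans⟩
    rintro ⟨rfl, h⟩
    cases s
    · exact h.le (hr' false) (fun i j h => .rel _ _ (Or.inl (.bottomCup h)))
        fun i j h => .rel _ _ (Or.inl (.middleCap (mem_cupList.2 h)))
    · exact h.le (hr' true) (fun i j h => .rel _ _ (Or.inl (.middleCup (mem_cupList.2 h))))
        fun i j h => .rel _ _ (Or.inl (.topCap h))

theorem sameCircle_nil {v w : V} {s t : Bool} : SameCircle a d [] (v, s) (w, t) ↔ Loop a d v w := by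
  have hr := sameCircle_equivalence a d []
  have hv : ∀ v, SameCircle a d [] (v, false) (v, true) := fun v =>
    sameCircle_vertical a d fun p hp => absurd hp (by simp)
  constructor
  · intro h
    refine h.le (r := fun x y => Loop a d x.1 y.1) ⟨fun _ => (Loop.equivalence a d).refl _,
      (Loop.equivalence a d).symm, (Loop.equivalence a d).trans⟩ (fun x y h => ?_)
      fun v _ => (Loop.equivalence a d).refl v
    cases h with
    | bottomCup h => exact h.loop_left
    | topCap h => exact h.loop_right
    | middleCap h => simp at h
    | middleCup h => simp at h
  · intro h
    have h1 : SameCircle a d [] (v, false) (w, false) :=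
      h.le (r := fun x y => SameCircle a d [] (x, false) (y, false))
        ⟨fun _ => hr.refl _, hr.symm, hr.trans⟩ (fun i j h => .rel _ _ (Or.inl (.bottomCup h)))
        fun i j h => hr.trans (hv i) (hr.trans (.rel _ _ (Or.inl (.topCap h))) (hr.symm (hv j)))
    have h2 : ∀ v s, SameCircle a d [] (v, false) (v, s) := by
      rintro v (_ | _)
      exacts [hr.refl _, hv v]
    exact hr.trans (hr.symm (h2 v s)) (hr.trans h1 (h2 w t))

theorem toLex_bool_le {v w : V} {s : Bool} : toLex (v, s) ≤ toLex (w, s) ↔ v ≤ w := by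
  rw [Prod.Lex.le_iff]
  simp [le_iff_lt_or_eq]

theorem isRep_cupList [Fintype V] (ha : Compat N f a) (hb : Compat N f b) (hd : Compat N f d)
    {v : V} {s : Bool} (hv : v ∈ N) : IsRep toLex (SameCircle a d (cupList b)) (v, s) ↔
      if s then IsRep id (Loop b d) v else IsRep id (Loop a b) v := by
  simp only [IsRep, Prod.forall, sameCircle_cupList ha hb hd hv]
  cases s
  · simp [toLex_bool_le]
  · simp [toLex_bool_le]

theorem isRep_nil {v : V} {s : Bool} :
    IsRep toLex (SameCircle a d []) (v, s) ↔ s = false ∧ IsRep id (Loop a d) v := by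
  simp only [IsRep, Prod.forall, sameCircle_nil, id]
  constructor
  · intro h
    have hs : s = false := by
      have := h v false ((Loop.equivalence a d).refl v)
      rw [Prod.Lex.le_iff] at this
      have h' : s ≤ false := by simpa using this
      exact le_bot_iff.1 h'
    subst hs
    exact ⟨rfl, fun w hw => toLex_bool_le.1 (h w false hw)⟩
  · rintro ⟨rfl, h⟩ w t hw
    rw [Prod.Lex.le_iff]
    rcases (h w hw).lt_or_eq with h | h
    · exact Or.inl h
    · exact Or.inr ⟨h, by simp⟩

@[to_additive]
theorem prod_reps_cupList [Fintype V] {M : Type*} [CommMonoid M] (ha : Compat N f a) (hb : Compat N f b)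
    (hd : Compat N f d) (g : V × Bool → M) (hg : ∀ u, u.1 ∉ N → g u = 1) :
    ∏ u ∈ reps toLex (SameCircle a d (cupList b)), g u =
      (∏ v ∈ reps id (Loop a b), g (v, false)) * ∏ v ∈ reps id (Loop b d), g (v, true) := by
  classical
  rw [reps, reps, reps, Finset.prod_filter, Finset.prod_filter, Finset.prod_filter,
    Fintype.prod_prod_type, ← Finset.prod_mul_distrib]
  refine Finset.prod_congr rfl fun v _ => ?_
  rw [Fintype.prod_bool]
  by_cases hv : v ∈ N
  · simp [isRep_cupList ha hb hd hv, mul_comm]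
  · simp [hg (v, true) hv, hg (v, false) hv]

@[to_additive]
theorem prod_reps_nil [Fintype V] {M : Type*} [CommMonoid M] (g : V × Bool → M) :
    ∏ u ∈ reps toLex (SameCircle a d []), g u = ∏ v ∈ reps id (Loop a d), g (v, false) := by
  classical
  rw [reps, reps, Finset.prod_filter, Finset.prod_filter, Fintype.prod_prod_type]
  refine Finset.prod_congr rfl fun v _ => ?_
  rw [Fintype.prod_bool]
  simp [isRep_nil]

open Classical in
/-- The function on orientations `μ` given by the oriented circle diagram `(a l b)`. -/
noncomputable def chi [Fintype V] (N : Finset V) (f a b l μ : V → Label) : ℂ :=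
  if Fits N f a μ ∧ Fits N f b μ then
    ∏ v ∈ reps id (Loop a b), phi (l v) (lineColour N μ v) else 0

/-- The normalizing factor of the cups of `b`. -/
noncomputable def thetaProd [Fintype V] (N : Finset V) (b μ : V → Label) : ℂ :=
  ((cupList b).map fun p => theta (lineColour N μ p.1)).prod

theorem thetaProd_ne_zero [Fintype V] (N : Finset V) (b μ : V → Label) : thetaProd N b μ ≠ 0 := by
  refine List.prod_ne_zero fun h => ?_
  obtain ⟨p, -, hp⟩ := List.mem_map.1 h
  exact theta_ne_zero _ hp

theorem finalColouring (ha : Compat N f a) (hμa : Fits N f a μ) (hd : Compat N f d)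
    (hμd : Fits N f d μ) : FinalColouring N a d fun u => lineColour N μ u.1 where
  mem _ hu := hμa.lineColour_eq_or ha hu
  bot _ _ h := hμa.lineColour_eq ha h
  top _ _ h := hμd.lineColour_eq hd h
  line _ := rfl

theorem phi_of_sgn {s : Label} (hs : s.sgn = 0) (c : ℤ) : phi s c = 1 := by
  cases s <;> simp_all [Label.sgn, phi]

theorem good_stack [Fintype V] (hb : Compat N f b)
    (hla : Fits N f a l) (hlb : Fits N f b l) (hmb : Fits N f b m) (hmd : Fits N f d m) :
    Good N f a d (cupList b) (stack l m) := by
  refine ⟨⟨fun u v h => ?_, fun i hi => ?_⟩, fun u hu => ?_⟩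
  · cases h with
    | bottomCup h => exact hla.cup _ _ h
    | topCap h => exact hmd.cup _ _ h
    | middleCap h => exact hlb.cup _ _ (mem_cupList.1 h)
    | middleCup h => exact hmb.cup _ _ (mem_cupList.1 h)
  · have := hb.vertical_iff.1 hi
    simp [stack, hla.off i this, hmb.off i this]
  · obtain ⟨v, s⟩ := u
    cases s <;> simp [stack, hla.off v hu, hmb.off v hu]

theorem Good.exists_stack {o : V × Bool → Label} (ho : Good N f a d [] o) :
    ∃ n, o = stack n n ∧ Fits N f a n ∧ Fits N f d n := by
  have hv : ∀ v, o (v, false) = o (v, true) := fun v =>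
    ho.ori.vertical v fun p hp => absurd hp (by simp)
  refine ⟨fun v => o (v, false), ?_, ⟨fun v hv => ho.off _ hv, fun i j h => ?_⟩,
    ⟨fun v hv => ho.off _ hv, fun i j h => ?_⟩⟩
  · funext ⟨v, s⟩
    cases s
    · rfl
    · exact (hv v).symm
  · exact ho.ori.arc _ _ (.bottomCup h)
  · simp only [hv]
    exact ho.ori.arc _ _ (.topCap h)

theorem stack_injective {V : Type*} : Function.Injective fun n : V → Label => stack n n := by
  intro n n' h
  funext v
  exact congrFun h (v, false)

theorem circleDegree_nil [Fintype V] : circleDegree a d [] (stack n n) = lineDegree a d n := by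
  rw [circleDegree, lineDegree, sum_reps_nil]
  rfl

theorem circleDegree_cupList [Fintype V] (ha : Compat N f a) (hb : Compat N f b) (hd : Compat N f d)
    (hla : Fits N f a l) (hlb : Fits N f b l) (hmb : Fits N f b m) (hmd : Fits N f d m) :
    circleDegree a d (cupList b) (stack l m) = lineDegree a b l + lineDegree b d m := by
  rw [circleDegree, lineDegree, lineDegree, sum_reps_cupList ha hb hd, neg_add]
  · rfl
  · intro u hu
    rw [(good_stack hb hla hlb hmb hmd).off u hu, ha.free _ hu]

theorem weightFun_nil [Fintype V] (ha : Compat N f a) (hd : Compat N f d) (hμa : Fits N f a μ)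
    (hμd : Fits N f d μ) :
    weightFun a d [] (stack n n) (fun u => lineColour N μ u.1) = chi N f a d n μ := by
  classical
  rw [weightFun, chi, if_pos, if_pos ⟨hμa, hμd⟩, prod_reps_nil]
  · rfl
  · rintro ⟨u, s⟩ ⟨v, t⟩ h
    exact (sameCircle_nil.1 h).lineColour_eq ha hd hμa hμd

theorem weightFun_cupList [Fintype V] (ha : Compat N f a) (hb : Compat N f b) (hd : Compat N f d)
    (hla : Fits N f a l) (hlb : Fits N f b l) (hmb : Fits N f b m) (hmd : Fits N f d m)
    (hμa : Fits N f a μ) (hμd : Fits N f d μ) :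
    weightFun a d (cupList b) (stack l m) (fun u => lineColour N μ u.1) =
      chi N f a b l μ * chi N f b d m μ := by
  classical
  by_cases hμb : Fits N f b μ
  · rw [weightFun, chi, chi, if_pos, if_pos ⟨hμa, hμb⟩, if_pos ⟨hμb, hμd⟩,
      prod_reps_cupList ha hb hd]
    · rfl
    · intro u hu
      rw [phi_of_sgn]
      rw [(good_stack hb hla hlb hmb hmd).off u hu, ha.free _ hu]
    · rintro ⟨u, s⟩ ⟨v, t⟩ h
      by_cases hu : u ∈ N
      · obtain ⟨rfl, h'⟩ := (sameCircle_cupList ha hb hd hu).1 h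
        cases s
        · exact Loop.lineColour_eq ha hb hμa hμb h'
        · exact Loop.lineColour_eq hb hd hμb hμd h'
      · have hv := mt ((diagram_cupList ha hb hd).mem_iff h).2 hu
        simp [lineColour, hμa.sgn_eq_zero ha hu, hμa.sgn_eq_zero ha hv]
  · rw [chi, if_neg fun h => hμb h.2, zero_mul, weightFun_eq_zero]
    refine fun h => hμb (hμa.of_lineColour ha hb fun i j hij => ?_)
    exact h (i, false) (j, false) (.rel _ _ (Or.inl (.middleCap (mem_cupList.2 hij))))

theorem khovanovCoeff_ne_zero [Fintype V] (ha : Compat N f a) (hb : Compat N f b) (hd : Compat N f d)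
    (hla : Fits N f a l) (hlb : Fits N f b l) (hmb : Fits N f b m) (hmd : Fits N f d m)
    (h : khovanovCoeff a l b m d n ≠ 0) : Fits N f a n ∧ Fits N f d n ∧
      lineDegree a d n = lineDegree a b l + lineDegree b d m + (cupList b).length := by
  obtain ⟨h1, h2⟩ := (diagram_cupList ha hb hd).surgeryCount_good
    (good_stack hb hla hlb hmb hmd) h
  obtain ⟨n', h3, h4, h5⟩ := h1.exists_stack
  obtain rfl := stack_injective h3
  refine ⟨h4, h5, ?_⟩
  rw [← circleDegree_nil, h2, circleDegree_cupList ha hb hd hla hlb hmb hmd]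

/-- The functions `chi` multiply as in Khovanov's algebra, up to terms of lower degree. -/
theorem chi_mul_chi [Fintype V] (ha : Compat N f a) (hb : Compat N f b) (hd : Compat N f d)
    (hla : Fits N f a l) (hlb : Fits N f b l) (hmb : Fits N f b m) (hmd : Fits N f d m) :
    ∃ ρ : (V → Label) → ℂ, (∀ n, ρ n ≠ 0 → Fits N f a n ∧ Fits N f d n ∧
        lineDegree a d n < lineDegree a b l + lineDegree b d m + (cupList b).length) ∧
      ∀ μ, thetaProd N b μ * (chi N f a b l μ * chi N f b d m μ) =
        ∑ n, (khovanovCoeff a l b m d n + ρ n) * chi N f a d n μ := by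
  classical
  have hD := diagram_cupList ha hb hd
  have hG := good_stack hb hla hlb hmb hmd
  obtain ⟨ρ, hρ, hsum⟩ := hD.surgeryCount_sum hG
  refine ⟨fun n => ρ (stack n n), fun n hn => ?_, fun μ => ?_⟩
  · obtain ⟨h1, h2⟩ := hρ _ hn
    obtain ⟨n', h3, h4, h5⟩ := h1.exists_stack
    obtain rfl := stack_injective h3
    refine ⟨h4, h5, ?_⟩
    rwa [circleDegree_nil, circleDegree_cupList ha hb hd hla hlb hmb hmd] at h2
  · by_cases hμ : Fits N f a μ ∧ Fits N f d μ
    · obtain ⟨hμa, hμd⟩ := hμ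
      have := hsum _ (finalColouring ha hμa hd hμd)
      rw [weightFun_cupList ha hb hd hla hlb hmb hmd hμa hμd] at this
      rw [thetaProd, this]
      symm
      refine Finset.sum_of_injOn (fun n => stack n n) stack_injective.injOn (by simp) ?_ ?_
      · intro o' _ ho'
        have hno : ¬ Good N f a d [] o' := fun h => by
          obtain ⟨n, rfl, -⟩ := h.exists_stack
          exact ho' ⟨n, by simp, rfl⟩
        have h1 : ρ o' = 0 := by
          by_contra h
          exact hno (hρ o' h).1
        have h2 : surgeryCount a d (cupList b) (stack l m) o' = 0 := by
          by_contra h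
          exact hno (hD.surgeryCount_good hG h).1
        simp [h1, h2]
      · intro n _
        rw [weightFun_nil ha hd hμa hμd, khovanovCoeff]
    · have h1 : ∀ n, chi N f a d n μ = 0 := fun n => if_neg hμ
      have h2 : chi N f a b l μ * chi N f b d m μ = 0 := by
        rw [not_and_or] at hμ
        rcases hμ with h | h
        · rw [chi, if_neg fun h' => h h'.1, zero_mul]
        · rw [mul_comm, chi, if_neg fun h' => h h'.2, zero_mul]
      simp [h1, h2]

end Lines

/-! ### Change of basis -/

/-- The label with the opposite sign. -/
def Label.flip : Label → Label
  | .down => .up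
  | .up => .down
  | s => s

section Lines

variable {V : Type*} [LinearOrder V] {N : Finset V} {f a b d l m n μ : V → Label} {i j : V}

open Classical in
/-- The orientation obtained by reversing the circles through the vertices in `T`. -/
noncomputable def flipOn (a b : V → Label) (T : Finset V) (l : V → Label) (v : V) : Label :=
  if ∃ w ∈ T, Loop a b w v then (l v).flip else l v

theorem flipOn_empty : flipOn a b ∅ l = l := by
  funext v
  simp [flipOn]

theorem Fits.flipOn_off (hd : Compat N f d) (hl : Fits N f d l) (T : Finset V) {v : V}
    (hv : v ∉ N) : flipOn a b T l v = f v := by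
  have h := hl.sgn_eq_zero hd hv
  rw [← hl.off v hv, flipOn]
  split_ifs
  · generalize l v = s at h ⊢
    cases s <;> simp_all [Label.sgn, Label.flip]
  · rfl

theorem flip_opposite {s t : Label} (h : (s = .down ∧ t = .up) ∨ (s = .up ∧ t = .down)) :
    (s.flip = .down ∧ t.flip = .up) ∨ (s.flip = .up ∧ t.flip = .down) := by
  rcases h with ⟨rfl, rfl⟩ | ⟨rfl, rfl⟩ <;> simp [Label.flip]

theorem flipOn_cup {T : Finset V} (hij : Loop a b i j)
    (h : (l i = .down ∧ l j = .up) ∨ (l i = .up ∧ l j = .down)) :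
    (flipOn a b T l i = .down ∧ flipOn a b T l j = .up) ∨
      (flipOn a b T l i = .up ∧ flipOn a b T l j = .down) := by
  have hr := Loop.equivalence a b
  have : (∃ w ∈ T, Loop a b w i) ↔ ∃ w ∈ T, Loop a b w j :=
    ⟨fun ⟨w, hw, h⟩ => ⟨w, hw, hr.trans h hij⟩, fun ⟨w, hw, h⟩ => ⟨w, hw, hr.trans h (hr.symm hij)⟩⟩
  by_cases hT : ∃ w ∈ T, Loop a b w j
  · simp only [flipOn, if_pos hT, if_pos (this.2 hT)]
    exact flip_opposite h
  · simpa only [flipOn, if_neg hT, if_neg (mt this.1 hT)] using h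

theorem Fits.flipOn_left (ha : Compat N f a) (hla : Fits N f a l) (T : Finset V) :
    Fits N f a (flipOn a b T l) :=
  ⟨fun _ => hla.flipOn_off ha T, fun i j h => flipOn_cup h.loop_left (hla.cup i j h)⟩

theorem Fits.flipOn_right (hb : Compat N f b) (hlb : Fits N f b l) (T : Finset V) :
    Fits N f b (flipOn a b T l) :=
  ⟨fun _ => hlb.flipOn_off hb T, fun i j h => flipOn_cup h.loop_right (hlb.cup i j h)⟩

variable [Fintype V]

theorem flipOn_rep {T : Finset V} (hT : T ⊆ reps id (Loop a b)) {v : V}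
    (hv : v ∈ reps id (Loop a b)) [Decidable (v ∈ T)] :
    flipOn a b T l v = if v ∈ T then (l v).flip else l v := by
  have hr := Loop.equivalence a b
  have : (∃ w ∈ T, Loop a b w v) ↔ v ∈ T := by
    refine ⟨fun ⟨w, hw, h⟩ => ?_, fun h => ⟨v, h, hr.refl v⟩⟩
    rwa [← (mem_reps.1 (hT hw)).eq hr Function.injective_id (mem_reps.1 hv) h]
  simp only [flipOn, this]

theorem lineDegree_flipOn {T : Finset V} (hT : T ⊆ reps id (Loop a b)) (hl : ∀ v ∈ T, l v = .up)
    (hne : T.Nonempty) : lineDegree a b (flipOn a b T l) < lineDegree a b l := by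
  classical
  rw [lineDegree, lineDegree, neg_lt_neg_iff]
  refine Finset.sum_lt_sum (fun v hv => ?_) ?_
  · rw [flipOn_rep hT hv]
    split_ifs with h
    · simp [hl v h, Label.flip, Label.sgn]
    · rfl
  · obtain ⟨v, hv⟩ := hne
    refine ⟨v, hT hv, ?_⟩
    rw [flipOn_rep hT (hT hv), if_pos hv, hl v hv]
    simp [Label.flip, Label.sgn]

open Classical in
/-- The function on orientations `μ` obtained from the oriented circle diagram `(a l b)`, where a
circle of colour `c` contributes the factor `P e s c` if its first vertex has the parity `e` and
the label `s`. -/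
noncomputable def loopFun (P : ℤ → Label → ℤ → ℂ) (N : Finset V) (f a b l μ : V → Label) : ℂ :=
  if Fits N f a μ ∧ Fits N f b μ then
    ∏ v ∈ reps id (Loop a b), P (par N v) (l v) (lineColour N μ v) else 0

/-- The functions given by the diagrams of degree less than `k`. -/
noncomputable def lower (P : ℤ → Label → ℤ → ℂ) (N : Finset V) (f a b : V → Label) (k : ℤ) :
    Submodule ℂ ((V → Label) → ℂ) :=
  Submodule.span ℂ (loopFun P N f a b '' {n | Fits N f a n ∧ Fits N f b n ∧ lineDegree a b n < k})

variable {P Q : ℤ → Label → ℤ → ℂ} {κ : ℤ → ℂ} {k k' : ℤ}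

theorem lower_mono (h : k ≤ k') : lower P N f a b k ≤ lower P N f a b k' :=
  Submodule.span_mono (Set.image_mono fun _ hn => ⟨hn.1, hn.2.1, hn.2.2.trans_le h⟩)

theorem loopFun_mem_lower (hna : Fits N f a n) (hnb : Fits N f b n) (hk : lineDegree a b n < k) :
    loopFun P N f a b n ∈ lower P N f a b k :=
  Submodule.subset_span ⟨n, ⟨hna, hnb, hk⟩, rfl⟩

theorem mem_lower {g : (V → Label) → ℂ} (hg : g ∈ lower P N f a b k) :
    ∃ ρ : (V → Label) → ℂ, (∀ n, ρ n ≠ 0 → Fits N f a n ∧ Fits N f b n ∧ lineDegree a b n < k) ∧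
      g = ∑ n, ρ n • loopFun P N f a b n := by
  rw [lower, Finsupp.mem_span_image_iff_linearCombination] at hg
  obtain ⟨ρ, hρ, rfl⟩ := hg
  refine ⟨ρ, fun n hn => hρ (Finsupp.mem_support_iff.2 hn), ?_⟩
  rw [Finsupp.linearCombination_apply, Finsupp.sum_fintype _ _ (by simp)]

theorem loopFun_sub_mem (ha : Compat N f a) (hb : Compat N f b) (hla : Fits N f a l)
    (hlb : Fits N f b l) (hPQ : ∀ e s c, s ≠ .up → P e s c = Q e s c)
    (hup : ∀ e c, P e .up c = Q e .up c + κ e * Q e .down c) :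
    loopFun P N f a b l - loopFun Q N f a b l ∈ lower Q N f a b (lineDegree a b l) := by
  classical
  set R := reps id (Loop a b)
  set U := R.filter fun v => l v = .up
  have hexp : loopFun P N f a b l =
      ∑ T ∈ U.powerset, (∏ v ∈ T, κ (par N v)) • loopFun Q N f a b (flipOn a b T l) := by
    funext μ
    rw [Finset.sum_apply]
    by_cases hμ : Fits N f a μ ∧ Fits N f b μ
    · simp only [Pi.smul_apply, loopFun, if_pos hμ, smul_eq_mul]
      have e1 : ∀ v ∈ R, P (par N v) (l v) (lineColour N μ v) =
          (if l v = .up then κ (par N v) * Q (par N v) .down (lineColour N μ v) else 0) +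
            Q (par N v) (l v) (lineColour N μ v) := by
        intro v _
        by_cases h : l v = .up
        · rw [if_pos h, h, hup, add_comm]
        · rw [if_neg h, hPQ _ _ _ h, zero_add]
      rw [Finset.prod_congr rfl e1, Finset.prod_add]
      symm
      refine Finset.sum_subset_zero_on_sdiff (Finset.powerset_mono.2 (Finset.filter_subset _ _))
        ?_ ?_
      · intro T hT
        obtain ⟨hTR, hTU⟩ := Finset.mem_sdiff.1 hT
        rw [Finset.mem_powerset] at hTR hTU
        obtain ⟨v, hv, hvU⟩ := Finset.not_subset.1 hTU
        have : l v ≠ .up := fun h => hvU (Finset.mem_filter.2 ⟨hTR hv, h⟩)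
        rw [Finset.prod_eq_zero hv (if_neg this), zero_mul]
      · intro T hT
        have hTU := Finset.mem_powerset.1 hT
        have hTR : T ⊆ R := hTU.trans (Finset.filter_subset _ _)
        have hTup : ∀ v ∈ T, l v = .up := fun v hv => (Finset.mem_filter.1 (hTU hv)).2
        rw [← Finset.prod_sdiff hTR, mul_left_comm, mul_comm, ← Finset.prod_mul_distrib]
        congr 1
        · refine Finset.prod_congr rfl fun v hv => ?_
          rw [flipOn_rep hTR (hTR hv), if_pos hv, if_pos (hTup v hv), hTup v hv]
          rfl
        · refine Finset.prod_congr rfl fun v hv => ?_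
          obtain ⟨h1, h2⟩ := Finset.mem_sdiff.1 hv
          rw [flipOn_rep hTR h1, if_neg h2]
    · simp only [Pi.smul_apply, loopFun, if_neg hμ, smul_zero, Finset.sum_const_zero]
  rw [hexp, ← Finset.add_sum_erase _ _ (Finset.empty_mem_powerset U), flipOn_empty,
    Finset.prod_empty, one_smul, add_sub_cancel_left]
  refine Submodule.sum_mem _ fun T hT => Submodule.smul_mem _ _ ?_
  obtain ⟨hne, hT⟩ := Finset.mem_erase.1 hT
  have hTU := Finset.mem_powerset.1 hT
  exact loopFun_mem_lower (hla.flipOn_left ha T) (hlb.flipOn_right hb T)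
    (lineDegree_flipOn (hTU.trans (Finset.filter_subset _ _))
      (fun v hv => (Finset.mem_filter.1 (hTU hv)).2) (Finset.nonempty_iff_ne_empty.2 hne))

theorem lower_le (ha : Compat N f a) (hb : Compat N f b)
    (hPQ : ∀ e s c, s ≠ .up → P e s c = Q e s c)
    (hup : ∀ e c, P e .up c = Q e .up c + κ e * Q e .down c) :
    lower P N f a b k ≤ lower Q N f a b k := by
  refine Submodule.span_le.2 ?_
  rintro _ ⟨n, ⟨hna, hnb, hn⟩, rfl⟩
  rw [SetLike.mem_coe, ← sub_add_cancel (loopFun P N f a b n) (loopFun Q N f a b n)]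
  exact Submodule.add_mem _ (lower_mono hn.le (loopFun_sub_mem ha hb hna hnb hPQ hup))
    (loopFun_mem_lower hna hnb hn)

/-- The factor of a circle of colour `c` whose first vertex has the parity `e` and the label `s`. It
vanishes if `s` is `up` and `c` is the colour for the label `down`. -/
noncomputable def psi (e : ℤ) (s : Label) (c : ℤ) : ℂ :=
  match s with
  | .down => (theta c)⁻¹
  | .up => (c - e) * (theta c)⁻¹
  | _ => 1

theorem phi_eq_psi (e : ℤ) (s : Label) (c : ℤ) (hs : s ≠ .up) : phi s c = psi e s c := by
  cases s <;> first | rfl | exact absurd rfl hs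

theorem phi_up_eq (e c : ℤ) : phi .up c = psi e .up c + (e : ℂ) * psi e .down c := by
  simp only [phi, psi]
  ring

theorem psi_up_eq (e c : ℤ) : psi e .up c = phi .up c + (-e : ℂ) * phi .down c := by
  simp only [phi, psi]
  ring

theorem thetaProd_mul_mem (ha : Compat N f a) (hb : Compat N f b) (hd : Compat N f d)
    {g g' : (V → Label) → ℂ} (hg : g ∈ lower (fun _ => phi) N f a b k)
    (hg' : g' ∈ lower (fun _ => phi) N f b d k') :
    thetaProd N b * (g * g') ∈
      lower (fun _ => phi) N f a d (k + k' + (cupList b).length - 1) := by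
  suffices h : Submodule.map (LinearMap.mulLeft ℂ (thetaProd N b))
      (lower (fun _ => phi) N f a b k * lower (fun _ => phi) N f b d k') ≤
        lower (fun _ => phi) N f a d (k + k' + (cupList b).length - 1) from
    h ⟨g * g', Submodule.mul_mem_mul hg hg', rfl⟩
  rw [Submodule.map_le_iff_le_comap, lower, lower, Submodule.span_mul_span, Submodule.span_le]
  rintro _ ⟨_, ⟨l, ⟨hla, hlb, hl⟩, rfl⟩, _, ⟨m, ⟨hmb, hmd, hm⟩, rfl⟩, rfl⟩
  obtain ⟨ρ, hρ, h⟩ := chi_mul_chi ha hb hd hla hlb hmb hmd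
  have e : thetaProd N b * (loopFun (fun _ => phi) N f a b l * loopFun (fun _ => phi) N f b d m) =
      ∑ n, (khovanovCoeff a l b m d n + ρ n) • loopFun (fun _ => phi) N f a d n := by
    funext μ
    rw [Finset.sum_apply]
    exact h μ
  rw [SetLike.mem_coe, Submodule.mem_comap, LinearMap.mulLeft_apply, e]
  refine Submodule.sum_mem _ fun n _ => ?_
  rw [add_smul]
  refine Submodule.add_mem _ ?_ ?_
  · by_cases h0 : khovanovCoeff a l b m d n = 0
    · simp [h0]
    · obtain ⟨h1, h2, h3⟩ := khovanovCoeff_ne_zero ha hb hd hla hlb hmb hmd h0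
      exact Submodule.smul_mem _ _ (loopFun_mem_lower h1 h2 (by omega))
  · by_cases h0 : ρ n = 0
    · simp [h0]
    · obtain ⟨h1, h2, h3⟩ := hρ n h0
      exact Submodule.smul_mem _ _ (loopFun_mem_lower h1 h2 (by omega))

/-- The functions `loopFun psi` multiply as in Khovanov's algebra, up to terms of lower degree. -/
theorem psi_mul_psi (ha : Compat N f a) (hb : Compat N f b) (hd : Compat N f d)
    (hla : Fits N f a l) (hlb : Fits N f b l) (hmb : Fits N f b m) (hmd : Fits N f d m) :
    ∃ ρ : (V → Label) → ℂ, (∀ n, ρ n ≠ 0 → Fits N f a n ∧ Fits N f d n ∧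
        lineDegree a d n < lineDegree a b l + lineDegree b d m + (cupList b).length) ∧
      thetaProd N b * (loopFun psi N f a b l * loopFun psi N f b d m) =
        ∑ n, (khovanovCoeff a l b m d n + ρ n : ℂ) • loopFun psi N f a d n := by
  classical
  set D := lineDegree a b l + lineDegree b d m + (cupList b).length with hD
  obtain ⟨ρ, hρ, h⟩ := chi_mul_chi ha hb hd hla hlb hmb hmd
  have e : thetaProd N b * (loopFun (fun _ => phi) N f a b l * loopFun (fun _ => phi) N f b d m) =
      ∑ n, (khovanovCoeff a l b m d n + ρ n) • loopFun (fun _ => phi) N f a d n := by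
    funext μ
    rw [Finset.sum_apply]
    exact h μ
  have hle : ∀ k, lower (fun _ => phi) N f a d k ≤ lower psi N f a d k :=
    fun k => lower_le ha hd phi_eq_psi phi_up_eq
  have hpsi : ∀ e s c, s ≠ Label.up → psi e s c = phi s c := fun e s c hs =>
    (phi_eq_psi e s c hs).symm
  have h1 := loopFun_sub_mem ha hb hla hlb hpsi psi_up_eq
  have h2 := loopFun_sub_mem hb hd hmb hmd hpsi psi_up_eq
  have h3 : loopFun psi N f a b l ∈ lower (fun _ => phi) N f a b (lineDegree a b l + 1) :=
    lower_le ha hb hpsi psi_up_eq (loopFun_mem_lower hla hlb (by omega))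
  have h4 : loopFun (fun _ => phi) N f b d m ∈
      lower (fun _ => phi) N f b d (lineDegree b d m + 1) :=
    loopFun_mem_lower hmb hmd (by omega)
  have h4' : loopFun (fun _ => phi) N f a b l ∈
      lower (fun _ => phi) N f a b (lineDegree a b l + 1) :=
    loopFun_mem_lower hla hlb (by omega)
  have h5 : thetaProd N b * (loopFun psi N f a b l * loopFun psi N f b d m) -
      ∑ n, (khovanovCoeff a l b m d n : ℂ) • loopFun psi N f a d n ∈ lower psi N f a d D := by
    have h6 := thetaProd_mul_mem ha hb hd h3 h2
    have h7 := thetaProd_mul_mem ha hb hd h1 h4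
    have h8 : ∑ n, (khovanovCoeff a l b m d n : ℂ) • (loopFun (fun _ => phi) N f a d n -
        loopFun psi N f a d n) ∈ lower psi N f a d D := by
      refine Submodule.sum_mem _ fun n _ => ?_
      by_cases h0 : khovanovCoeff a l b m d n = 0
      · simp [h0]
      · obtain ⟨h8, h9, h10⟩ := khovanovCoeff_ne_zero ha hb hd hla hlb hmb hmd h0
        refine Submodule.smul_mem _ _ ?_
        rw [hD, ← h10]
        exact loopFun_sub_mem ha hd h8 h9 phi_eq_psi phi_up_eq
    have h9 : ∑ n, ρ n • loopFun (fun _ => phi) N f a d n ∈ lower psi N f a d D := by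
      refine Submodule.sum_mem _ fun n _ => ?_
      by_cases h0 : ρ n = 0
      · simp [h0]
      · obtain ⟨h9, h10, h11⟩ := hρ n h0
        exact Submodule.smul_mem _ _ (hle _ (loopFun_mem_lower h9 h10 h11))
    have h10 := Submodule.add_mem _ (Submodule.add_mem _ (lower_mono (k' := D) (by omega) (hle _ h6))
      (lower_mono (k' := D) (by omega) (hle _ h7))) (Submodule.add_mem _ h8 h9)
    convert h10 using 1
    simp only [add_smul, Finset.sum_add_distrib] at e
    simp only [smul_sub, Finset.sum_sub_distrib]
    linear_combination e
  obtain ⟨ρ', hρ', h6⟩ := mem_lower h5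
  refine ⟨ρ', hρ', ?_⟩
  simp only [add_smul, Finset.sum_add_distrib, ← h6]
  abel

end Lines

/-! ### Triangularity -/

/-- A numbering of the labels. -/
def Label.rank : Label → ℕ
  | .nought => 0
  | .cross => 1
  | .down => 2
  | .up => 3

theorem Label.rank_injective : Function.Injective Label.rank := by
  intro s t h
  cases s <;> cases t <;> simp_all [Label.rank]

/-- Labellings are ordered lexicographically. -/
def lexKey {V : Type*} (l : V → Label) : Lex (V → ℕ) := toLex fun v => (l v).rank

theorem lexKey_injective {V : Type*} : Function.Injective (lexKey (V := V)) := by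
  intro l m h
  funext v
  exact Label.rank_injective (congrFun (toLex.injective h) v)

section Lines

variable {V : Type*} [LinearOrder V] [Fintype V] {N : Finset V} {f a b d l m n μ : V → Label}
  {i j : V}

theorem fits_of_loopFun_ne_zero {P : ℤ → Label → ℤ → ℂ} (h : loopFun P N f a b l μ ≠ 0) :
    Fits N f a μ ∧ Fits N f b μ := by
  by_contra h'
  exact h (if_neg h')

theorem loopFun_psi_self_ne_zero (hla : Fits N f a l) (hlb : Fits N f b l) :
    loopFun psi N f a b l l ≠ 0 := by
  rw [loopFun, if_pos ⟨hla, hlb⟩, Finset.prod_ne_zero_iff]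
  intro v _
  rw [lineColour]
  have h1 := theta_ne_zero (par N v * (l v).sgn)
  cases h : l v
  · exact one_ne_zero
  · exact one_ne_zero
  · exact inv_ne_zero (by rwa [h] at h1)
  · refine mul_ne_zero ?_ (inv_ne_zero (by rwa [h] at h1))
    rcases par_eq_or N v with h' | h' <;> rw [h'] <;> norm_num [Label.sgn]

theorem up_of_loopFun_psi_ne_zero (ha : Compat N f a) (hla : Fits N f a l)
    (h : loopFun psi N f a b l μ ≠ 0) {v : V} (hv : v ∈ reps id (Loop a b)) (hlv : l v = .up) :
    μ v = .up := by
  have hμ := fits_of_loopFun_ne_zero h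
  have hvN : v ∈ N := by
    by_contra hv
    have := hla.sgn_eq_zero ha hv
    rw [hlv] at this
    cases this
  rw [loopFun, if_pos hμ, Finset.prod_ne_zero_iff] at h
  have h1 := h v hv
  rw [hlv, psi] at h1
  refine (hμ.1.active ha hvN).resolve_left fun hd => h1 ?_
  simp [lineColour, hd, Label.sgn]

/-- If two orientations of a circle diagram differ at a vertex, they differ at the first vertex of
its circle. -/
theorem exists_rep_of_ne (ha : Compat N f a) (hb : Compat N f b) (hla : Fits N f a l)
    (hlb : Fits N f b l) (h : loopFun psi N f a b l μ ≠ 0) {v : V} (hv : l v ≠ μ v) :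
    ∃ u ∈ reps id (Loop a b), Loop a b v u ∧ u ≤ v ∧ l u = .down ∧ μ u = .up := by
  obtain ⟨hμa, hμb⟩ := fits_of_loopFun_ne_zero h
  have hr := Loop.equivalence a b
  obtain ⟨u, hvu, hu⟩ := exists_isRep (key := id) hr v
  have hvN : v ∈ N := by
    by_contra hvN
    exact hv ((hla.off v hvN).trans (hμa.off v hvN).symm)
  have huN := (hvu.mem_iff ha hb).1 hvN
  have hne : l u ≠ μ u := by
    intro h'
    have h1 := hvu.lineColour_eq ha hb hla hlb
    have h2 := hvu.lineColour_eq ha hb hμa hμb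
    rw [lineColour, lineColour, h'] at h1
    rw [lineColour, lineColour, ← h1] at h2
    refine hv (Label.sgn_injOn (hla.active ha hvN) ?_)
    rcases par_eq_or N v with h | h <;> rw [h] at h2 <;> linarith
  have hu' := mem_reps.2 hu
  refine ⟨u, hu', hvu, hu v (hr.symm hvu), ?_⟩
  have h3 := up_of_loopFun_psi_ne_zero ha hla h hu'
  rcases hla.active ha huN with h4 | h4
  · refine ⟨h4, (hμa.active ha huN).resolve_left fun h5 => hne (h4.trans h5.symm)⟩
  · exact absurd (h4.trans (h3 h4).symm) hne

theorem lexKey_le (ha : Compat N f a) (hb : Compat N f b) (hla : Fits N f a l)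
    (hlb : Fits N f b l) (h : loopFun psi N f a b l μ ≠ 0) : lexKey l ≤ lexKey μ := by
  rcases eq_or_ne l μ with rfl | hne
  · exact le_rfl
  have hD : (Finset.univ.filter fun v => l v ≠ μ v).Nonempty := by
    obtain ⟨v, hv⟩ := Function.ne_iff.1 hne
    exact ⟨v, by simpa using hv⟩
  obtain ⟨v, hv, hmin⟩ := Finset.exists_min_image _ id hD
  simp only [Finset.mem_filter, Finset.mem_univ, true_and, id] at hv hmin
  obtain ⟨u, -, -, huv, h1, h2⟩ := exists_rep_of_ne ha hb hla hlb h hv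
  have hu : u = v := le_antisymm huv (hmin u (by rw [h1, h2]; decide))
  subst hu
  refine le_of_lt ⟨u, fun w hw => ?_, ?_⟩
  · have : l w = μ w := by
      by_contra h'
      exact hw.not_ge (hmin w h')
    simp [lexKey, this]
  · simp [lexKey, h1, h2, Label.rank]

/-- The first and the last vertex of a circle have opposite labels. -/
theorem sgn_last (ha : Compat N f a) (hb : Compat N f b) (hμa : Fits N f a μ) (hμb : Fits N f b μ)
    {u w : V} (hu : u ∈ N) (huw : Loop a b u w) (hfirst : ∀ v, Loop a b u v → u ≤ v)
    (hlast : ∀ v, Loop a b u v → v ≤ w) : (μ w).sgn = - (μ u).sgn := by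
  classical
  have hr := Loop.equivalence a b
  set C := Finset.univ.filter fun v => Loop a b u v
  have hC : ∀ v, v ∈ C ↔ Loop a b u v := by simp [C]
  have hCN : ∀ v ∈ C, v ∈ N := fun v hv => (((hC v).1 hv).mem_iff ha hb).1 hu
  have hmate : ∀ {c}, Compat N f c → (∀ {i j}, Cup c i j → Loop a b i j) →
      ∀ v ∈ C, mate c v ∈ C ∧ mate c v ≠ v := by
    intro c hc hcl v hv
    refine ⟨(hC _).2 (hr.trans ((hC v).1 hv) ?_), (hc.mate_mem (hCN v hv)).2⟩
    rcases hc.cup_mate (hCN v hv) with ⟨-, h⟩ | ⟨-, h⟩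
    exacts [hcl h, hr.symm (hcl h)]
  have hCa := hmate ha fun h => h.loop_left
  have hCb := hmate hb fun h => h.loop_right
  have hmem : ∀ {v v'}, Loop a b v v' → (v ∈ C ↔ v' ∈ C) := by
    intro v v' h
    rw [hC, hC]
    exact ⟨fun h' => hr.trans h' h, fun h' => hr.trans h' (hr.symm h)⟩
  have hconst : (u ∈ C ↔ w ∈ C) ∧ (u ∈ C → par C u * (μ u).sgn = par C w * (μ w).sgn) := by
    refine huw.le (r := fun u w => (u ∈ C ↔ w ∈ C) ∧
      (u ∈ C → par C u * (μ u).sgn = par C w * (μ w).sgn)) ⟨fun _ => ⟨Iff.rfl, fun _ => rfl⟩,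
      fun h => ⟨h.1.symm, fun h' => (h.2 (h.1.2 h')).symm⟩,
      fun h h' => ⟨h.1.trans h'.1, fun h1 => (h.2 h1).trans (h'.2 (h.1.1 h1))⟩⟩ ?_ ?_
    · intro i j h
      refine ⟨hmem h.loop_left, fun hi => ?_⟩
      rw [h.par_eq hi hCa, hμa.sgn_eq h, neg_mul_neg]
    · intro i j h
      refine ⟨hmem h.loop_right, fun hi => ?_⟩
      rw [h.par_eq hi hCb, hμb.sgn_eq h, neg_mul_neg]
  have huC : u ∈ C := (hC u).2 (hr.refl u)
  have hwC : w ∈ C := (hC w).2 huw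
  have h1 : par C u = 1 := by
    rw [par, Finset.filter_eq_empty_iff.2]
    · simp
    · exact fun v hv => (hfirst v ((hC v).1 hv)).not_gt
  have h2 : par C w = -1 := by
    have : C.filter (· < w) = C.erase w := by
      ext v
      simp only [Finset.mem_filter, Finset.mem_erase]
      constructor
      · exact fun h => ⟨h.2.ne, h.1⟩
      · exact fun h => ⟨h.2, lt_of_le_of_ne (hlast v ((hC v).1 h.2)) h.1⟩
    have heven := even_card_of_involutive C (mate a) (fun v hv => (hCa v hv).1)
      (fun v _ => mate_mate a v) fun v hv => (hCa v hv).2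
    rw [par, this, Finset.card_erase_of_mem hwC]
    refine Odd.neg_one_pow ?_
    have := Finset.card_pos.2 ⟨w, hwC⟩
    exact Nat.Even.sub_odd this heven odd_one
  have h3 := hconst.2 huC
  rw [h1, h2] at h3
  linarith

/-- If `μ` has labels `down` at all vertices to the left of a vertex, then so has `l`. -/
theorem down_of_loopFun_psi_ne_zero (ha : Compat N f a) (hb : Compat N f b) (hla : Fits N f a l)
    (hlb : Fits N f b l) (h : loopFun psi N f a b l μ ≠ 0) {v : V}
    (hv : ∀ u ≤ v, μ u = .down) : l v = .down := by
  by_contra hne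
  rw [← hv v le_rfl] at hne
  obtain ⟨u, -, -, huv, -, h2⟩ := exists_rep_of_ne ha hb hla hlb h hne
  rw [hv u huv] at h2
  cases h2

/-- If `μ` has labels `up` at all vertices to the right of a vertex, then so has `l`. -/
theorem up_of_le_of_loopFun_psi_ne_zero (ha : Compat N f a) (hb : Compat N f b)
    (hla : Fits N f a l) (hlb : Fits N f b l) (h : loopFun psi N f a b l μ ≠ 0) {v : V}
    (hv : ∀ u ≥ v, μ u = .up) : l v = .up := by
  by_contra hne
  rw [← hv v le_rfl] at hne
  obtain ⟨hμa, hμb⟩ := fits_of_loopFun_ne_zero h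
  have hr := Loop.equivalence a b
  obtain ⟨u, hu, hvu, -, -, h2⟩ := exists_rep_of_ne ha hb hla hlb h hne
  have huN : u ∈ N := by
    by_contra huN
    have := hμa.sgn_eq_zero ha huN
    rw [h2] at this
    cases this
  obtain ⟨w, hw, hlast⟩ := Set.exists_max_image {w | Loop a b u w} id (Set.toFinite _)
    ⟨u, hr.refl u⟩
  have h3 := sgn_last ha hb hμa hμb huN hw (fun v hv => mem_reps.1 hu v hv) hlast
  rw [h2, hv w (hlast v (hr.symm hvu))] at h3
  norm_num [Label.sgn] at h3

/-- Only the weight itself has degree zero in its cup diagram. -/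
theorem eq_of_cupDegree_eq_zero (ha : Compat N f a) (hl : Fits N f a l)
    (h : cupDegree a l = 0) : l = a := by
  rw [cupDegree, Set.ncard_eq_zero] at h
  have hcup : ∀ i j, Cup a i j → l i = .down ∧ l j = .up := by
    intro i j hij
    refine (hl.cup i j hij).resolve_right fun h' => ?_
    have : (i, j) ∈ {p : V × V | Cup a p.1 p.2 ∧ l p.1 = .up} := ⟨hij, h'.1⟩
    rw [h] at this
    exact this
  funext v
  by_cases hv : v ∈ N
  · obtain ⟨j, h | h⟩ := ha.full v hv
    · rw [(hcup _ _ h).1, h.down]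
    · rw [(hcup _ _ h).2, h.up]
  · rw [hl.off v hv, ha.off v hv]

theorem cupDegree_self (a : V → Label) : cupDegree a a = 0 := by
  rw [cupDegree, Set.ncard_eq_zero]
  ext p
  simp only [Set.mem_ofPred_eq, Set.mem_empty_iff_false, iff_false]
  rintro ⟨h1, h2⟩
  rw [h1.down] at h2
  cases h2

/-- On the diagram `(a a a)` the function is the indicator function of the orientations of `a`. -/
theorem thetaProd_mul_loopFun_self (ha : Compat N f a) (hμ : Fits N f a μ) :
    thetaProd N a μ * loopFun psi N f a a a μ = 1 := by
  classical
  have hr := Loop.equivalence a a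
  have hloop : ∀ u v, Loop a a u v → v = u ∨ v = mate a u := by
    intro u v h
    refine h.le (r := fun u v => v = u ∨ v = mate a u) ⟨fun _ => Or.inl rfl, ?_, ?_⟩ ?_ ?_
    · rintro x y (rfl | rfl)
      exacts [Or.inl rfl, Or.inr (mate_mate _ _).symm]
    · rintro x y z (rfl | rfl) (rfl | rfl)
      exacts [Or.inl rfl, Or.inr rfl, Or.inr rfl, Or.inl (mate_mate _ _)]
    · exact fun i j h => Or.inr h.mate_left.symm
    · exact fun i j h => Or.inr h.mate_left.symm
  have e1 : thetaProd N a μ =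
      ∏ v, if v ∈ N ∧ v < mate a v then theta (lineColour N μ v) else 1 := by
    rw [thetaProd, ← List.prod_toFinset _ (nodup_cupList a), ← Finset.prod_filter]
    refine Finset.prod_bij (fun p _ => p.1) ?_ ?_ ?_ fun _ _ => rfl
    · intro p hp
      have hp := mem_cupList.1 (List.mem_toFinset.1 hp)
      refine Finset.mem_filter.2 ⟨Finset.mem_univ _, ha.left_mem hp, ?_⟩
      rw [hp.mate_left]
      exact hp.lt
    · intro p hp q hq h
      have hp := mem_cupList.1 (List.mem_toFinset.1 hp)
      have hq := mem_cupList.1 (List.mem_toFinset.1 hq)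
      refine Prod.ext h (hp.right_unique ?_)
      rw [h]
      exact hq
    · intro v hv
      obtain ⟨hvN, hv⟩ := (Finset.mem_filter.1 hv).2
      rcases ha.cup_mate hvN with ⟨-, h⟩ | ⟨h, -⟩
      · exact ⟨(v, mate a v), List.mem_toFinset.2 (mem_cupList.2 h), rfl⟩
      · exact absurd h hv.asymm
  rw [e1, loopFun, if_pos ⟨hμ, hμ⟩, reps, Finset.prod_filter, ← Finset.prod_mul_distrib]
  refine Finset.prod_eq_one fun v _ => ?_
  by_cases hv : v ∈ N
  · rcases ha.cup_mate hv with ⟨h1, h2⟩ | ⟨h1, h2⟩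
    · have hrep : IsRep id (Loop a a) v := by
        intro u hu
        rcases hloop v u hu with rfl | rfl
        exacts [le_rfl, h1.le]
      rw [if_pos ⟨hv, h1⟩, if_pos hrep, h2.down]
      exact mul_inv_cancel₀ (theta_ne_zero _)
    · have hrep : ¬ IsRep id (Loop a a) v := fun h => (h _ (hr.symm h2.loop_left)).not_gt h1
      rw [if_neg fun h => h.2.asymm h1, if_neg hrep, mul_one]
  · rw [if_neg fun h => hv h.1, one_mul]
    split_ifs
    · have h0 := ha.fits_self.sgn_eq_zero ha hv
      generalize a v = s at h0 ⊢
      cases s <;> simp_all [Label.sgn, psi]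
    · rfl

end Lines

/-! ### Blocks and windows -/

section Blocks

variable {V : Type*} [LinearOrder V] {w u : V → Label} {i j : V}

/-- A labelling in which every initial segment ending in an `up` has at least as many `down`s as
`up`s, and which has as many `down`s as `up`s, has no rays. -/
theorem exists_cup_of_card_le [Fintype V] [LocallyFiniteOrder V]
    (h : ∀ y, w y = .up → (Finset.univ.filter fun v => v ≤ y ∧ w v = .up).card ≤
      (Finset.univ.filter fun v => v < y ∧ w v = .down).card)
    (hcard : (Finset.univ.filter fun v => w v = .up).card =
      (Finset.univ.filter fun v => w v = .down).card) {v : V} (hv : w v = .down ∨ w v = .up) :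
    ∃ j, Cup w v j ∨ Cup w j v := by
  have hup : ∀ y, w y = .up → ∃ x, Cup w x y := by
    intro y hy
    by_contra hcon
    push Not at hcon
    have h1 : (Finset.univ.filter fun v => v < y ∧ w v = .down).card ≤
        (Finset.univ.filter fun v => v < y ∧ w v = .up).card := by
      refine Finset.card_le_card_of_injOn (mate w) ?_ ?_
      · intro x hx
        obtain ⟨hxy, hx⟩ := (Finset.mem_filter.1 hx).2
        obtain ⟨z, hz⟩ := (exists_cup_of_down_up hxy hx hy).resolve_right fun ⟨k, hk⟩ => hcon k hk
        rw [hz.mate_left]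
        refine Finset.mem_coe.2 (Finset.mem_filter.2 ⟨Finset.mem_univ _, ?_, hz.up⟩)
        rcases lt_trichotomy z y with h | rfl | h
        · exact h
        · exact absurd hz (hcon x)
        · obtain ⟨k, hk, -⟩ := hz.exists_of_up hxy h hy
          exact absurd hk (hcon k)
      · intro x _ x' _ hxx'
        rw [← mate_mate w x, hxx', mate_mate]
    have h2 : (Finset.univ.filter fun v => v < y ∧ w v = .up).card <
        (Finset.univ.filter fun v => v ≤ y ∧ w v = .up).card := by
      refine Finset.card_lt_card ⟨fun x hx => ?_, fun hsub => ?_⟩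
      · obtain ⟨h1, h2⟩ := (Finset.mem_filter.1 hx).2
        exact Finset.mem_filter.2 ⟨Finset.mem_univ _, h1.le, h2⟩
      · have := hsub (Finset.mem_filter.2 ⟨Finset.mem_univ y, le_rfl, hy⟩)
        exact lt_irrefl _ (Finset.mem_filter.1 this).2.1
    exact absurd (h y hy) (by omega)
  rcases hv with hv | hv
  · have hsurj := Finset.surj_on_of_inj_on_of_card_le
      (s := Finset.univ.filter fun v => w v = .up) (t := Finset.univ.filter fun v => w v = .down)
      (fun y _ => mate w y) ?_ ?_ hcard.ge v (Finset.mem_filter.2 ⟨Finset.mem_univ _, hv⟩)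
    · obtain ⟨y, hy, hvy⟩ := hsurj
      obtain ⟨x, hx⟩ := hup y (Finset.mem_filter.1 hy).2
      rw [hx.mate_right] at hvy
      subst hvy
      exact ⟨y, Or.inl hx⟩
    · intro y hy
      obtain ⟨x, hx⟩ := hup y (Finset.mem_filter.1 hy).2
      rw [hx.mate_right]
      exact Finset.mem_filter.2 ⟨Finset.mem_univ _, hx.down⟩
    · intro x x' _ _ hxx'
      rw [← mate_mate w x, hxx', mate_mate]
  · obtain ⟨x, hx⟩ := hup v hv
    exact ⟨x, Or.inr hx⟩

/-- Linked labellings differ at active vertices only. -/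
theorem Linked.eq_or_active (h : Linked w u) (i : V) :
    w i = u i ∨ ((w i = .down ∨ w i = .up) ∧ (u i = .down ∨ u i = .up)) := by
  induction h with
  | refl x => exact Or.inl rfl
  | symm x y _ ih =>
    rcases ih with h | h
    exacts [Or.inl h.symm, Or.inr h.symm]
  | trans x y z _ _ ih1 ih2 =>
    rcases ih1 with h | h <;> rcases ih2 with h' | h'
    · exact Or.inl (h.trans h')
    · exact Or.inr ⟨by rw [h]; exact h'.1, h'.2⟩
    · exact Or.inr ⟨h.1, by rw [← h']; exact h.2⟩
    · exact Or.inr ⟨h.1, h'.2⟩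
  | rel x y h =>
    obtain ⟨a, b, -, ha, hb, rfl⟩ := h
    by_cases h1 : i = a
    · subst h1
      exact Or.inr ⟨Or.inl ha, by simp [hb]⟩
    by_cases h2 : i = b
    · subst h2
      exact Or.inr ⟨Or.inr hb, by simp [ha]⟩
    exact Or.inl (by simp [Equiv.swap_apply_of_ne_of_ne h1 h2])

theorem linked_swap (hij : i ≠ j) (hi : w i = .down) (hj : w j = .up) :
    Linked w (w ∘ Equiv.swap i j) := by
  rcases hij.lt_or_gt with h | h
  · exact .rel _ _ ⟨i, j, h, hi, hj, rfl⟩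
  · refine .symm _ _ (.rel _ _ ⟨j, i, h, by simp [hi], by simp [hj], ?_⟩)
    funext k
    simp [Equiv.swap_comm j i]

theorem linked_of_sum_eq (S : Finset V) (hoff : ∀ i ∉ S, w i = u i)
    (hact : ∀ i, w i = u i ∨ ((w i = .down ∨ w i = .up) ∧ (u i = .down ∨ u i = .up)))
    (hsum : ∑ i ∈ S, (w i).sgn = ∑ i ∈ S, (u i).sgn) : Linked w u := by
  induction hn : (S.filter fun i => w i ≠ u i).card using Nat.strong_induction_on generalizing w with
  | _ n ih =>
  subst hn
  by_cases hne : ∀ i ∈ S, (w i).sgn ≤ (u i).sgn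
  · have heq := (Finset.sum_eq_sum_iff_of_le hne).1 hsum
    have : w = u := by
      funext i
      by_cases hi : i ∈ S
      · rcases hact i with h | h
        · exact h
        · exact Label.sgn_injOn h.1 (heq i hi)
      · exact hoff i hi
    subst this
    exact .refl _
  · have hne' : ¬ ∀ i ∈ S, (u i).sgn ≤ (w i).sgn := by
      intro h
      have heq := (Finset.sum_eq_sum_iff_of_le h).1 hsum.symm
      exact hne fun i hi => (heq i hi).ge
    push Not at hne hne'
    have key : ∀ {s t : Label}, s = t ∨ ((s = .down ∨ s = .up) ∧ (t = .down ∨ t = .up)) →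
        s.sgn < t.sgn → s = .up ∧ t = .down := by
      intro s t
      cases s <;> cases t <;> simp [Label.sgn]
    obtain ⟨i, hi, hlt⟩ := hne
    obtain ⟨j, hj, hlt'⟩ := hne'
    have hact' : ∀ i, u i = w i ∨ ((u i = .down ∨ u i = .up) ∧ (w i = .down ∨ w i = .up)) := by
      intro i
      rcases hact i with h | h
      exacts [Or.inl h.symm, Or.inr h.symm]
    obtain ⟨hui, hwi⟩ := key (hact' i) hlt
    obtain ⟨hwj, huj⟩ := key (hact j) hlt'
    have hij : i ≠ j := by
      rintro rfl
      rw [hwi] at hwj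
      cases hwj
    have hlink := linked_swap hij hwi hwj
    have e : ∀ k, k ≠ i → k ≠ j → (w ∘ Equiv.swap i j) k = w k := fun k h1 h2 => by
      simp [Equiv.swap_apply_of_ne_of_ne h1 h2]
    have ei : (w ∘ Equiv.swap i j) i = u i := by simp [hwj, hui]
    have ej : (w ∘ Equiv.swap i j) j = u j := by simp [hwi, huj]
    have hk : ∀ k, (w ∘ Equiv.swap i j) k = u k ∨ (k ≠ i ∧ k ≠ j) := by
      intro k
      by_cases h1 : k = i
      · exact Or.inl (h1 ▸ ei)
      by_cases h2 : k = j
      · exact Or.inl (h2 ▸ ej)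
      exact Or.inr ⟨h1, h2⟩
    refine .trans _ _ _ hlink (ih _ ?_ ?_ ?_ ?_ rfl)
    · refine Finset.card_lt_card ⟨fun k hkm => ?_, fun hsub => ?_⟩
      · obtain ⟨h1, h2⟩ := Finset.mem_filter.1 hkm
        obtain ⟨h3, h4⟩ := (hk k).resolve_left h2
        rw [e k h3 h4] at h2
        exact Finset.mem_filter.2 ⟨h1, h2⟩
      · have := hsub (Finset.mem_filter.2 ⟨hi, by rw [hwi, hui]; decide⟩)
        exact (Finset.mem_filter.1 this).2 ei
    · intro k hkS
      rcases hk k with h | ⟨h1, h2⟩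
      · exact h
      · rw [e k h1 h2]
        exact hoff k hkS
    · intro k
      rcases hk k with h | ⟨h1, h2⟩
      · exact Or.inl h
      · rw [e k h1 h2]
        exact hact k
    · rw [← hsum]
      refine Finset.sum_equiv (Equiv.swap i j) (fun k => ?_) fun k _ => rfl
      by_cases h1 : k = i
      · subst h1
        simp [hi, hj]
      by_cases h2 : k = j
      · subst h2
        simp [hi, hj]
      rw [Equiv.swap_apply_of_ne_of_ne h1 h2]

variable {Λ : Set (V → Label)}

theorem IsBlock.linked (hΛ : IsBlock Λ) (hw : w ∈ Λ) (hu : u ∈ Λ) : Linked w u := by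
  obtain ⟨w₀, -, rfl⟩ := hΛ
  exact .trans _ _ _ (.symm _ _ hw) hu

theorem IsBlock.mem (hΛ : IsBlock Λ) (hw : w ∈ Λ) (h : Linked w u) : u ∈ Λ := by
  obtain ⟨w₀, -, rfl⟩ := hΛ
  exact .trans _ _ _ hw h

end Blocks

section Windows

variable {J : Set ℤ} {Λ : Set (J → Label)} {m n : ℤ} {w u a l : J → Label} {i j : J}

theorem finite_window (J : Set ℤ) (m n : ℤ) : {i : J | (i : ℤ) ∈ Set.Ico m n}.Finite :=
  (Set.finite_Ico m n).preimage Subtype.val_injective.injOn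

/-- The vertices in a window. -/
noncomputable def window (J : Set ℤ) (m n : ℤ) : Finset J := (finite_window J m n).toFinset

theorem mem_window : i ∈ window J m n ↔ (i : ℤ) ∈ Set.Ico m n := by
  simp [window]

/-- The labels `down … up` of a weight in `Λ` lie in the window. -/
theorem IsWindow.mem_of_down_up (hW : IsWindow Λ m n) (hΛ : IsBlock Λ) (hw : w ∈ Λ) (hij : i ≠ j)
    (hi : w i = .down) (hj : w j = .up) : (i : ℤ) ∈ Set.Ico m n ∧ (j : ℤ) ∈ Set.Ico m n := by
  have hu := hΛ.mem hw (linked_swap hij hi hj)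
  constructor
  · by_contra h
    have := hW.agree w hw _ hu i h
    simp [hi, hj] at this
  · by_contra h
    have := hW.agree w hw _ hu j h
    simp [hi, hj] at this

theorem IsWindow.sum_eq (hW : IsWindow Λ m n) (hΛ : IsBlock Λ) (hw : w ∈ Λ) (hu : u ∈ Λ)
    (g : Label → ℤ) : ∑ i ∈ window J m n, g (w i) = ∑ i ∈ window J m n, g (u i) := by
  have h := hΛ.linked hw hu
  suffices h' : (w ∈ Λ ↔ u ∈ Λ) ∧
      (w ∈ Λ → ∑ i ∈ window J m n, g (w i) = ∑ i ∈ window J m n, g (u i)) from h'.2 hw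
  clear hw hu
  induction h with
  | refl x => exact ⟨Iff.rfl, fun _ => rfl⟩
  | symm x y _ ih => exact ⟨ih.1.symm, fun h => (ih.2 (ih.1.2 h)).symm⟩
  | trans x y z _ _ ih1 ih2 =>
    exact ⟨ih1.1.trans ih2.1, fun h => (ih1.2 h).trans (ih2.2 (ih1.1.1 h))⟩
  | rel x y h =>
    have hxy : Linked x y := .rel _ _ h
    refine ⟨⟨fun hx => hΛ.mem hx hxy, fun hy => hΛ.mem hy (.symm _ _ hxy)⟩, fun hx => ?_⟩
    obtain ⟨i, j, hij, hi, hj, rfl⟩ := h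
    obtain ⟨h1, h2⟩ := hW.mem_of_down_up hΛ hx hij.ne hi hj
    rw [← mem_window] at h1 h2
    symm
    refine Finset.sum_equiv (Equiv.swap i j) (fun k => ?_) fun k _ => rfl
    by_cases hk1 : k = i
    · subst hk1
      simp [h1, h2]
    by_cases hk2 : k = j
    · subst hk2
      simp [h1, h2]
    rw [Equiv.swap_apply_of_ne_of_ne hk1 hk2]

theorem count_eq (m n : ℤ) (s : Label) (w : J → Label) :
    count m n s w = ((window J m n).filter fun i => w i = s).card := by
  rw [count, ← Set.ncard_coe_finset]
  congr 1
  ext i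
  simp [mem_window]

theorem IsWindow.count_eq (hW : IsWindow Λ m n) (hΛ : IsBlock Λ) (hw : w ∈ Λ) (hu : u ∈ Λ)
    (s : Label) : count m n s w = count m n s u := by
  have := hW.sum_eq hΛ hw hu fun t => if t = s then 1 else 0
  simp only [Finset.sum_boole] at this
  rw [ArcAlgebra.count_eq, ArcAlgebra.count_eq]
  exact_mod_cast this

theorem IsWindow.cup_mem (hW : IsWindow Λ m n) (hΛ : IsBlock Λ) (ha : a ∈ Λ) (h : Cup a i j) :
    (i : ℤ) ∈ Set.Ico m n ∧ (j : ℤ) ∈ Set.Ico m n :=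
  hW.mem_of_down_up hΛ ha h.lt.ne h.down h.up

/-- The weight of an oriented cup diagram agrees with the weight of the cup diagram on the rays. -/
theorem IsWindow.eq_of_ray (hW : IsWindow Λ m n) (hΛ : IsBlock Λ) (ha : a ∈ Λ) (hl : l ∈ Λ)
    (h : IsOriented a l) (hi : Ray a i) : l i = a i := by
  classical
  by_cases him : (i : ℤ) ∈ Set.Ico m n
  · set R := (window J m n).filter fun i => Ray a i
    have hrest : ∀ l : J → Label, (∀ i j, Cup a i j → (l i = .down ∧ l j = .up) ∨
        (l i = .up ∧ l j = .down)) → (∀ i, (a i).sgn = 0 → (l i).sgn = 0) →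
        ∑ i ∈ window J m n, (l i).sgn = ∑ i ∈ R, (l i).sgn := by
      intro l hcup h0
      rw [← Finset.sum_filter_add_sum_filter_not (window J m n) fun i => Ray a i]
      rw [add_eq_left]
      refine Finset.sum_involution (fun i _ => mate a i) ?_ ?_ ?_ fun i _ => mate_mate a i
      · intro i hi
        by_cases hc : ∃ j, Cup a i j ∨ Cup a j i
        · obtain ⟨j, hc | hc⟩ := hc
          · rw [hc.mate_left, opposite_sgn (hcup _ _ hc), add_neg_cancel]
          · rw [hc.mate_right, opposite_sgn (hcup _ _ hc), neg_add_cancel]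
        · have hact : (a i).sgn = 0 := by
            rw [Label.sgn_eq_zero]
            intro hact
            push Not at hc
            exact (Finset.mem_filter.1 hi).2 ⟨hact, hc⟩
          rw [mate_eq_self (by simpa using hc), h0 i hact, add_zero]
      · intro i hi hne
        by_cases hc : ∃ j, Cup a i j ∨ Cup a j i
        · obtain ⟨j, hc | hc⟩ := hc
          · rw [hc.mate_left]; exact hc.lt.ne'
          · rw [hc.mate_right]; exact hc.lt.ne
        · refine absurd (h0 i ?_) hne
          rw [Label.sgn_eq_zero]
          intro hact
          push Not at hc
          exact (Finset.mem_filter.1 hi).2 ⟨hact, hc⟩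
      · intro i hi
        obtain ⟨hi, hnr⟩ := Finset.mem_filter.1 hi
        by_cases hc : ∃ j, Cup a i j ∨ Cup a j i
        · obtain ⟨j, hc | hc⟩ := hc
          · rw [hc.mate_left]
            exact Finset.mem_filter.2 ⟨mem_window.2 (hW.cup_mem hΛ ha hc).2,
              fun hr => (hr.2 i).2 hc⟩
          · rw [hc.mate_right]
            exact Finset.mem_filter.2 ⟨mem_window.2 (hW.cup_mem hΛ ha hc).1,
              fun hr => (hr.2 i).1 hc⟩
        · rw [mate_eq_self (by simpa using hc)]
          exact Finset.mem_filter.2 ⟨hi, hnr⟩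
    have h0 : ∀ i, (a i).sgn = 0 → (l i).sgn = 0 := by
      intro i hi
      rcases (hΛ.linked ha hl).eq_or_active i with h | h
      · rwa [← h]
      · exact absurd h.1 (Label.sgn_eq_zero.1 hi)
    have hsum : ∑ i ∈ R, (l i).sgn = ∑ i ∈ R, (a i).sgn := by
      rw [← hrest l h.cup h0, ← hrest a (fun i j h => Or.inl ⟨h.down, h.up⟩) fun _ h => h]
      exact hW.sum_eq hΛ hl ha _
    have hkey : ∀ i ∈ R, (l i).sgn = (a i).sgn := by
      have hactive : ∀ {i}, i ∈ R → (l i = .down ∨ l i = .up) ∧ (a i = .down ∨ a i = .up) :=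
        fun hi => ⟨h.ray _ (Finset.mem_filter.1 hi).2, (Finset.mem_filter.1 hi).2.1⟩
      have hlt : ∀ {i}, i ∈ R → (l i).sgn < (a i).sgn → l i = .up ∧ a i = .down := by
        intro i hi
        rcases (hactive hi).1 with h1 | h1 <;> rcases (hactive hi).2 with h2 | h2 <;>
          simp [h1, h2, Label.sgn]
      have hgt : ∀ {i}, i ∈ R → (a i).sgn < (l i).sgn → l i = .down ∧ a i = .up := by
        intro i hi
        rcases (hactive hi).1 with h1 | h1 <;> rcases (hactive hi).2 with h2 | h2 <;>
          simp [h1, h2, Label.sgn]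
      by_contra hcon
      have h1 : ∃ i ∈ R, (l i).sgn < (a i).sgn := by
        by_contra h'
        push Not at h'
        exact hcon fun i hi => ((Finset.sum_eq_sum_iff_of_le h').1 hsum.symm i hi).symm
      have h2 : ∃ i ∈ R, (a i).sgn < (l i).sgn := by
        by_contra h'
        push Not at h'
        exact hcon fun i hi => (Finset.sum_eq_sum_iff_of_le h').1 hsum i hi
      obtain ⟨x, hx, hxlt⟩ := h1
      obtain ⟨y, hy, hylt⟩ := h2
      obtain ⟨hlx, hax⟩ := hlt hx hxlt
      obtain ⟨hly, hay⟩ := hgt hy hylt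
      rcases lt_trichotomy x y with hxy | rfl | hxy
      · rcases exists_cup_of_down_up hxy hax hay with ⟨k, hk⟩ | ⟨k, hk⟩
        · exact ((Finset.mem_filter.1 hx).2.2 k).1 hk
        · exact ((Finset.mem_filter.1 hy).2.2 k).2 hk
      · rw [hlx] at hly
        cases hly
      · exact h.rays y x hxy (Finset.mem_filter.1 hy).2 (Finset.mem_filter.1 hx).2 ⟨hly, hlx⟩
    exact Label.sgn_injOn (h.ray i hi) (hkey i (Finset.mem_filter.2 ⟨mem_window.2 him, hi⟩))
  · exact hW.agree l hl a ha i him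

end Windows

/-! ### Closures -/

section Closure

variable {J : Set ℤ} {Λ : Set (J → Label)} {m n : ℤ} {p q : ℕ} {w a l : J → Label} {i j : J}
  {u v : Set.Ico (m - p) (n + q)}

theorem closure_of_lt (h : (v : ℤ) < m) : closure m n p q w v = .down := by
  rw [closure, if_pos h]

theorem closure_of_ge (h : m ≤ (v : ℤ)) (h' : n ≤ (v : ℤ)) : closure m n p q w v = .up := by
  rw [closure, if_neg h.not_gt, if_pos h']

theorem closure_of_mem (hi : (i : ℤ) ∈ Set.Ico m n) (hv : (v : ℤ) = i) :
    closure m n p q w v = w i := by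
  have hJ : (v : ℤ) ∈ J := hv ▸ i.2
  rw [closure, if_neg (by rw [hv]; exact hi.1.not_gt), if_neg (by rw [hv]; exact hi.2.not_ge),
    dif_pos hJ]
  congr

theorem position (hsub : Set.Ico m n ⊆ J) (v : Set.Ico (m - p) (n + q)) :
    (v : ℤ) < m ∨ (m ≤ (v : ℤ) ∧ n ≤ (v : ℤ)) ∨ ∃ i : J, (i : ℤ) ∈ Set.Ico m n ∧ (v : ℤ) = i := by
  rcases lt_or_ge (v : ℤ) m with h | h
  · exact Or.inl h
  · rcases lt_or_ge (v : ℤ) n with h' | h'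
    · exact Or.inr (Or.inr ⟨⟨v, hsub ⟨h, h'⟩⟩, ⟨h, h'⟩, rfl⟩)
    · exact Or.inr (Or.inl ⟨h, h'⟩)

theorem exists_position (p q : ℕ) (hi : (i : ℤ) ∈ Set.Ico m n) :
    ∃ v : Set.Ico (m - (p : ℤ)) (n + q), (v : ℤ) = i := by
  have := hi.1
  have := hi.2
  exact ⟨⟨i, by omega, by omega⟩, rfl⟩

theorem cup_closure_iff (hsub : Set.Ico m n ⊆ J) (hi : (i : ℤ) ∈ Set.Ico m n)
    (hj : (j : ℤ) ∈ Set.Ico m n) (hu : (u : ℤ) = i) (hv : (v : ℤ) = j) :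
    Cup (closure m n p q w) u v ↔ Cup w i j := by
  classical
  set g : J → Set.Ico (m - (p : ℤ)) (n + q) := fun x =>
    if h : (x : ℤ) ∈ Set.Ico (m - (p : ℤ)) (n + q) then ⟨x, h⟩ else u
  set f : Set.Ico (m - (p : ℤ)) (n + q) → J := fun x => if h : (x : ℤ) ∈ J then ⟨x, h⟩ else i
  have hg : ∀ x : J, (x : ℤ) ∈ Set.Ico m n → (g x : ℤ) = x := by
    intro x hx
    have := hx.1
    have := hx.2
    have h : (x : ℤ) ∈ Set.Ico (m - (p : ℤ)) (n + q) := ⟨by omega, by omega⟩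
    simp only [g, dif_pos h]
  have hf : ∀ x : Set.Ico (m - (p : ℤ)) (n + q), (x : ℤ) ∈ Set.Ico m n → (f x : ℤ) = x := by
    intro x hx
    simp only [f, dif_pos (hsub hx)]
  have hgi : g i = u := Subtype.ext ((hg i hi).trans hu.symm)
  have hgj : g j = v := Subtype.ext ((hg j hj).trans hv.symm)
  have hfu : f u = i := Subtype.ext ((hf u (hu ▸ hi)).trans hu)
  have hfv : f v = j := Subtype.ext ((hf v (hv ▸ hj)).trans hv)
  have hicc : ∀ x : J, x ∈ Set.Icc i j → (x : ℤ) ∈ Set.Ico m n := fun x hx =>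
    ⟨hi.1.trans hx.1, lt_of_le_of_lt hx.2 hj.2⟩
  have hicc' : ∀ x : Set.Ico (m - (p : ℤ)) (n + q), x ∈ Set.Icc u v → (x : ℤ) ∈ Set.Ico m n := by
    intro x hx
    have h1 : (u : ℤ) ≤ x := hx.1
    have h2 : (x : ℤ) ≤ v := hx.2
    rw [hu] at h1
    rw [hv] at h2
    exact ⟨hi.1.trans h1, lt_of_le_of_lt h2 hj.2⟩
  have hgmem : ∀ x ∈ Set.Icc i j, g x ∈ Set.Icc u v := by
    intro x hx
    refine ⟨?_, ?_⟩
    · change (u : ℤ) ≤ g x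
      rw [hg x (hicc x hx), hu]
      exact hx.1
    · change (g x : ℤ) ≤ v
      rw [hg x (hicc x hx), hv]
      exact hx.2
  have hfmem : ∀ x ∈ Set.Icc u v, f x ∈ Set.Icc i j := by
    intro x hx
    refine ⟨?_, ?_⟩
    · change (i : ℤ) ≤ f x
      rw [hf x (hicc' x hx), ← hu]
      exact hx.1
    · change (f x : ℤ) ≤ j
      rw [hf x (hicc' x hx), ← hv]
      exact hx.2
  have hgf : ∀ x ∈ Set.Icc u v, g (f x) = x := fun x hx =>
    Subtype.ext ((hg _ (hicc _ (hfmem x hx))).trans (hf x (hicc' x hx)))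
  have hfg : ∀ x ∈ Set.Icc i j, f (g x) = x := fun x hx =>
    Subtype.ext ((hf _ (hicc' _ (hgmem x hx))).trans (hg x (hicc x hx)))
  constructor
  · intro h
    have := h.transfer (u := w) f g ?_ ?_ ?_
    · rwa [hfu, hfv] at this
    · intro x hx y hy hxy
      change (f x : ℤ) < f y
      rw [hf x (hicc' x hx), hf y (hicc' y hy)]
      exact hxy
    · rw [hfu, hfv]
      exact fun x hx => ⟨hgmem x hx, hfg x hx⟩
    · intro x hx
      exact (closure_of_mem (hicc _ (hfmem x hx)) (hf x (hicc' x hx)).symm).symm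
  · intro h
    have := h.transfer (u := closure m n p q w) g f ?_ ?_ ?_
    · rwa [hgi, hgj] at this
    · intro x hx y hy hxy
      change (g x : ℤ) < g y
      rw [hg x (hicc x hx), hg y (hicc y hy)]
      exact hxy
    · rw [hgi, hgj]
      exact fun x hx => ⟨hfmem x hx, hgf x hx⟩
    · intro x hx
      exact closure_of_mem (hicc _ hx) (hg x (hicc x hx))

/-- The vertices in the window with a given label. -/
noncomputable def labelled (m n : ℤ) (s : Label) (w : J → Label) : Finset ℤ :=
  ((window J m n).filter fun i => w i = s).map ⟨Subtype.val, Subtype.val_injective⟩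

theorem card_labelled (m n : ℤ) (s : Label) (w : J → Label) :
    (labelled m n s w).card = count m n s w := by
  rw [labelled, Finset.card_map, count_eq]

theorem mem_labelled {s : Label} {x : ℤ} :
    x ∈ labelled m n s w ↔ ∃ i : J, (i : ℤ) ∈ Set.Ico m n ∧ w i = s ∧ (i : ℤ) = x := by
  simp only [labelled, Finset.mem_map, Finset.mem_filter, mem_window, Function.Embedding.coeFn_mk,
    and_assoc]

/-- The cup diagram of a closure has no rays. -/
theorem exists_cup_closure (hsub : Set.Ico m n ⊆ J) (hp : count m n .up w = p)
    (hq : count m n .down w = q)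
    (hv : closure m n p q w v = .down ∨ closure m n p q w v = .up) :
    ∃ j, Cup (closure m n p q w) v j ∨ Cup (closure m n p q w) j v := by
  classical
  have hmn : m ≤ n ∨ p = 0 ∧ q = 0 := by
    rcases le_or_gt m n with h | h
    · exact Or.inl h
    · refine Or.inr ⟨?_, ?_⟩
      · rw [← hp, count, Set.Ico_eq_empty h.not_gt]
        simp
      · rw [← hq, count, Set.Ico_eq_empty h.not_gt]
        simp
  rcases hmn with hmn | ⟨h1, h2⟩
  swap
  · subst h1 h2
    rcases position hsub v with h | h | ⟨i, hi, hvi⟩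
    · have := v.2.1
      push_cast at this
      omega
    · have := v.2.2
      push_cast at this
      omega
    · exfalso
      rw [closure_of_mem hi hvi] at hv
      rcases hv with hv | hv
      · have : i ∈ (window J m n).filter fun i => w i = .down :=
          Finset.mem_filter.2 ⟨mem_window.2 hi, hv⟩
        rw [count_eq, Finset.card_eq_zero] at hq
        rw [hq] at this
        simp at this
      · have : i ∈ (window J m n).filter fun i => w i = .up :=
          Finset.mem_filter.2 ⟨mem_window.2 hi, hv⟩
        rw [count_eq, Finset.card_eq_zero] at hp
        rw [hp] at this
        simp at this
  have hup : ∀ x : Set.Ico (m - (p : ℤ)) (n + q), closure m n p q w x = .up ↔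
      (x : ℤ) ∈ labelled m n .up w ∪ Finset.Ico n (n + q) := by
    intro x
    rw [Finset.mem_union, mem_labelled, Finset.mem_Ico]
    rcases position hsub x with h | ⟨h, h'⟩ | ⟨i, hi, hxi⟩
    · rw [closure_of_lt h]
      refine iff_of_false (by decide) ?_
      rintro (⟨i, hi, -, hix⟩ | h')
      · have := hi.1
        omega
      · omega
    · rw [closure_of_ge h h']
      exact iff_of_true rfl (Or.inr ⟨h', x.2.2⟩)
    · rw [closure_of_mem hi hxi]
      constructor
      · exact fun h => Or.inl ⟨i, hi, h, hxi.symm⟩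
      · rintro (⟨k, hk, hwk, hkx⟩ | h')
        · rwa [show i = k from Subtype.ext (hxi.symm.trans hkx.symm)]
        · have := hi.2
          omega
  have hdown : ∀ x : Set.Ico (m - (p : ℤ)) (n + q), closure m n p q w x = .down ↔
      (x : ℤ) ∈ Finset.Ico (m - p) m ∪ labelled m n .down w := by
    intro x
    rw [Finset.mem_union, mem_labelled, Finset.mem_Ico]
    rcases position hsub x with h | ⟨h, h'⟩ | ⟨i, hi, hxi⟩
    · rw [closure_of_lt h]
      exact iff_of_true rfl (Or.inl ⟨x.2.1, h⟩)
    · rw [closure_of_ge h h']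
      refine iff_of_false (by decide) ?_
      rintro (h' | ⟨i, hi, -, hix⟩)
      · omega
      · have := hi.2
        omega
    · rw [closure_of_mem hi hxi]
      constructor
      · exact fun h => Or.inr ⟨i, hi, h, hxi.symm⟩
      · rintro (h' | ⟨k, hk, hwk, hkx⟩)
        · have := hi.1
          omega
        · rwa [show i = k from Subtype.ext (hxi.symm.trans hkx.symm)]
  have hmemV : ∀ {s x}, x ∈ labelled m n s w → x ∈ Set.Ico (m - (p : ℤ)) (n + q) := by
    intro s x hx
    obtain ⟨i, hi, -, rfl⟩ := mem_labelled.1 hx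
    have := hi.1
    have := hi.2
    exact ⟨by omega, by omega⟩
  have hmap : ∀ (P : Set.Ico (m - (p : ℤ)) (n + q) → Prop) [DecidablePred P] (T : Finset ℤ)
      (_ : ∀ x, P x → (x : ℤ) ∈ T), (Finset.univ.filter P).card ≤ T.card := by
    intro P _ T h
    refine Finset.card_le_card_of_injOn Subtype.val (fun x hx => ?_) Subtype.val_injective.injOn
    exact h x (Finset.mem_filter.1 hx).2
  have hmap' : ∀ (P : Set.Ico (m - (p : ℤ)) (n + q) → Prop) [DecidablePred P] (T : Finset ℤ)
      (_ : ∀ x ∈ T, ∃ y, P y ∧ (y : ℤ) = x), T.card ≤ (Finset.univ.filter P).card := by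
    intro P _ T h
    have : T ⊆ (Finset.univ.filter P).image Subtype.val := by
      intro x hx
      obtain ⟨y, hy, rfl⟩ := h x hx
      exact Finset.mem_image_of_mem _ (Finset.mem_filter.2 ⟨Finset.mem_univ _, hy⟩)
    exact (Finset.card_le_card this).trans Finset.card_image_le
  have hdisj : Disjoint (labelled m n .up w) (Finset.Ico n (n + q)) := by
    refine Finset.disjoint_left.2 fun x hx hx' => ?_
    obtain ⟨i, hi, -, rfl⟩ := mem_labelled.1 hx
    have := hi.2
    have := (Finset.mem_Ico.1 hx').1
    omega
  have hdisj' : Disjoint (Finset.Ico (m - p) m) (labelled m n .down w) := by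
    refine Finset.disjoint_left.2 fun x hx' hx => ?_
    obtain ⟨i, hi, -, rfl⟩ := mem_labelled.1 hx
    have := hi.1
    have := (Finset.mem_Ico.1 hx').2
    omega
  have hc1 : (labelled m n .up w ∪ Finset.Ico n (n + q)).card = p + q := by
    rw [Finset.card_union_of_disjoint hdisj, card_labelled, hp, Int.card_Ico]
    simp
  have hc2 : (Finset.Ico (m - p) m ∪ labelled m n .down w).card = p + q := by
    rw [Finset.card_union_of_disjoint hdisj', card_labelled, hq, Int.card_Ico]
    simp
  have hpre : ∀ x ∈ Finset.Ico (m - (p : ℤ)) m, x ∈ Set.Ico (m - (p : ℤ)) (n + q) := by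
    intro x hx
    have := Finset.mem_Ico.1 hx
    exact ⟨by omega, by omega⟩
  have hsuf : ∀ x ∈ Finset.Ico n (n + (q : ℤ)), x ∈ Set.Ico (m - (p : ℤ)) (n + q) := by
    intro x hx
    have := Finset.mem_Ico.1 hx
    exact ⟨by omega, by omega⟩
  refine exists_cup_of_card_le (fun y hy => ?_) ?_ hv
  · rcases position hsub y with h | ⟨h, h'⟩ | ⟨i, hi, hyi⟩
    · rw [closure_of_lt h] at hy
      cases hy
    · refine (hmap (fun x => x ≤ y ∧ closure m n p q w x = .up) _ fun x hx => (hup x).1 hx.2).trans ?_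
      rw [hc1, ← hc2]
      refine hmap' _ _ fun x hx => ?_
      have hxV : x ∈ Set.Ico (m - (p : ℤ)) (n + q) :=
        (Finset.mem_union.1 hx).elim (hpre x) hmemV
      refine ⟨⟨x, hxV⟩, ⟨?_, (hdown _).2 hx⟩, rfl⟩
      change x < (y : ℤ)
      rcases Finset.mem_union.1 hx with hx | hx
      · exact (Finset.mem_Ico.1 hx).2.trans_le h
      · obtain ⟨i, hi, -, rfl⟩ := mem_labelled.1 hx
        exact hi.2.trans_le h'
    · refine (hmap (fun x => x ≤ y ∧ closure m n p q w x = .up) (labelled m n .up w) fun x hx => ?_).trans ?_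
      · refine (Finset.mem_union.1 ((hup x).1 hx.2)).resolve_right fun h => ?_
        have h1 : (x : ℤ) ≤ y := hx.1
        have h2 := (Finset.mem_Ico.1 h).1
        have h3 := hi.2
        omega
      · rw [card_labelled, hp]
        have : (Finset.Ico (m - (p : ℤ)) m).card = p := by simp
        refine this.ge.trans (hmap' _ _ fun x hx => ⟨⟨x, hpre x hx⟩, ⟨?_, ?_⟩, rfl⟩)
        · change x < (y : ℤ)
          have h1 := (Finset.mem_Ico.1 hx).2
          have h2 := hi.1
          omega
        · exact (hdown _).2 (Finset.mem_union_left _ hx)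
  · refine le_antisymm ?_ ?_
    · refine (hmap (fun x => closure m n p q w x = .up) _ fun x hx => (hup x).1 hx).trans ?_
      rw [hc1, ← hc2]
      exact hmap' _ _ fun x hx => ⟨⟨x, (Finset.mem_union.1 hx).elim (hpre x) hmemV⟩,
        (hdown _).2 hx, rfl⟩
    · refine (hmap (fun x => closure m n p q w x = .down) _ fun x hx => (hdown x).1 hx).trans ?_
      rw [hc2, ← hc1]
      exact hmap' _ _ fun x hx => ⟨⟨x, (Finset.mem_union.1 hx).elim hmemV (hsuf x)⟩,
        (hup _).2 hx, rfl⟩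

end Closure

section Closure

variable {J : Set ℤ} {Λ : Set (J → Label)} {m n : ℤ} {p q : ℕ} {w w₀ a l : J → Label} {i j : J}

/-- The vertices of the closed number line that are labelled `down` or `up` by the closures of the
weights in the block of `w`. -/
noncomputable def activeSet (m n : ℤ) (p q : ℕ) (w : J → Label) :
    Finset (Set.Ico (m - (p : ℤ)) (n + q)) :=
  Finset.univ.filter fun v => (closure m n p q w v).sgn ≠ 0

/-- A window of a block, with the numbers of `up`s and `down`s in the window. -/
structure Truncation (Λ : Set (J → Label)) (m n : ℤ) (p q : ℕ) : Prop where
  block : IsBlock Λ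
  window : IsWindow Λ m n
  up : ∀ w ∈ Λ, count m n .up w = p
  down : ∀ w ∈ Λ, count m n .down w = q

variable {u v : Set.Ico (m - (p : ℤ)) (n + q)}

theorem Truncation.closure_eq_or_active (h : Truncation Λ m n p q) (ha : a ∈ Λ) (hl : l ∈ Λ)
    (v : Set.Ico (m - (p : ℤ)) (n + q)) : closure m n p q a v = closure m n p q l v ∨
      ((closure m n p q a v = .down ∨ closure m n p q a v = .up) ∧
        (closure m n p q l v = .down ∨ closure m n p q l v = .up)) := by
  rcases position h.window.subset v with hv | ⟨hv, hv'⟩ | ⟨i, hi, hv⟩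
  · exact Or.inl (by rw [closure_of_lt hv, closure_of_lt hv])
  · exact Or.inl (by rw [closure_of_ge hv hv', closure_of_ge hv hv'])
  · rw [closure_of_mem hi hv, closure_of_mem hi hv]
    exact (h.block.linked ha hl).eq_or_active i

theorem Truncation.compat (h : Truncation Λ m n p q) (hw₀ : w₀ ∈ Λ) (hw : w ∈ Λ) :
    Compat (activeSet m n p q w₀) (closure m n p q w₀) (closure m n p q w) where
  off v hv := by
    have h0 : (closure m n p q w₀ v).sgn = 0 := by simpa [activeSet] using hv
    rcases h.closure_eq_or_active hw hw₀ v with h1 | h1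
    · exact h1
    · exact absurd h1.2 (Label.sgn_eq_zero.1 h0)
  free v hv := by simpa [activeSet] using hv
  full v hv := by
    have h0 : (closure m n p q w₀ v).sgn ≠ 0 := by simpa [activeSet] using hv
    rw [Ne, Label.sgn_eq_zero, not_not] at h0
    refine exists_cup_closure h.window.subset (h.up w hw) (h.down w hw) ?_
    rcases h.closure_eq_or_active hw hw₀ v with h1 | h1
    · rwa [h1]
    · exact h1.1

theorem Truncation.closure_injOn (h : Truncation Λ m n p q) :
    Set.InjOn (closure m n p q) Λ := by
  intro a ha l hl hal
  funext i
  by_cases hi : (i : ℤ) ∈ Set.Ico m n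
  · obtain ⟨v, hv⟩ := exists_position p q hi
    rw [← closure_of_mem (w := a) hi hv, hal, closure_of_mem hi hv]
  · exact h.window.agree a ha l hl i hi

/-- A ray in the window becomes a cup of the closure. -/
theorem Truncation.cup_of_ray (h : Truncation Λ m n p q) (ha : a ∈ Λ)
    (hi : (i : ℤ) ∈ Set.Ico m n) (hv : (v : ℤ) = i) (hr : Ray a i) :
    (a i = .down ∧ ∃ u : Set.Ico (m - (p : ℤ)) (n + q), Cup (closure m n p q a) v u ∧
      (u : ℤ) ∉ Set.Ico m n ∧ m ≤ (u : ℤ)) ∨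
    (a i = .up ∧ ∃ u : Set.Ico (m - (p : ℤ)) (n + q), Cup (closure m n p q a) u v ∧
      (u : ℤ) < m) := by
  have hsub := h.window.subset
  have hact : closure m n p q a v = .down ∨ closure m n p q a v = .up := by
    rw [closure_of_mem hi hv]
    exact hr.1
  obtain ⟨u, hu⟩ := exists_cup_closure hsub (h.up a ha) (h.down a ha) hact
  have hout : (u : ℤ) ∉ Set.Ico m n := by
    intro hu'
    rcases hu with hu | hu
    · exact (hr.2 ⟨u, hsub hu'⟩).1 ((cup_closure_iff hsub hi hu' hv rfl).1 hu)
    · exact (hr.2 ⟨u, hsub hu'⟩).2 ((cup_closure_iff hsub hu' hi rfl hv).1 hu)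
  rcases hu with hu | hu
  · refine Or.inl ⟨by rw [← closure_of_mem (w := a) hi hv, hu.down], u, hu, hout, ?_⟩
    have : (v : ℤ) < u := hu.lt
    have := hi.1
    omega
  · refine Or.inr ⟨by rw [← closure_of_mem (w := a) hi hv, hu.up], u, hu, ?_⟩
    have : (u : ℤ) < v := hu.lt
    have := hi.2
    by_contra h'
    exact hout ⟨not_lt.1 h', by omega⟩

theorem Truncation.sub_iff (h : Truncation Λ m n p q) (hw₀ : w₀ ∈ Λ) (ha : a ∈ Λ) (hl : l ∈ Λ) :
    Sub a l ↔
      Fits (activeSet m n p q w₀) (closure m n p q w₀) (closure m n p q a) (closure m n p q l) := by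
  have hsub := h.window.subset
  constructor
  · rintro ⟨-, ho⟩
    refine ⟨(h.compat hw₀ hl).off, fun u v huv => ?_⟩
    have hne : ∀ {i : J} {v : Set.Ico (m - (p : ℤ)) (n + q)}, (i : ℤ) ∈ Set.Ico m n →
        (v : ℤ) = i → (∀ k : Set.Ico (m - (p : ℤ)) (n + q), (k : ℤ) ∈ Set.Ico m n →
          ¬ Cup (closure m n p q a) v k ∧ ¬ Cup (closure m n p q a) k v) →
        (closure m n p q a v = .down ∨ closure m n p q a v = .up) →
        closure m n p q l v = closure m n p q a v := by
      intro i v hi hv hk hact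
      rw [closure_of_mem hi hv] at hact
      rw [closure_of_mem hi hv, closure_of_mem hi hv]
      refine h.window.eq_of_ray h.block ha hl ho ⟨hact, fun j => ⟨fun hj => ?_, fun hj => ?_⟩⟩
      · have hj' := (h.window.cup_mem h.block ha hj).2
        obtain ⟨k, hk'⟩ := exists_position p q hj'
        exact (hk k (hk' ▸ hj')).1 ((cup_closure_iff hsub hi hj' hv hk').2 hj)
      · have hj' := (h.window.cup_mem h.block ha hj).1
        obtain ⟨k, hk'⟩ := exists_position p q hj'
        exact (hk k (hk' ▸ hj')).2 ((cup_closure_iff hsub hj' hi hk' hv).2 hj)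
    rcases position hsub u with hu | ⟨hu, hu'⟩ | ⟨i, hi, hui⟩
    · have hlu : closure m n p q l u = .down := closure_of_lt hu
      rcases position hsub v with hv | ⟨hv, hv'⟩ | ⟨j, hj, hvj⟩
      · have := huv.up
        rw [closure_of_lt hv] at this
        cases this
      · exact Or.inl ⟨hlu, closure_of_ge hv hv'⟩
      · refine Or.inl ⟨hlu, ?_⟩
        rw [hne hj hvj ?_ (Or.inr huv.up), huv.up]
        intro k hk
        refine ⟨fun hc => hc.false_of_left_right huv, fun hc => ?_⟩
        rw [hc.left_unique huv] at hk
        exact hk.1.not_gt hu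
    · have := huv.down
      rw [closure_of_ge hu hu'] at this
      cases this
    · rcases position hsub v with hv | ⟨hv, hv'⟩ | ⟨j, hj, hvj⟩
      · have := huv.up
        rw [closure_of_lt hv] at this
        cases this
      · refine Or.inl ⟨?_, closure_of_ge hv hv'⟩
        rw [hne hi hui ?_ (Or.inl huv.down), huv.down]
        intro k hk
        refine ⟨fun hc => ?_, fun hc => huv.false_of_left_right hc⟩
        rw [hc.right_unique huv] at hk
        exact hk.2.not_ge hv'
      · rw [closure_of_mem hi hui, closure_of_mem hj hvj]
        exact ho.cup i j ((cup_closure_iff hsub hi hj hui hvj).1 huv)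
  · intro hf
    have hlink := h.block.linked ha hl
    have hray : ∀ i : J, (i : ℤ) ∈ Set.Ico m n → Ray a i → l i = a i := by
      intro i hi hr
      obtain ⟨v, hv⟩ := exists_position p q hi
      rcases h.cup_of_ray ha hi hv hr with ⟨hai, u, hu, hout, hmu⟩ | ⟨hai, u, hu, hum⟩
      · have hlu : closure m n p q l u = .up := by
          refine closure_of_ge hmu ?_
          by_contra h'
          exact hout ⟨hmu, not_le.1 h'⟩
        rw [hai, ← closure_of_mem (w := l) hi hv]
        rcases hf.cup _ _ hu with h' | h'
        · exact h'.1
        · rw [hlu] at h'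
          exact absurd h'.2 (by decide)
      · have hlu : closure m n p q l u = .down := closure_of_lt hum
        rw [hai, ← closure_of_mem (w := l) hi hv]
        rcases hf.cup _ _ hu with h' | h'
        · exact h'.2
        · rw [hlu] at h'
          exact absurd h'.1 (by decide)
    refine ⟨hlink, fun i hi => ?_, fun i j hij => ?_, fun i hi => ?_, fun i j hij hi hj hlij => ?_⟩
    · rcases hlink.eq_or_active i with h' | h'
      · rwa [← h']
      · rcases hi with hi | hi <;> rw [hi] at h' <;> simp at h'
    · obtain ⟨hi, hj⟩ := h.window.cup_mem h.block ha hij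
      obtain ⟨u, hu⟩ := exists_position p q hi
      obtain ⟨v, hv⟩ := exists_position p q hj
      have := hf.cup u v ((cup_closure_iff hsub hi hj hu hv).2 hij)
      rwa [closure_of_mem hi hu, closure_of_mem hj hv] at this
    · rcases hlink.eq_or_active i with h' | h'
      · rw [← h']
        exact hi.1
      · exact h'.2
    · obtain ⟨hi', hj'⟩ := h.window.mem_of_down_up h.block hl hij.ne hlij.1 hlij.2
      have hai := (hray i hi' hi).symm.trans hlij.1
      have haj := (hray j hj' hj).symm.trans hlij.2
      classical
      rcases exists_cup_of_down_up hij hai haj with ⟨k, hk⟩ | ⟨k, hk⟩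
      · exact (hi.2 k).1 hk
      · exact (hj.2 k).2 hk

theorem Truncation.cupDegree_closure (h : Truncation Λ m n p q) (ha : a ∈ Λ) (hl : l ∈ Λ)
    (hal : Sub a l) : cupDegree (closure m n p q a) (closure m n p q l) = cupDegree a l := by
  have hsub := h.window.subset
  have hf := (h.sub_iff ha ha hl).1 hal
  rw [cupDegree, cupDegree]
  symm
  refine Set.ncard_congr (fun x hx => ?_) ?_ ?_ ?_
  · have hx1 := (h.window.cup_mem h.block ha hx.1).1
    have hx2 := (h.window.cup_mem h.block ha hx.1).2
    exact (⟨x.1, by have := hx1.1; have := hx1.2; exact ⟨by omega, by omega⟩⟩,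
      ⟨x.2, by have := hx2.1; have := hx2.2; exact ⟨by omega, by omega⟩⟩)
  · rintro ⟨i, j⟩ ⟨hij, hi⟩
    obtain ⟨h1, h2⟩ := h.window.cup_mem h.block ha hij
    refine ⟨(cup_closure_iff hsub h1 h2 rfl rfl).2 hij, ?_⟩
    exact (closure_of_mem h1 rfl).trans hi
  · rintro ⟨i, j⟩ ⟨i', j'⟩ hx hx' heq
    simp only [Prod.mk.injEq] at heq
    exact Prod.ext (Subtype.ext (Subtype.mk.inj heq.1))
      (Subtype.ext (Subtype.mk.inj heq.2))
  · rintro ⟨u, v⟩ ⟨huv, hu⟩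
    have hluv := (hf.cup u v huv).resolve_left fun h' => by
      rw [h'.1] at hu
      cases hu
    simp only at hu huv
    rcases position hsub u with hu' | ⟨hu', hu''⟩ | ⟨i, hi, hui⟩
    · rw [closure_of_lt hu'] at hu
      cases hu
    · have := huv.down
      rw [closure_of_ge hu' hu''] at this
      cases this
    · rcases position hsub v with hv | ⟨hv, hv'⟩ | ⟨j, hj, hvj⟩
      · have := huv.up
        rw [closure_of_lt hv] at this
        cases this
      · have := hluv.2
        rw [closure_of_ge hv hv'] at this
        cases this
      · refine ⟨(i, j), ⟨(cup_closure_iff hsub hi hj hui hvj).1 huv, ?_⟩, ?_⟩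
        · rwa [closure_of_mem hi hui] at hu
        · exact Prod.ext (Subtype.ext hui.symm) (Subtype.ext hvj.symm)

theorem Fits.sum_sgn {V : Type*} [LinearOrder V] {N : Finset V} {f a l : V → Label}
    (ha : Compat N f a) (hl : Fits N f a l) : ∑ v ∈ N, (l v).sgn = 0 := by
  refine Finset.sum_involution (fun v _ => mate a v) ?_ (fun v hv _ => (ha.mate_mem hv).2)
    (fun v hv => (ha.mate_mem hv).1) fun v _ => mate_mate a v
  intro v hv
  rw [hl.sgn_mate ha hv, add_neg_cancel]

theorem Truncation.exists_closure_eq (h : Truncation Λ m n p q) (hw₀ : w₀ ∈ Λ) (ha : a ∈ Λ)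
    {ν : Set.Ico (m - (p : ℤ)) (n + q) → Label}
    (hν : Fits (activeSet m n p q w₀) (closure m n p q w₀) (closure m n p q a) ν)
    (hlt : ∀ v : Set.Ico (m - (p : ℤ)) (n + q), (v : ℤ) < m → ν v = .down)
    (hge : ∀ v : Set.Ico (m - (p : ℤ)) (n + q), m ≤ (v : ℤ) → n ≤ (v : ℤ) → ν v = .up) :
    ∃ w ∈ Λ, closure m n p q w = ν := by
  classical
  have hsub := h.window.subset
  have hV : ∀ {i : J}, (i : ℤ) ∈ Set.Ico m n → (i : ℤ) ∈ Set.Ico (m - (p : ℤ)) (n + q) := by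
    intro i hi
    have := hi.1
    have := hi.2
    exact ⟨by omega, by omega⟩
  set w : J → Label := fun i => if hi : (i : ℤ) ∈ Set.Ico m n then ν ⟨i, hV hi⟩ else a i
  have hcl : closure m n p q w = ν := by
    funext v
    rcases position hsub v with hv | ⟨hv, hv'⟩ | ⟨i, hi, hvi⟩
    · rw [closure_of_lt hv, hlt v hv]
    · rw [closure_of_ge hv hv', hge v hv hv']
    · rw [closure_of_mem hi hvi]
      simp only [w, dif_pos hi]
      congr 1
      exact Subtype.ext hvi.symm
  have hca := h.compat hw₀ ha
  refine ⟨w, h.block.mem ha ?_, hcl⟩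
  refine linked_of_sum_eq (ArcAlgebra.window J m n) ?_ ?_ ?_
  · intro i hi
    rw [mem_window] at hi
    simp only [w, dif_neg hi]
  · intro i
    by_cases hi : (i : ℤ) ∈ Set.Ico m n
    · obtain ⟨v, hv⟩ := exists_position p q hi
      rw [← closure_of_mem (w := w) hi hv, ← closure_of_mem (w := a) hi hv, hcl]
      by_cases hvN : v ∈ activeSet m n p q w₀
      · exact Or.inr ⟨hca.fits_self.active hca hvN, hν.active hca hvN⟩
      · exact Or.inl ((hca.off v hvN).trans (hν.off v hvN).symm)
    · left
      simp only [w, dif_neg hi]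
  · have h1 : ∑ v, ((closure m n p q a v).sgn - (ν v).sgn) = 0 := by
      rw [← Finset.sum_subset (Finset.subset_univ (activeSet m n p q w₀))]
      · rw [Finset.sum_sub_distrib, hν.sum_sgn hca, hca.fits_self.sum_sgn hca, sub_zero]
      · intro v _ hv
        rw [hν.sgn_eq_zero hca hv, hca.fits_self.sgn_eq_zero hca hv, sub_zero]
    rw [← sub_eq_zero, ← Finset.sum_sub_distrib, ← h1]
    refine Finset.sum_bij_ne_zero (fun i hi _ => ⟨i, hV (mem_window.1 hi)⟩) ?_ ?_ ?_ ?_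
    · exact fun _ _ _ => Finset.mem_univ _
    · intro i _ _ j _ _ hij
      exact Subtype.ext (Subtype.mk.inj hij)
    · intro v _ hv
      rcases position hsub v with hv' | ⟨hv', hv''⟩ | ⟨i, hi, hvi⟩
      · rw [closure_of_lt hv', hlt v hv', sub_self] at hv
        exact absurd rfl hv
      · rw [closure_of_ge hv' hv'', hge v hv' hv'', sub_self] at hv
        exact absurd rfl hv
      · refine ⟨i, mem_window.2 hi, ?_, Subtype.ext hvi.symm⟩
        rwa [← closure_of_mem (w := a) hi hvi, ← closure_of_mem (w := w) hi hvi, hcl]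
    · intro i hi _
      rw [mem_window] at hi
      have hv : ((⟨i, hV hi⟩ : Set.Ico (m - (p : ℤ)) (n + q)) : ℤ) = i := rfl
      rw [← closure_of_mem (w := a) hi hv, ← closure_of_mem (w := w) hi hv, hcl]

end Closure

end ArcAlgebra

/-! ### Heredity ideals -/

/-- An idempotent in the Jacobson radical is zero. -/
theorem eq_zero_of_mem_jacobson {R : Type*} [Ring R] {e : R} (he : e * e = e)
    (hJ : e ∈ Ring.jacobson R) : e = 0 := by
  rw [← Ideal.jacobson_bot, Ideal.mem_jacobson_iff] at hJ
  obtain ⟨z, hz⟩ := hJ (-1)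
  rw [Ideal.mem_bot] at hz
  have h1 : z * (1 - e) = 1 := by
    rw [mul_sub, mul_one]
    have : z * -1 * e + z - 1 = z - z * e - 1 := by noncomm_ring
    rw [this] at hz
    exact sub_eq_zero.1 hz
  calc e = z * (1 - e) * e := by rw [h1, one_mul]
    _ = z * (e - e * e) := by noncomm_ring
    _ = 0 := by rw [he, sub_self, mul_zero]

section Heredity

variable {k R : Type*} [Field k] [Ring R] [Algebra k R] {T T' : Type*} [Fintype T] [Fintype T']

theorem isHeredityIdeal_of_basis (I : Ideal R) (hI : I.IsTwoSided) {e : R} (he : e * e = e)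
    (heI : e ∈ I) (x : T → R) (y : T' → R) (hx : ∀ a, x a * e = x a) (hy : ∀ b, e * y b = y b)
    (hspan : ∀ r ∈ I, r ∈ Submodule.span k (Set.range fun ab : T × T' => x ab.1 * y ab.2))
    (hRe : ∀ r, r * e ∈ Submodule.span k (Set.range x))
    (heRe : ∀ r, ∃ c : k, e * r * e = c • e)
    (hli : LinearIndependent k fun ab : T × T' => x ab.1 * y ab.2) : IsHeredityIdeal I := by
  classical
  have hxI : ∀ a, x a ∈ I := fun a => by
    rw [← hx a]
    exact I.mul_mem_left _ heI
  have hyI : ∀ b, y b ∈ I := fun b => by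
    rw [← hy b]
    exact I.mul_mem_right _ heI
  refine ⟨hI, le_antisymm Ideal.mul_le_left fun r hr => ?_, ?_, ?_⟩
  · have hle : Submodule.span k (Set.range fun ab : T × T' => x ab.1 * y ab.2) ≤
        (I * I).restrictScalars k := by
      rw [Submodule.span_le]
      rintro _ ⟨ab, rfl⟩
      exact Ideal.mul_mem_mul (hxI _) (hyI _)
    exact hle (hspan r hr)
  · rw [eq_bot_iff, Ideal.mul_le]
    intro r hr s hs
    rw [Ideal.mem_bot]
    refine Submodule.mul_induction_on hr (fun i hi j hj => ?_) fun r r' h h' => ?_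
    · refine Submodule.span_induction (p := fun i _ => i * j * s = 0) ?_ (by simp) ?_ ?_
        (hspan i hi)
      · rintro _ ⟨⟨a, b⟩, rfl⟩
        refine Submodule.span_induction (p := fun s _ => x a * y b * j * s = 0) ?_ (by simp) ?_ ?_
          (hspan s hs)
        · rintro _ ⟨⟨a', b'⟩, rfl⟩
          obtain ⟨c, hc⟩ := heRe (y b * j * x a')
          have h1 : e * (y b * j * x a') * e = y b * j * x a' := by
            calc e * (y b * j * x a') * e = (e * y b) * j * (x a' * e) := by noncomm_ring
              _ = y b * j * x a' := by rw [hx, hy]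
          have h2 : c • e = 0 := by
            rcases eq_or_ne c 0 with rfl | hc0
            · exact zero_smul _ _
            have hcJ : c • e ∈ Ring.jacobson R := by
              rw [← hc]
              refine Ideal.mul_mem_right _ _ (Ideal.mul_mem_left _ _ ?_)
              exact Ideal.mul_mem_right _ _ (Ideal.mul_mem_left _ _ hj)
            have heJ : e ∈ Ring.jacobson R := by
              have := (Ring.jacobson R).mul_mem_left (algebraMap k R c⁻¹) hcJ
              rwa [← Algebra.smul_def, smul_smul, inv_mul_cancel₀ hc0, one_smul] at this
            rw [eq_zero_of_mem_jacobson he heJ, smul_zero]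
          have h3 : y b * j * x a' = 0 := by rw [← h1, hc, h2]
          calc x a * y b * j * (x a' * y b') = x a * (y b * j * x a') * y b' := by noncomm_ring
            _ = 0 := by rw [h3, mul_zero, zero_mul]
        · intro s s' _ _ h h'
          rw [mul_add, h, h', add_zero]
        · intro c s _ h
          rw [mul_smul_comm, h, smul_zero]
      · intro i i' _ _ h h'
        rw [add_mul, add_mul, h, h', add_zero]
      · intro c i _ h
        rw [smul_mul_assoc, smul_mul_assoc, h, smul_zero]
    · rw [add_mul, h, h', add_zero]
  · let Q : Submodule R (T' → R) :=
      { carrier := {f | ∀ b, f b * e = f b}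
        add_mem' := fun {f g} hf hg b => by
          change (f b + g b) * e = f b + g b
          rw [add_mul, hf, hg]
        zero_mem' := fun b => zero_mul e
        smul_mem' := fun r f hf b => by
          change r * f b * e = r * f b
          rw [mul_assoc, hf] }
    let s : (T' → R) →ₗ[R] I :=
      { toFun := fun f => ⟨∑ b, f b * y b, I.sum_mem fun b _ => I.mul_mem_left _ (hyI b)⟩
        map_add' := fun f g => by
          ext
          simp [add_mul, Finset.sum_add_distrib]
        map_smul' := fun r f => by
          ext
          simp [mul_assoc, Finset.mul_sum] }
    have hs : ∀ f, (s f : R) = ∑ b, f b * y b := fun _ => rfl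
    have hbij : Function.Bijective (s ∘ₗ Q.subtype) := by
      constructor
      · rw [← LinearMap.ker_eq_bot, LinearMap.ker_eq_bot']
        rintro ⟨f, hf⟩ h0
        have h0 : ∑ b, f b * y b = 0 := congrArg Subtype.val h0
        have h1 : ∀ b, ∃ c : T → k, ∑ a, c a • x a = f b := fun b => by
          have := hRe (f b)
          rw [hf b] at this
          exact (Submodule.mem_span_range_iff_exists_fun k).1 this
        choose c hc using h1
        have h2 : ∑ ab : T × T', c ab.2 ab.1 • (x ab.1 * y ab.2) = 0 := by
          rw [Fintype.sum_prod_type_right, ← h0]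
          refine Finset.sum_congr rfl fun b _ => ?_
          rw [← hc b, Finset.sum_mul]
          simp only [smul_mul_assoc]
        have h3 := Fintype.linearIndependent_iff.1 hli _ h2
        ext b
        change f b = 0
        rw [← hc b]
        exact Finset.sum_eq_zero fun a _ => by rw [h3 (a, b), zero_smul]
      · rintro ⟨r, hr⟩
        obtain ⟨c, hc⟩ := (Submodule.mem_span_range_iff_exists_fun k).1 (hspan r hr)
        refine ⟨⟨fun b => ∑ a, c (a, b) • x a, fun b => ?_⟩, Subtype.ext ?_⟩
        · simp only [Finset.sum_mul, smul_mul_assoc, hx]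
        · change ∑ b, (∑ a, c (a, b) • x a) * y b = r
          rw [← hc, Fintype.sum_prod_type_right]
          refine Finset.sum_congr rfl fun b _ => ?_
          rw [Finset.sum_mul]
          simp only [smul_mul_assoc]
    let E := LinearEquiv.ofBijective _ hbij
    refine Module.Projective.of_split (Q.subtype ∘ₗ E.symm.toLinearMap) s ?_
    ext r
    exact congrArg Subtype.val (E.apply_symm_apply r)

end Heredity

/-! ### Quasi-hereditary algebras with a cellular basis -/

open Module in
/-- A homogeneous basis of an algebra, indexed by triples of weights, whose multiplication respects the
order of the weights. -/
structure IsCellBasis {k A X W : Type*} [Field k] [Ring A] [Algebra k A] [LinearOrder W] [Fintype W]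
    (v : Basis X k A) (deg : X → ℕ) (src wt tgt : X → W) (ε : W → X) : Prop where
  ext : ∀ x y, src x = src y → wt x = wt y → tgt x = tgt y → x = y
  src_idem : ∀ a, src (ε a) = a
  wt_idem : ∀ a, wt (ε a) = a
  tgt_idem : ∀ a, tgt (ε a) = a
  deg_idem : ∀ a, deg (ε a) = 0
  eq_idem : ∀ x, deg x = 0 → x = ε (wt x)
  sum_idem : ∑ a, v (ε a) = 1
  idem_mul : ∀ a x, v (ε a) * v x = if src x = a then v x else 0
  mul_idem : ∀ a x, v x * v (ε a) = if tgt x = a then v x else 0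
  mul_deg : ∀ x y, v x * v y ∈ Submodule.span k (v '' {z | deg z = deg x + deg y})
  mul_wt : ∀ x y, v x * v y ∈ Submodule.span k (v '' {z | wt x ≤ wt z ∧ wt y ≤ wt z})
  src_le : ∀ x, src x ≤ wt x
  tgt_le : ∀ x, tgt x ≤ wt x
  mul_cell : ∀ x y, wt y = wt x → tgt x = wt x → src y = wt x → ∃ z, ∃ c : k, c ≠ 0 ∧
    src z = src x ∧ wt z = wt x ∧ tgt z = tgt y ∧
      v x * v y - c • v z ∈ Submodule.span k (v '' {w | wt x < wt w})
  exists_cell : ∀ z, ∃ x y, (wt x = wt z ∧ tgt x = wt z ∧ src x = src z) ∧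
    wt y = wt z ∧ src y = wt z ∧ tgt y = tgt z

namespace IsCellBasis

open Module

variable {k A X W : Type*} [Field k] [Ring A] [Algebra k A] [LinearOrder W] [Fintype W]
  {v : Basis X k A} {deg : X → ℕ} {src wt tgt : X → W} {ε : W → X}

/-- The subspace spanned by the basis vectors of degree `i`. -/
def grading (v : Basis X k A) (deg : X → ℕ) (i : ℕ) : Submodule k A :=
  Submodule.span k (v '' {x | deg x = i})

theorem mem_grading (v : Basis X k A) (deg : X → ℕ) (x : X) : v x ∈ grading v deg (deg x) :=
  Submodule.subset_span ⟨x, rfl, rfl⟩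

/-- The decomposition into homogeneous components. -/
noncomputable def decomposeMap (v : Basis X k A) (deg : X → ℕ) :
    A →ₗ[k] DirectSum ℕ fun i => grading v deg i :=
  v.constr k fun x => DirectSum.lof k ℕ (fun i => grading v deg i) (deg x) ⟨v x, mem_grading v deg x⟩

theorem decomposeMap_of_mem {i : ℕ} {r : A} (hr : r ∈ grading v deg i) :
    decomposeMap v deg r = DirectSum.lof k ℕ (fun i => grading v deg i) i ⟨r, hr⟩ := by
  induction hr using Submodule.span_induction with
  | mem r h =>
    obtain ⟨x, hx, rfl⟩ := h
    change deg x = i at hx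
    subst hx
    rw [decomposeMap, Basis.constr_basis]
  | zero =>
    rw [map_zero]
    exact (map_zero _).symm
  | add r s hr hs h h' =>
    rw [map_add, h, h', ← map_add]
    rfl
  | smul c r hr h =>
    rw [map_smul, h, ← map_smul]
    rfl

/-- The grading defined by a homogeneous basis. -/
@[reducible]
noncomputable def gradedAlgebra (h : IsCellBasis v deg src wt tgt ε) :
    GradedAlgebra (grading v deg) where
  one_mem := by
    rw [← h.sum_idem]
    refine Submodule.sum_mem _ fun a _ => ?_
    rw [← h.deg_idem a]
    exact mem_grading v deg _
  mul_mem := by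
    intro i j r s hr hs
    have : grading v deg i * grading v deg j ≤ grading v deg (i + j) := by
      rw [grading, grading, Submodule.span_mul_span, Submodule.span_le]
      rintro _ ⟨_, ⟨x, hx, rfl⟩, _, ⟨y, hy, rfl⟩, rfl⟩
      change deg x = i at hx
      change deg y = j at hy
      subst hx hy
      exact h.mul_deg x y
    exact this (Submodule.mul_mem_mul hr hs)
  toDecomposition := DirectSum.Decomposition.ofLinearMap _ (decomposeMap v deg)
    (v.ext fun x => by
      rw [LinearMap.comp_apply, decomposeMap_of_mem (mem_grading v deg x),
        DirectSum.coeLinearMap_lof]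
      rfl)
    (DirectSum.linearMap_ext _ fun i => LinearMap.ext fun r => by
      rw [LinearMap.comp_apply, LinearMap.comp_apply, DirectSum.coeLinearMap_lof,
        decomposeMap_of_mem r.2]
      rfl)

theorem isSemisimpleRing (h : IsCellBasis v deg src wt tgt ε) :
    letI := h.gradedAlgebra
    IsSemisimpleRing (grading v deg 0) := by
  let := h.gradedAlgebra
  have hmem : ∀ f : W → k, ∑ a, f a • v (ε a) ∈ grading v deg 0 := fun f => by
    refine Submodule.sum_mem _ fun a _ => Submodule.smul_mem _ _ ?_
    rw [← h.deg_idem a]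
    exact mem_grading v deg _
  have hε : Function.Injective ε := fun a b hab => by rw [← h.wt_idem a, hab, h.wt_idem]
  have hmul : ∀ a b, v (ε a) * v (ε b) = if b = a then v (ε b) else 0 := fun a b => by
    rw [h.idem_mul, h.src_idem]
  let φ : (W → k) →+* grading v deg 0 :=
    { toFun := fun f => ⟨∑ a, f a • v (ε a), hmem f⟩
      map_one' := Subtype.ext (by simpa using h.sum_idem)
      map_zero' := Subtype.ext (by simp)
      map_add' := fun f g => Subtype.ext (by simp [add_smul, Finset.sum_add_distrib])
      map_mul' := fun f g => Subtype.ext (by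
        change _ = (∑ a, f a • v (ε a)) * ∑ a, g a • v (ε a)
        rw [Finset.sum_mul_sum]
        refine Finset.sum_congr rfl fun a _ => ?_
        simp [hmul, smul_smul, mul_comm]) }
  have hbij : Function.Bijective φ := by
    constructor
    · rw [injective_iff_map_eq_zero]
      intro f hf
      have h0 : ∑ a, f a • v (ε a) = 0 := congrArg Subtype.val hf
      funext a
      exact Fintype.linearIndependent_iff.1 (v.linearIndependent.comp ε hε) f h0 a
    · rintro ⟨r, hr⟩
      have hset : v '' {x | deg x = 0} = Set.range (v ∘ ε) := by
        ext s
        constructor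
        · rintro ⟨x, hx, rfl⟩
          exact ⟨wt x, by rw [Function.comp_apply, ← h.eq_idem x hx]⟩
        · rintro ⟨a, rfl⟩
          exact ⟨ε a, h.deg_idem a, rfl⟩
      have hr' := hr
      rw [grading, hset, Submodule.mem_span_range_iff_exists_fun] at hr'
      obtain ⟨f, hf⟩ := hr'
      exact ⟨f, Subtype.ext hf⟩
  exact (RingEquiv.ofBijective φ hbij).isSemisimpleRing

/-- The ideal spanned by the basis vectors with weight in `U`. -/
def cellIdeal (v : Basis X k A) (wt : X → W) (U : Set W) : Ideal A :=
  Ideal.span (v '' {x | wt x ∈ U})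

theorem mul_mem_span (h : IsCellBasis v deg src wt tgt ε) {U : Set W} (hU : IsUpperSet U) {r s : A}
    (hs : r ∈ Submodule.span k (v '' {x | wt x ∈ U}) ∨ s ∈ Submodule.span k (v '' {x | wt x ∈ U})) :
    r * s ∈ Submodule.span k (v '' {x | wt x ∈ U}) := by
  have key : ∀ S T : Set X, ((∀ x ∈ S, wt x ∈ U) ∨ ∀ x ∈ T, wt x ∈ U) →
      Submodule.span k (v '' S) * Submodule.span k (v '' T) ≤
        Submodule.span k (v '' {x | wt x ∈ U}) := by
    intro S T hST
    rw [Submodule.span_mul_span, Submodule.span_le]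
    rintro _ ⟨_, ⟨x, hx, rfl⟩, _, ⟨y, hy, rfl⟩, rfl⟩
    refine Submodule.span_mono (Set.image_mono fun z hz => ?_) (h.mul_wt x y)
    rcases hST with hS | hT
    · exact hU hz.1 (hS x hx)
    · exact hU hz.2 (hT y hy)
  have htop : ∀ t : A, t ∈ Submodule.span k (v '' Set.univ) := fun t => by
    rw [Set.image_univ, v.span_eq]
    trivial
  rcases hs with hs | hs
  · exact key _ Set.univ (Or.inl fun _ hx => hx) (Submodule.mul_mem_mul hs (htop s))
  · exact key Set.univ _ (Or.inr fun _ hx => hx) (Submodule.mul_mem_mul (htop r) hs)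

theorem mem_cellIdeal (h : IsCellBasis v deg src wt tgt ε) {U : Set W} (hU : IsUpperSet U) {r : A} :
    r ∈ cellIdeal v wt U ↔ r ∈ Submodule.span k (v '' {x | wt x ∈ U}) := by
  constructor
  · intro hr
    induction hr using Submodule.span_induction with
    | mem r hr => exact Submodule.subset_span hr
    | zero => exact zero_mem _
    | add r s _ _ hr hs => exact add_mem hr hs
    | smul c r _ hr => exact h.mul_mem_span hU (Or.inr hr)
  · intro hr
    induction hr using Submodule.span_induction with
    | mem r hr => exact Ideal.subset_span hr
    | zero => exact zero_mem _
    | add r s _ _ hr hs => exact add_mem hr hs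
    | smul c r _ hr =>
      rw [Algebra.smul_def]
      exact Ideal.mul_mem_left _ _ hr

theorem isTwoSided_cellIdeal (h : IsCellBasis v deg src wt tgt ε) {U : Set W} (hU : IsUpperSet U) :
    (cellIdeal v wt U).IsTwoSided :=
  ⟨fun s hr => by
    rw [h.mem_cellIdeal hU] at hr ⊢
    exact h.mul_mem_span hU (Or.inl hr)⟩

theorem cellIdeal_mono {k A X W : Type*} [Field k] [Ring A] [Algebra k A] {v : Basis X k A}
    {wt : X → W} {U U' : Set W} (hUU' : U ⊆ U') : cellIdeal v wt U ≤ cellIdeal v wt U' :=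
  Ideal.span_mono (Set.image_mono fun _ hx => hUU' hx)

theorem idem_mem_cellIdeal (h : IsCellBasis v deg src wt tgt ε) {U : Set W} (hU : IsUpperSet U)
    {a : W} : v (ε a) ∈ cellIdeal v wt U ↔ a ∈ U := by
  rw [h.mem_cellIdeal hU, Basis.mem_span_image, Basis.repr_self,
    Finsupp.support_single _ one_ne_zero]
  simp [h.wt_idem]

theorem isHeredityIdeal [Fintype X] (h : IsCellBasis v deg src wt tgt ε) (l : W) (I I' : Ideal A)
    [I.IsTwoSided] (hI : ∀ r, r ∈ I ↔ r ∈ Submodule.span k (v '' {x | l < wt x}))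
    (hI' : ∀ r, r ∈ I' ↔ r ∈ Submodule.span k (v '' {x | l ≤ wt x}))
    (htwo : I'.IsTwoSided) :
    IsHeredityIdeal (I'.map (Ideal.Quotient.mk I)) := by
  classical
  let π : A →ₐ[k] A ⧸ I := Ideal.Quotient.mkₐ k I
  have hπ : Function.Surjective π := Ideal.Quotient.mkₐ_surjective k I
  have hker : ∀ r, π r = 0 ↔ r ∈ I := fun r => Ideal.Quotient.eq_zero_iff_mem
  have hkill : ∀ z, l < wt z → π (v z) = 0 := fun z hz =>
    (hker _).2 ((hI _).2 (Submodule.subset_span ⟨z, hz, rfl⟩))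
  have hmem : ∀ r, r ∈ I'.map (Ideal.Quotient.mk I) ↔ ∃ s ∈ I', π s = r := fun r =>
    Ideal.mem_map_iff_of_surjective _ Ideal.Quotient.mk_surjective
  have htop : ∀ t : A, t ∈ Submodule.span k (Set.range v) := fun t => by
    rw [v.span_eq]
    trivial
  have hcell : ∀ x y, wt x = l → tgt x = l → wt y = l → src y = l → ∃ z, ∃ c : k, c ≠ 0 ∧
      src z = src x ∧ wt z = l ∧ tgt z = tgt y ∧ v x * v y - c • v z ∈ I := by
    intro x y h1 h2 h3 h4
    obtain ⟨z, c, hc, h5, h6, h7, h8⟩ := h.mul_cell x y (h3.trans h1.symm) (h2.trans h1.symm)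
      (h4.trans h1.symm)
    rw [h1] at h8
    exact ⟨z, c, hc, h5, h6.trans h1, h7, (hI _).2 h8⟩
  refine isHeredityIdeal_of_basis (k := k) (T := {x // wt x = l ∧ tgt x = l})
    (T' := {x // wt x = l ∧ src x = l}) (e := π (v (ε l))) _ ?_ ?_ ?_
    (fun x => π (v x)) (fun y => π (v y)) ?_ ?_ ?_ ?_ ?_ ?_
  · refine ⟨fun s hr => ?_⟩
    obtain ⟨r, hr', rfl⟩ := (hmem _).1 hr
    obtain ⟨s, rfl⟩ := hπ s
    exact (hmem _).2 ⟨r * s, I'.mul_mem_right s hr', map_mul _ _ _⟩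
  · rw [← map_mul, h.idem_mul, if_pos (h.src_idem l)]
  · exact (hmem _).2 ⟨_, (hI' _).2 (Submodule.subset_span ⟨ε l, (h.wt_idem l).ge, rfl⟩), rfl⟩
  · rintro ⟨x, h1, h2⟩
    rw [← map_mul, h.mul_idem, if_pos h2]
  · rintro ⟨x, h1, h2⟩
    rw [← map_mul, h.idem_mul, if_pos h2]
  · intro r hr
    obtain ⟨r, hr', rfl⟩ := (hmem _).1 hr
    rw [hI'] at hr'
    clear hr
    induction hr' using Submodule.span_induction with
    | mem r hr =>
      obtain ⟨z, hz, rfl⟩ := hr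
      rcases (show l ≤ wt z from hz).lt_or_eq with hz | hz
      · rw [hkill z hz]
        exact zero_mem _
      · obtain ⟨x, y, ⟨h1, h2, h3⟩, h4, h5, h6⟩ := h.exists_cell z
        rw [← hz] at h1 h2 h4 h5
        obtain ⟨z', c, hc, h7, h8, h9, h10⟩ := hcell x y h1 h2 h4 h5
        have hzz' : z' = z := h.ext _ _ (h7.trans h3) (h8.trans hz) (h9.trans h6)
        subst hzz'
        rw [← hker, map_sub, map_smul, sub_eq_zero] at h10
        have : π (v z') = c⁻¹ • (π (v x) * π (v y)) := by
          rw [← map_mul, h10, smul_smul, inv_mul_cancel₀ hc, one_smul]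
        rw [this]
        exact Submodule.smul_mem _ _ (Submodule.subset_span ⟨(⟨x, h1, h2⟩, ⟨y, h4, h5⟩), rfl⟩)
    | zero =>
      rw [map_zero]
      exact zero_mem _
    | add r s _ _ hr hs =>
      rw [map_add]
      exact add_mem hr hs
    | smul c r _ hr =>
      rw [map_smul]
      exact Submodule.smul_mem _ _ hr
  · intro r
    obtain ⟨r, rfl⟩ := hπ r
    have hr := htop r
    induction hr using Submodule.span_induction with
    | mem r hr =>
      obtain ⟨z, rfl⟩ := hr
      rw [← map_mul, h.mul_idem]
      split_ifs with hz
      · rcases (hz ▸ h.tgt_le z : l ≤ wt z).lt_or_eq with hz' | hz'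
        · rw [hkill z hz']
          exact zero_mem _
        · exact Submodule.subset_span ⟨⟨z, hz'.symm, hz⟩, rfl⟩
      · rw [map_zero]
        exact zero_mem _
    | zero =>
      rw [map_zero, zero_mul]
      exact zero_mem _
    | add r s _ _ hr hs =>
      rw [map_add, add_mul]
      exact add_mem hr hs
    | smul c r _ hr =>
      rw [map_smul, smul_mul_assoc]
      exact Submodule.smul_mem _ _ hr
  · intro r
    obtain ⟨r, rfl⟩ := hπ r
    suffices hs : π (v (ε l)) * π r * π (v (ε l)) ∈ Submodule.span k {π (v (ε l))} by
      obtain ⟨c, hc⟩ := Submodule.mem_span_singleton.1 hs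
      exact ⟨c, hc.symm⟩
    have hr := htop r
    induction hr using Submodule.span_induction with
    | mem r hr =>
      obtain ⟨z, rfl⟩ := hr
      rw [← map_mul, h.idem_mul]
      split_ifs with hz
      · rw [← map_mul, h.mul_idem]
        split_ifs with hz'
        · rcases (hz ▸ h.src_le z : l ≤ wt z).lt_or_eq with hlt | heq
          · rw [hkill z hlt]
            exact zero_mem _
          · rw [h.ext z (ε l) (hz.trans (h.src_idem l).symm) (heq.symm.trans (h.wt_idem l).symm)
              (hz'.trans (h.tgt_idem l).symm)]
            exact Submodule.mem_span_singleton_self _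
        · rw [map_zero]
          exact zero_mem _
      · rw [map_zero, zero_mul]
        exact zero_mem _
    | zero =>
      rw [map_zero, mul_zero, zero_mul]
      exact zero_mem _
    | add r s _ _ hr hs =>
      rw [map_add, mul_add, add_mul]
      exact add_mem hr hs
    | smul c r _ hr =>
      rw [map_smul, mul_smul_comm, smul_mul_assoc]
      exact Submodule.smul_mem _ _ hr
  · choose z c hc hsrc hwt htgt hz using fun ab : {x // wt x = l ∧ tgt x = l} ×
      {x // wt x = l ∧ src x = l} => hcell ab.1 ab.2 ab.1.2.1 ab.1.2.2 ab.2.2.1 ab.2.2.2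
    have hinj : Function.Injective z := by
      intro ab ab' hzz
      refine Prod.ext (Subtype.ext (h.ext _ _ ?_ ?_ ?_)) (Subtype.ext (h.ext _ _ ?_ ?_ ?_))
      · rw [← hsrc, ← hsrc, hzz]
      · rw [ab.1.2.1, ab'.1.2.1]
      · rw [ab.1.2.2, ab'.1.2.2]
      · rw [ab.2.2.2, ab'.2.2.2]
      · rw [ab.2.2.1, ab'.2.2.1]
      · rw [← htgt, ← htgt, hzz]
    rw [Fintype.linearIndependent_iff]
    intro g hg ab
    have h1 : ∑ ab, g ab • (v ab.1 * v ab.2) ∈ I := by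
      rw [← hker, map_sum, ← hg]
      simp only [map_smul, map_mul]
    have h2 : ∑ ab, g ab • (v ab.1 * v ab.2 - c ab • v (z ab)) ∈ I :=
      I.sum_mem fun ab _ => by
        rw [Algebra.smul_def]
        exact I.mul_mem_left _ (hz ab)
    have h3 : ∑ ab, (g ab * c ab) • v (z ab) ∈ I := by
      have := I.sub_mem h1 h2
      rw [← Finset.sum_sub_distrib] at this
      convert this using 2 with ab
      rw [smul_sub, sub_sub_cancel, smul_smul]
    rw [hI, Basis.mem_span_image] at h3
    have h4 : v.repr (∑ ab, (g ab * c ab) • v (z ab)) (z ab) = g ab * c ab := by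
      rw [map_sum, Finsupp.finsetSum_apply, Finset.sum_eq_single ab]
      · simp
      · intro ab' _ hne
        simp [hinj.ne hne]
      · simp
    by_contra hne
    have h5 : z ab ∈ (v.repr (∑ ab, (g ab * c ab) • v (z ab))).support := by
      rw [Finsupp.mem_support_iff, h4]
      exact mul_ne_zero hne (hc ab)
    have h6 : l < wt (z ab) := h3 h5
    exact h6.ne (hwt ab).symm

theorem isPositivelyGradedQuasiHereditary [Fintype X] (h : IsCellBasis v deg src wt tgt ε) :
    IsPositivelyGradedQuasiHereditary k (grading v deg) := by
  classical
  let σ : Fin (Fintype.card W) ≃o Wᵒᵈ :=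
    Fintype.orderIsoFinOfCardEq Wᵒᵈ rfl
  let U : ℕ → Set W := fun i => {w | ((σ.symm (OrderDual.toDual w) : Fin _) : ℕ) < i}
  have hU : ∀ i, IsUpperSet (U i) := by
    intro i a b hab ha
    have h1 : σ.symm (OrderDual.toDual b) ≤ σ.symm (OrderDual.toDual a) :=
      σ.symm.monotone (OrderDual.toDual_le_toDual.2 hab)
    change (σ.symm (OrderDual.toDual a) : ℕ) < i at ha
    exact lt_of_le_of_lt (Fin.le_def.1 h1) ha
  have hU' : ∀ (i : Fin (Fintype.card W)) (w : W),
      (w ∈ U i ↔ OrderDual.ofDual (σ i) < w) ∧ (w ∈ U (i + 1) ↔ OrderDual.ofDual (σ i) ≤ w) := by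
    intro i w
    have e1 : OrderDual.ofDual (σ i) < w ↔ σ.symm (OrderDual.toDual w) < i := by
      rw [← OrderDual.toDual_lt_toDual, ← σ.symm.lt_iff_lt]
      simp
    have e2 : OrderDual.ofDual (σ i) ≤ w ↔ σ.symm (OrderDual.toDual w) ≤ i := by
      rw [← OrderDual.toDual_le_toDual, ← σ.symm.le_iff_le]
      simp
    rw [e1, e2]
    exact ⟨Iff.rfl, Nat.lt_succ_iff⟩
  refine ⟨Module.Basis.finiteDimensional_of_finite v, h.gradedAlgebra, h.isSemisimpleRing,
    Fintype.card W, fun i => cellIdeal v wt (U i), fun i => h.isTwoSided_cellIdeal (hU i),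
    ?_, ?_, ?_, ?_, ?_⟩
  · refine Fin.strictMono_iff_lt_succ.2 fun i => lt_of_le_of_ne (cellIdeal_mono fun w hw => ?_) ?_
    · exact Nat.lt_succ_of_lt hw
    · intro heq
      have h1 : v (ε (OrderDual.ofDual (σ i))) ∈ cellIdeal v wt (U i.succ) := by
        rw [h.idem_mem_cellIdeal (hU _), Fin.val_succ, (hU' i _).2]
      rw [← heq, h.idem_mem_cellIdeal (hU _), Fin.val_castSucc, (hU' i _).1] at h1
      exact lt_irrefl _ h1
  · rw [eq_bot_iff]
    refine Ideal.span_le.2 ?_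
    rintro _ ⟨x, hx, rfl⟩
    exact absurd hx (Nat.not_lt_zero _)
  · rw [eq_top_iff]
    intro r _
    rw [h.mem_cellIdeal (hU _)]
    have : {x | wt x ∈ U (Fin.last (Fintype.card W))} = Set.univ :=
      Set.eq_univ_of_forall fun x => (σ.symm (OrderDual.toDual (wt x))).2
    rw [this, Set.image_univ, v.span_eq]
    trivial
  · intro i
    let := h.gradedAlgebra
    refine Ideal.homogeneous_span _ _ ?_
    rintro _ ⟨x, -, rfl⟩
    exact ⟨deg x, mem_grading v deg x⟩
  · intro i
    have := h.isTwoSided_cellIdeal (hU i.castSucc)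
    refine h.isHeredityIdeal (OrderDual.ofDual (σ i)) _ _ (fun r => ?_) (fun r => ?_)
      (h.isTwoSided_cellIdeal (hU i.succ))
    · rw [h.mem_cellIdeal (hU _)]
      simp only [Fin.val_castSucc, (hU' i _).1]
    · rw [h.mem_cellIdeal (hU _)]
      simp only [Fin.val_succ, (hU' i _).2]

end IsCellBasis

/-! ### Associativity by degeneration -/

/-- An associative unital bilinear multiplication on a vector space. -/
structure BilinearProduct (k M : Type*) [Field k] [AddCommGroup M] [Module k M] where
  mul : M →ₗ[k] M →ₗ[k] M
  one : M
  assoc : ∀ f g h, mul (mul f g) h = mul f (mul g h)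
  one_mul : ∀ f, mul one f = f
  mul_one : ∀ f, mul f one = f

namespace BilinearProduct

variable {k M : Type*} [Field k] [AddCommGroup M] [Module k M]

/-- The algebra defined by a multiplication. -/
def Carrier (_ : BilinearProduct k M) : Type _ := M

variable (P : BilinearProduct k M)

instance : AddCommGroup P.Carrier := inferInstanceAs (AddCommGroup M)

instance : Module k P.Carrier := inferInstanceAs (Module k M)

/-- The identity map to the algebra. -/
def equiv : M ≃ₗ[k] P.Carrier := LinearEquiv.refl k M

instance : Ring P.Carrier where
  __ := (inferInstance : AddCommGroup P.Carrier)
  mul f g := P.equiv (P.mul (P.equiv.symm f) (P.equiv.symm g))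
  one := P.equiv P.one
  mul_assoc f g h := P.assoc f g h
  one_mul f := P.one_mul f
  mul_one f := P.mul_one f
  left_distrib f g h := map_add (P.mul f) g h
  right_distrib f g h := LinearMap.map_add₂ P.mul f g h
  zero_mul f := LinearMap.map_zero₂ P.mul f
  mul_zero f := map_zero (P.mul f)

instance : Algebra k P.Carrier :=
  Algebra.ofModule (fun r f g => LinearMap.map_smul₂ P.mul r f g) fun r f g => map_smul (P.mul f) r g

theorem equiv_mul (f g : M) : P.equiv (P.mul f g) = P.equiv f * P.equiv g := rfl

theorem equiv_one : P.equiv P.one = 1 := rfl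

end BilinearProduct

section Filtered

variable {k X R : Type*} [Field k]

/-- The bilinear map with given values at the basis vectors. -/
noncomputable def mulMap (K : X → X → X →₀ k) : (X →₀ k) →ₗ[k] (X →₀ k) →ₗ[k] X →₀ k :=
  Finsupp.linearCombination k fun x => Finsupp.linearCombination k (K x)

theorem mulMap_single (K : X → X → X →₀ k) (x y : X) :
    mulMap K (.single x 1) (.single y 1) = K x y := by
  simp [mulMap]

theorem mulMap_apply (K : X → X → X →₀ k) (f g : X →₀ k) :
    mulMap K f g = f.sum fun x r => g.sum fun y s => (r * s) • K x y := by
  rw [mulMap, Finsupp.linearCombination_apply, Finsupp.sum, LinearMap.sum_apply, Finsupp.sum]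
  refine Finset.sum_congr rfl fun x _ => ?_
  rw [LinearMap.smul_apply, Finsupp.linearCombination_apply, Finsupp.smul_sum]
  simp only [smul_smul]

theorem bilinear_mem {M : Type*} [AddCommGroup M] [Module k M]
    (D : (X →₀ k) →ₗ[k] (X →₀ k) →ₗ[k] M) (P : Submodule k M) {S T : Set X}
    (h : ∀ x ∈ S, ∀ y ∈ T, D (.single x 1) (.single y 1) ∈ P) {f g : X →₀ k}
    (hf : f ∈ Finsupp.supported k k S) (hg : g ∈ Finsupp.supported k k T) : D f g ∈ P := by
  rw [Finsupp.supported_eq_span_single] at hf hg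
  induction hf using Submodule.span_induction with
  | mem f hf =>
    obtain ⟨x, hx, rfl⟩ := hf
    induction hg using Submodule.span_induction with
    | mem g hg =>
      obtain ⟨y, hy, rfl⟩ := hg
      exact h x hx y hy
    | zero => simp
    | add g g' _ _ hg hg' =>
      rw [map_add]
      exact add_mem hg hg'
    | smul c g _ hg =>
      rw [map_smul]
      exact P.smul_mem c hg
  | zero => simp
  | add f f' _ _ hf hf' =>
    rw [LinearMap.map_add₂]
    exact add_mem hf hf'
  | smul c f _ hf =>
    rw [LinearMap.map_smul₂]
    exact P.smul_mem c hf

variable [Ring R] [Algebra k R]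

/-- The product `K` is the leading term of the multiplication of the algebra `R`, with respect to the
degree of the basis vectors `B x`. -/
structure IsLeadingTerm (B : (X →₀ k) →ₗ[k] R) (deg : X → ℕ) (K : X → X → X →₀ k) : Prop where
  injective : Function.Injective B
  homogeneous : ∀ x y, K x y ∈ Finsupp.supported k k {z | deg z = deg x + deg y}
  leading : ∀ x y, B (.single x 1) * B (.single y 1) - B (K x y) ∈
    (Finsupp.supported k k {z | deg z < deg x + deg y}).map B

variable {B : (X →₀ k) →ₗ[k] R} {deg : X → ℕ} {K : X → X → X →₀ k}

namespace IsLeadingTerm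

theorem eq_zero (h : IsLeadingTerm B deg K) {n : ℕ} {f : X →₀ k}
    (hf : f ∈ Finsupp.supported k k {z | deg z = n})
    (hB : B f ∈ (Finsupp.supported k k {z | deg z < n}).map B) : f = 0 := by
  obtain ⟨g, hg, hgf⟩ := hB
  have hfg := h.injective hgf
  subst hfg
  have := (Finsupp.disjoint_supported_supported (M := k) (R := k) (α := X)
    (s := {z | deg z = n}) (t := {z | deg z < n}) ?_).le_bot ⟨hf, hg⟩
  · exact this
  · exact Set.disjoint_left.2 fun z (hz : deg z = n) (hz' : deg z < n) => hz'.ne hz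

theorem eq_of_mul_eq (h : IsLeadingTerm B deg K) {x y : X} {f : X →₀ k}
    (hf : f ∈ Finsupp.supported k k {z | deg z = deg x + deg y})
    (hB : B (.single x 1) * B (.single y 1) = B f) : K x y = f := by
  have h1 := h.leading x y
  rw [hB, ← map_sub] at h1
  exact (sub_eq_zero.1 (h.eq_zero (sub_mem hf (h.homogeneous x y)) h1)).symm

theorem mul_mem (h : IsLeadingTerm B deg K) {n : ℕ} {S T : Set X}
    (hST : ∀ x ∈ S, ∀ y ∈ T, deg x + deg y < n) {f g : X →₀ k}
    (hf : f ∈ Finsupp.supported k k S) (hg : g ∈ Finsupp.supported k k T) :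
    B f * B g ∈ (Finsupp.supported k k {z | deg z < n}).map B := by
  refine bilinear_mem ((LinearMap.mul k R).compl₁₂ B B) _ (fun x hx y hy => ?_) hf hg
  have hlt := hST x hx y hy
  rw [LinearMap.compl₁₂_apply, LinearMap.mul_apply', ← sub_add_cancel (_ * _) (B (K x y))]
  refine add_mem ?_ ⟨_, ?_, rfl⟩
  · refine Submodule.map_mono (Finsupp.supported_mono fun z hz => ?_) (h.leading x y)
    exact lt_trans hz hlt
  · refine Finsupp.supported_mono (fun z hz => ?_) (h.homogeneous x y)
    exact lt_of_eq_of_lt hz hlt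

theorem mulMap_mem (h : IsLeadingTerm B deg K) {m n : ℕ} {f g : X →₀ k}
    (hf : f ∈ Finsupp.supported k k {z | deg z = m})
    (hg : g ∈ Finsupp.supported k k {z | deg z = n}) :
    mulMap K f g ∈ Finsupp.supported k k {z | deg z = m + n} := by
  refine bilinear_mem (mulMap K) _ (fun x hx y hy => ?_) hf hg
  rw [mulMap_single]
  change deg x = m at hx
  change deg y = n at hy
  subst hx hy
  exact h.homogeneous x y

theorem mul_sub_mem (h : IsLeadingTerm B deg K) {m n : ℕ} {f g : X →₀ k}
    (hf : f ∈ Finsupp.supported k k {z | deg z = m})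
    (hg : g ∈ Finsupp.supported k k {z | deg z = n}) :
    B f * B g - B (mulMap K f g) ∈ (Finsupp.supported k k {z | deg z < m + n}).map B := by
  refine bilinear_mem ((LinearMap.mul k R).compl₁₂ B B - (mulMap K).compr₂ B) _
    (fun x hx y hy => ?_) hf hg
  change deg x = m at hx
  change deg y = n at hy
  subst hx hy
  simpa [mulMap_single] using h.leading x y

theorem single_mem (deg : X → ℕ) (x : X) :
    (.single x 1 : X →₀ k) ∈ Finsupp.supported k k {z | deg z = deg x} :=
  Finsupp.single_mem_supported k 1 rfl

theorem assoc_single (h : IsLeadingTerm B deg K) (x y z : X) :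
    mulMap K (K x y) (.single z 1) = mulMap K (.single x 1) (K y z) := by
  have hx := single_mem (k := k) deg x
  have hz := single_mem (k := k) deg z
  have h1 := h.mul_sub_mem (h.homogeneous x y) hz
  have h2 := h.mul_sub_mem hx (h.homogeneous y z)
  obtain ⟨r, hr, hrB⟩ := h.leading x y
  obtain ⟨s, hs, hsB⟩ := h.leading y z
  have h3 := h.mul_mem (n := deg x + deg y + deg z)
    (fun u (hu : deg u < _) v (hv : deg v = _) => by omega) hr hz
  have h4 := h.mul_mem (n := deg x + deg y + deg z)
    (fun u (hu : deg u = _) v (hv : deg v < _) => by omega) hx hs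
  have h5 := h.mulMap_mem (h.homogeneous x y) hz
  have h6 := h.mulMap_mem hx (h.homogeneous y z)
  rw [← add_assoc] at h2 h6
  rw [hrB] at h3
  rw [hsB] at h4
  refine sub_eq_zero.1 (h.eq_zero (sub_mem h5 h6) ?_)
  have := sub_mem (add_mem h2 h4) (add_mem h1 h3)
  convert this using 1
  rw [map_sub]
  noncomm_ring

theorem assoc (h : IsLeadingTerm B deg K) (f g g' : X →₀ k) :
    mulMap K (mulMap K f g) g' = mulMap K f (mulMap K g g') := by
  have h1 : ∀ x y, (mulMap K).flip g' (K x y) = mulMap K (.single x 1) (mulMap K (.single y 1) g') := by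
    intro x y
    induction g' using Finsupp.induction_linear with
    | zero => simp
    | add f g hf hg => rw [map_add, LinearMap.add_apply, hf, hg, map_add, map_add]
    | single z c =>
      rw [LinearMap.flip_apply, ← mul_one c, ← smul_eq_mul, ← Finsupp.smul_single, map_smul,
        map_smul, map_smul, h.assoc_single, mulMap_single]
  have h2 : ∀ x, mulMap K (mulMap K (.single x 1) g) g' =
      mulMap K (.single x 1) (mulMap K g g') := by
    intro x
    induction g using Finsupp.induction_linear with
    | zero => simp
    | add f g hf hg => rw [map_add, LinearMap.map_add₂, hf, hg, LinearMap.map_add₂, map_add]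
    | single y c =>
      rw [← mul_one c, ← smul_eq_mul, ← Finsupp.smul_single, map_smul, LinearMap.map_smul₂,
        LinearMap.map_smul₂, map_smul, mulMap_single, ← h1, LinearMap.flip_apply]
  induction f using Finsupp.induction_linear with
  | zero => simp
  | add f f' hf hf' => simp only [LinearMap.map_add₂, hf, hf']
  | single x c =>
    rw [← mul_one c, ← smul_eq_mul, ← Finsupp.smul_single]
    simp only [LinearMap.map_smul₂, h2]

end IsLeadingTerm

end Filtered

namespace ArcAlgebra

/-! ### The deformed algebra -/

section Representation

variable {J : Set ℤ} {Λ : Set (J → Label)} {m n : ℤ} {p q : ℕ} {w₀ : J → Label}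

theorem OrientedCircleDiagram.ext' {x y : OrientedCircleDiagram Λ} (ha : x.a = y.a) (hl : x.l = y.l)
    (hb : x.b = y.b) : x = y := by
  cases x
  cases y
  simp_all

theorem finite_orientedCircleDiagram (hfin : Λ.Finite) : Finite (OrientedCircleDiagram Λ) := by
  have : Finite Λ := hfin
  refine Finite.of_injective (β := Λ × Λ × Λ) (fun x => (⟨x.a, x.a_mem⟩, ⟨x.l, x.l_mem⟩, ⟨x.b, x.b_mem⟩))
    fun x y h => ?_
  simp only [Prod.mk.injEq, Subtype.mk.injEq] at h
  exact OrientedCircleDiagram.ext' h.1 h.2.1 h.2.2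

/-- The order of the weights in a block. -/
noncomputable def weightKey (m n : ℤ) (p q : ℕ) (w : J → Label) :
    Lex (Set.Ico (m - (p : ℤ)) (n + q) → ℕ) :=
  lexKey (closure m n p q w)

/-- The matrix entry of a basis vector. -/
noncomputable def entry (m n : ℤ) (p q : ℕ) (w₀ : J → Label) (x : OrientedCircleDiagram Λ)
    (μ : J → Label) : ℂ :=
  thetaProd (activeSet m n p q w₀) (closure m n p q x.b) (closure m n p q μ) *
    loopFun psi (activeSet m n p q w₀) (closure m n p q w₀) (closure m n p q x.a)
      (closure m n p q x.b) (closure m n p q x.l) (closure m n p q μ)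

open Classical in
/-- The representation of `K_Λ` by its deformation, a product of matrix algebras. -/
noncomputable def rep (Λ : Set (J → Label)) (m n : ℤ) (p q : ℕ) (w₀ : J → Label) :
    KLambda Λ →ₗ[ℂ] (Λ → Matrix Λ Λ ℂ) :=
  Finsupp.linearCombination ℂ fun x μ =>
    Matrix.single ⟨x.a, x.a_mem⟩ ⟨x.b, x.b_mem⟩ (entry m n p q w₀ x μ)

/-- The products of the basis vectors of `K_Λ`. -/
noncomputable def structureConst (Λ : Set (J → Label)) [Finite (OrientedCircleDiagram Λ)] (m n : ℤ)
    (x y : OrientedCircleDiagram Λ) : KLambda Λ :=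
  Finsupp.equivFunOnFinite.symm fun z => (mulCoeff m n x y z : ℂ)

theorem structureConst_apply [Finite (OrientedCircleDiagram Λ)]
    (x y z : OrientedCircleDiagram Λ) : structureConst Λ m n x y z = mulCoeff m n x y z := rfl

theorem Truncation.mulCoeff_eq (h : Truncation Λ m n p q) {x y z : OrientedCircleDiagram Λ}
    (hxy : x.b = y.a) (ha : z.a = x.a) (hb : z.b = y.b) :
    mulCoeff m n x y z = khovanovCoeff (closure m n p q x.a) (closure m n p q x.l)
      (closure m n p q x.b) (closure m n p q y.l) (closure m n p q y.b) (closure m n p q z.l) := by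
  have hp := h.up x.l x.l_mem
  have hq := h.down x.l x.l_mem
  subst hp hq
  rw [mulCoeff, if_pos ⟨hxy, ha, hb⟩]

theorem mulCoeff_ne_zero {x y z : OrientedCircleDiagram Λ} (h : mulCoeff m n x y z ≠ 0) :
    x.b = y.a ∧ z.a = x.a ∧ z.b = y.b := by
  by_contra h'
  exact h (if_neg h')

theorem Truncation.fits_a (h : Truncation Λ m n p q) (hw₀ : w₀ ∈ Λ) (x : OrientedCircleDiagram Λ) :
    Fits (activeSet m n p q w₀) (closure m n p q w₀) (closure m n p q x.a) (closure m n p q x.l) :=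
  (h.sub_iff hw₀ x.a_mem x.l_mem).1 x.a_sub

theorem Truncation.fits_b (h : Truncation Λ m n p q) (hw₀ : w₀ ∈ Λ) (x : OrientedCircleDiagram Λ) :
    Fits (activeSet m n p q w₀) (closure m n p q w₀) (closure m n p q x.b) (closure m n p q x.l) :=
  (h.sub_iff hw₀ x.b_mem x.l_mem).1 x.b_sub

theorem Truncation.degree_eq (h : Truncation Λ m n p q) (hw₀ : w₀ ∈ Λ)
    (x : OrientedCircleDiagram Λ) {c : J → Label} (hc : c ∈ Λ) :
    (x.degree : ℤ) = (cupList (closure m n p q c)).length +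
      lineDegree (closure m n p q x.a) (closure m n p q x.b) (closure m n p q x.l) := by
  have h1 := cupDegree_add_cupDegree (h.compat hw₀ x.a_mem) (h.compat hw₀ x.b_mem)
    (h.fits_a hw₀ x) (h.fits_b hw₀ x)
  have h2 := two_mul_length_cupList (h.compat hw₀ x.b_mem)
  have h3 := two_mul_length_cupList (h.compat hw₀ hc)
  have h4 : (cupList (closure m n p q x.b)).length = (cupList (closure m n p q c)).length := by
    omega
  rw [h.cupDegree_closure x.a_mem x.l_mem x.a_sub, h.cupDegree_closure x.b_mem x.l_mem x.b_sub,
    h4] at h1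
  rw [OrientedCircleDiagram.degree, ← h1]
  push_cast
  rfl

theorem Truncation.weightKey_injOn (h : Truncation Λ m n p q) :
    Set.InjOn (weightKey m n p q) Λ := fun _ ha _ hb hab =>
  h.closure_injOn ha hb (lexKey_injective hab)

theorem Truncation.entry_self_ne_zero (h : Truncation Λ m n p q) (hw₀ : w₀ ∈ Λ)
    (x : OrientedCircleDiagram Λ) : entry m n p q w₀ x x.l ≠ 0 :=
  mul_ne_zero (thetaProd_ne_zero _ _ _)
    (loopFun_psi_self_ne_zero (h.fits_a hw₀ x) (h.fits_b hw₀ x))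

theorem Truncation.key_le_of_entry_ne_zero (h : Truncation Λ m n p q) (hw₀ : w₀ ∈ Λ)
    {x : OrientedCircleDiagram Λ} {μ : J → Label} (hx : entry m n p q w₀ x μ ≠ 0) :
    weightKey m n p q x.l ≤ weightKey m n p q μ :=
  lexKey_le (h.compat hw₀ x.a_mem) (h.compat hw₀ x.b_mem) (h.fits_a hw₀ x) (h.fits_b hw₀ x)
    (right_ne_zero_of_mul hx)

open Classical in
theorem rep_single (x : OrientedCircleDiagram Λ) (μ : Λ) :
    rep Λ m n p q w₀ (.single x 1) μ =
      Matrix.single ⟨x.a, x.a_mem⟩ ⟨x.b, x.b_mem⟩ (entry m n p q w₀ x μ) := by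
  rw [rep, Finsupp.linearCombination_single, one_smul]

open Classical in
theorem rep_apply [Fintype (OrientedCircleDiagram Λ)] (g : KLambda Λ) (μ a b : Λ) :
    rep Λ m n p q w₀ g μ a b =
      ∑ z : OrientedCircleDiagram Λ, if z.a = a ∧ z.b = b then g z * entry m n p q w₀ z μ else 0 := by
  rw [rep, Finsupp.linearCombination_apply, Finsupp.sum_fintype _ _ (by simp), Finset.sum_apply,
    Matrix.sum_apply]
  refine Finset.sum_congr rfl fun z _ => ?_
  rw [Pi.smul_apply, Matrix.smul_apply, Matrix.single_apply]
  simp only [Subtype.ext_iff, smul_eq_mul, mul_ite, mul_zero]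

variable [Finite (OrientedCircleDiagram Λ)]

/-- The representation is triangular. -/
theorem Truncation.exists_rep_ne_zero (h : Truncation Λ m n p q) (hw₀ : w₀ ∈ Λ) {g : KLambda Λ}
    {z : OrientedCircleDiagram Λ} (hz : g z ≠ 0) : ∃ z₀ : OrientedCircleDiagram Λ,
      weightKey m n p q z₀.l ≤ weightKey m n p q z.l ∧
        rep Λ m n p q w₀ g ⟨z₀.l, z₀.l_mem⟩ ⟨z.a, z.a_mem⟩ ⟨z.b, z.b_mem⟩ ≠ 0 := by
  classical
  have := Fintype.ofFinite (OrientedCircleDiagram Λ)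
  obtain ⟨z₀, hz₀, hmin⟩ := Finset.exists_min_image
    (Finset.univ.filter fun z' : OrientedCircleDiagram Λ => (z'.a = z.a ∧ z'.b = z.b) ∧ g z' ≠ 0)
    (fun z' => weightKey m n p q z'.l) ⟨z, by simpa using hz⟩
  simp only [Finset.mem_filter, Finset.mem_univ, true_and] at hz₀ hmin
  refine ⟨z₀, hmin z ⟨⟨rfl, rfl⟩, hz⟩, ?_⟩
  rw [rep_apply, Finset.sum_eq_single z₀]
  · rw [if_pos hz₀.1]
    exact mul_ne_zero hz₀.2 (h.entry_self_ne_zero hw₀ z₀)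
  · intro z' _ hne
    rw [ite_eq_right_iff]
    intro hab
    by_contra hne0
    obtain ⟨h1, h2⟩ := mul_ne_zero_iff.1 hne0
    have h3 := h.key_le_of_entry_ne_zero hw₀ h2
    have h4 := h.weightKey_injOn z'.l_mem z₀.l_mem (le_antisymm h3 (hmin z' ⟨hab, h1⟩))
    exact hne (OrientedCircleDiagram.ext' (hab.1.trans hz₀.1.1.symm) h4 (hab.2.trans hz₀.1.2.symm))
  · simp

theorem Truncation.rep_injective (h : Truncation Λ m n p q) (hw₀ : w₀ ∈ Λ) :
    Function.Injective (rep Λ m n p q w₀) := by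
  rw [← LinearMap.ker_eq_bot, LinearMap.ker_eq_bot']
  intro g hg
  ext z
  by_contra hz
  obtain ⟨z₀, -, h0⟩ := h.exists_rep_ne_zero hw₀ hz
  rw [hg] at h0
  exact h0 rfl

theorem Truncation.degree_of_structureConst_ne_zero (h : Truncation Λ m n p q) (hw₀ : w₀ ∈ Λ)
    {x y z : OrientedCircleDiagram Λ} (hz : structureConst Λ m n x y z ≠ 0) :
    z.degree = x.degree + y.degree := by
  rw [structureConst_apply, Nat.cast_ne_zero] at hz
  obtain ⟨hxy, ha, hb⟩ := mulCoeff_ne_zero hz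
  rw [h.mulCoeff_eq hxy ha hb] at hz
  have h1 := (khovanovCoeff_ne_zero (h.compat hw₀ x.a_mem) (h.compat hw₀ x.b_mem)
    (h.compat hw₀ y.b_mem) (h.fits_a hw₀ x) (h.fits_b hw₀ x) (hxy ▸ h.fits_a hw₀ y)
    (h.fits_b hw₀ y) hz).2.2
  have h2 := h.degree_eq hw₀ x x.b_mem
  have h3 := h.degree_eq hw₀ y x.b_mem
  have h4 := h.degree_eq hw₀ z x.b_mem
  rw [ha, hb] at h4
  rw [← hxy] at h3
  omega

/-- The product of two basis vectors is the leading term of their product in the deformed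
algebra. -/
theorem Truncation.exists_rep_mul [Fintype Λ] (h : Truncation Λ m n p q) (hw₀ : w₀ ∈ Λ)
    (x y : OrientedCircleDiagram Λ) :
    ∃ r ∈ Finsupp.supported ℂ ℂ {z : OrientedCircleDiagram Λ | z.degree < x.degree + y.degree},
      rep Λ m n p q w₀ (.single x 1) * rep Λ m n p q w₀ (.single y 1) =
        rep Λ m n p q w₀ (structureConst Λ m n x y + r) := by
  classical
  have := Fintype.ofFinite (OrientedCircleDiagram Λ)
  by_cases hxy : x.b = y.a
  swap
  · refine ⟨0, zero_mem _, ?_⟩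
    have h0 : structureConst Λ m n x y = 0 := by
      ext z
      rw [structureConst_apply, mulCoeff, if_neg fun h' => hxy h'.1]
      simp
    rw [h0, add_zero, map_zero]
    funext μ
    rw [Pi.mul_apply, rep_single, rep_single, Matrix.single_mul_single_of_ne]
    · rfl
    · simpa [Subtype.ext_iff] using hxy
  have hca := h.compat hw₀ x.a_mem
  have hcb := h.compat hw₀ x.b_mem
  have hcd := h.compat hw₀ y.b_mem
  obtain ⟨ρ, hρ, hmul⟩ := psi_mul_psi hca hcb hcd (h.fits_a hw₀ x) (h.fits_b hw₀ x)
    (hxy ▸ h.fits_a hw₀ y) (h.fits_b hw₀ y)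
  let r : KLambda Λ := Finsupp.equivFunOnFinite.symm fun z =>
    if z.a = x.a ∧ z.b = y.b then ρ (closure m n p q z.l) else 0
  have hr : ∀ z, r z = if z.a = x.a ∧ z.b = y.b then ρ (closure m n p q z.l) else 0 := fun _ => rfl
  refine ⟨r, fun z hz => ?_, ?_⟩
  · have hz := Finsupp.mem_support_iff.1 hz
    rw [hr] at hz
    split_ifs at hz with hab
    · obtain ⟨-, -, h1⟩ := hρ _ hz
      have h2 := h.degree_eq hw₀ x x.b_mem
      have h3 := h.degree_eq hw₀ y x.b_mem
      have h4 := h.degree_eq hw₀ z x.b_mem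
      rw [hab.1, hab.2] at h4
      rw [← hxy] at h3
      change z.degree < x.degree + y.degree
      omega
    · exact absurd rfl hz
  · funext μ
    ext a d
    have hval : (rep Λ m n p q w₀ (.single x 1) * rep Λ m n p q w₀ (.single y 1)) μ =
        Matrix.single ⟨x.a, x.a_mem⟩ ⟨y.b, y.b_mem⟩
          (entry m n p q w₀ x μ * entry m n p q w₀ y μ) := by
      have hb : (⟨y.a, y.a_mem⟩ : Λ) = ⟨x.b, x.b_mem⟩ := Subtype.ext hxy.symm
      rw [Pi.mul_apply, rep_single, rep_single, hb, Matrix.single_mul_single_same]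
    rw [hval, Matrix.single_apply, rep_apply]
    by_cases had : x.a = a ∧ y.b = d
    · rw [if_pos ⟨Subtype.ext had.1, Subtype.ext had.2⟩]
      have h1 := congrFun hmul (closure m n p q μ.1)
      rw [Finset.sum_apply] at h1
      have h2 : entry m n p q w₀ x μ * entry m n p q w₀ y μ =
          thetaProd (activeSet m n p q w₀) (closure m n p q y.b) (closure m n p q μ.1) *
            ∑ ν, (khovanovCoeff (closure m n p q x.a) (closure m n p q x.l)
              (closure m n p q x.b) (closure m n p q y.l) (closure m n p q y.b) ν + ρ ν : ℂ) *
              loopFun psi (activeSet m n p q w₀) (closure m n p q w₀) (closure m n p q x.a)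
                (closure m n p q y.b) ν (closure m n p q μ.1) := by
        refine Eq.trans ?_ (congrArg _ h1)
        simp only [entry, Pi.mul_apply, ← hxy]
        ring
      rw [h2, Finset.mul_sum]
      symm
      rw [← Finset.sum_filter]
      refine Finset.sum_of_injOn (fun z : OrientedCircleDiagram Λ => closure m n p q z.l) ?_
        (by simp) ?_ ?_
      · intro z hz z' hz' hzz
        have h3 := (Finset.mem_filter.1 hz).2
        have h4 := (Finset.mem_filter.1 hz').2
        exact OrientedCircleDiagram.ext' (h3.1.trans h4.1.symm)
          (h.closure_injOn z.l_mem z'.l_mem hzz) (h3.2.trans h4.2.symm)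
      · intro ν _ hν
        by_contra hne
        obtain ⟨hcoeff, hψ⟩ := mul_ne_zero_iff.1 (right_ne_zero_of_mul hne)
        have hfit : Fits (activeSet m n p q w₀) (closure m n p q w₀) (closure m n p q x.a) ν ∧
            Fits (activeSet m n p q w₀) (closure m n p q w₀) (closure m n p q y.b) ν := by
          by_cases h0 : ρ ν = 0
          · rw [h0, add_zero, Nat.cast_ne_zero] at hcoeff
            have := khovanovCoeff_ne_zero hca hcb hcd (h.fits_a hw₀ x) (h.fits_b hw₀ x)
              (hxy ▸ h.fits_a hw₀ y) (h.fits_b hw₀ y) hcoeff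
            exact ⟨this.1, this.2.1⟩
          · exact ⟨(hρ ν h0).1, (hρ ν h0).2.1⟩
        obtain ⟨w, hw, rfl⟩ := h.exists_closure_eq hw₀ x.a_mem hfit.1
          (fun v hv => down_of_loopFun_psi_ne_zero hca hcd hfit.1 hfit.2 hψ fun u hu =>
            closure_of_lt (lt_of_le_of_lt hu hv))
          (fun v hv hv' => up_of_le_of_loopFun_psi_ne_zero hca hcd hfit.1 hfit.2 hψ fun u hu =>
            closure_of_ge (le_trans hv hu) (le_trans hv' hu))
        refine hν ⟨⟨x.a, w, y.b, x.a_mem, hw, y.b_mem, (h.sub_iff hw₀ x.a_mem hw).2 hfit.1,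
          (h.sub_iff hw₀ y.b_mem hw).2 hfit.2⟩, ?_, rfl⟩
        simp [had]
      · intro z hz
        have h3 := (Finset.mem_filter.1 hz).2
        have h4 : z.a = x.a := h3.1.trans had.1.symm
        have h5 : z.b = y.b := h3.2.trans had.2.symm
        rw [Finsupp.add_apply, hr, if_pos ⟨h4, h5⟩, structureConst_apply, h.mulCoeff_eq hxy h4 h5,
          entry, h4, h5]
        ring
    · rw [if_neg fun h' => had ⟨congrArg Subtype.val h'.1, congrArg Subtype.val h'.2⟩]
      symm
      refine Finset.sum_eq_zero fun z _ => ?_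
      split_ifs with hz
      · have h1 : ¬ (z.a = x.a ∧ z.b = y.b) := fun h' =>
          had ⟨h'.1.symm.trans hz.1, h'.2.symm.trans hz.2⟩
        rw [Finsupp.add_apply, hr, if_neg h1, structureConst_apply, mulCoeff,
          if_neg fun h' => h1 h'.2]
        simp
      · rfl

theorem Truncation.isLeadingTerm [Fintype Λ] [DecidableEq Λ] (h : Truncation Λ m n p q) (hw₀ : w₀ ∈ Λ) :
    IsLeadingTerm (rep Λ m n p q w₀) OrientedCircleDiagram.degree (structureConst Λ m n) where
  injective := h.rep_injective hw₀
  homogeneous x y z hz := h.degree_of_structureConst_ne_zero hw₀ (Finsupp.mem_support_iff.1 hz)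
  leading x y := by
    obtain ⟨r, hr, hmul⟩ := h.exists_rep_mul hw₀ x y
    refine ⟨r, hr, ?_⟩
    rw [hmul, map_add, add_sub_cancel_left]

/-- The weights of the terms of a product are at least the weights of the factors. -/
theorem Truncation.key_le_of_mul [Fintype Λ] (h : Truncation Λ m n p q) (hw₀ : w₀ ∈ Λ)
    {x y z : OrientedCircleDiagram Λ} {g : KLambda Λ}
    (hg : rep Λ m n p q w₀ (.single x 1) * rep Λ m n p q w₀ (.single y 1) = rep Λ m n p q w₀ g)
    (hz : g z ≠ 0) : weightKey m n p q x.l ≤ weightKey m n p q z.l ∧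
      weightKey m n p q y.l ≤ weightKey m n p q z.l := by
  classical
  obtain ⟨z₀, hle, hne⟩ := h.exists_rep_ne_zero hw₀ hz
  rw [← hg, Pi.mul_apply, rep_single, rep_single] at hne
  have h1 : entry m n p q w₀ x z₀.l ≠ 0 := by
    intro h0
    simp [h0] at hne
  have h2 : entry m n p q w₀ y z₀.l ≠ 0 := by
    intro h0
    simp [h0] at hne
  exact ⟨(h.key_le_of_entry_ne_zero hw₀ h1).trans hle, (h.key_le_of_entry_ne_zero hw₀ h2).trans hle⟩

end Representation

/-! ### The cellular basis of `K_Λ` -/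

section CellBasis

variable {J : Set ℤ} {Λ : Set (J → Label)} {m n : ℤ} {p q : ℕ} {w₀ : J → Label}

theorem Truncation.sub_self (h : Truncation Λ m n p q) {a : J → Label} (ha : a ∈ Λ) : Sub a a :=
  (h.sub_iff ha ha ha).2 (h.compat ha ha).fits_self

theorem Truncation.cupDegree_self (h : Truncation Λ m n p q) {a : J → Label} (ha : a ∈ Λ) :
    cupDegree a a = 0 := by
  rw [← h.cupDegree_closure ha ha (h.sub_self ha), ArcAlgebra.cupDegree_self]

/-- The diagram `(a a a)`. -/
def Truncation.idem (h : Truncation Λ m n p q) (a : Λ) : OrientedCircleDiagram Λ :=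
  ⟨a, a, a, a.2, a.2, a.2, h.sub_self a.2, h.sub_self a.2⟩

theorem Truncation.degree_idem (h : Truncation Λ m n p q) (a : Λ) : (h.idem a).degree = 0 := by
  rw [OrientedCircleDiagram.degree, idem, h.cupDegree_self a.2]

theorem Truncation.eq_of_sub_of_cupDegree_eq_zero (h : Truncation Λ m n p q) {a l : J → Label}
    (ha : a ∈ Λ) (hl : l ∈ Λ) (hal : Sub a l) (h0 : cupDegree a l = 0) : l = a := by
  rw [← h.cupDegree_closure ha hl hal] at h0
  exact h.closure_injOn hl ha
    (eq_of_cupDegree_eq_zero (h.compat ha ha) ((h.sub_iff ha ha hl).1 hal) h0)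

theorem Truncation.eq_idem (h : Truncation Λ m n p q) {x : OrientedCircleDiagram Λ}
    (hx : x.degree = 0) : x = h.idem ⟨x.l, x.l_mem⟩ := by
  obtain ⟨h1, h2⟩ := Nat.add_eq_zero_iff.1 hx
  exact OrientedCircleDiagram.ext'
    (h.eq_of_sub_of_cupDegree_eq_zero x.a_mem x.l_mem x.a_sub h1).symm rfl
    (h.eq_of_sub_of_cupDegree_eq_zero x.b_mem x.l_mem x.b_sub h2).symm

theorem Truncation.entry_idem (h : Truncation Λ m n p q) (hw₀ : w₀ ∈ Λ) (a : Λ) {μ : J → Label}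
    (hμ : Fits (activeSet m n p q w₀) (closure m n p q w₀) (closure m n p q a.1)
      (closure m n p q μ)) : entry m n p q w₀ (h.idem a) μ = 1 :=
  thetaProd_mul_loopFun_self (h.compat hw₀ a.2) hμ

theorem Truncation.weightKey_le (h : Truncation Λ m n p q) {a l : J → Label} (ha : a ∈ Λ)
    (hl : l ∈ Λ) (hal : Sub a l) : weightKey m n p q a ≤ weightKey m n p q l := by
  refine h.key_le_of_entry_ne_zero ha (x := h.idem ⟨a, ha⟩) ?_
  rw [h.entry_idem ha ⟨a, ha⟩ ((h.sub_iff ha ha hl).1 hal)]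
  exact one_ne_zero

theorem Truncation.rep_idem_mul [Fintype Λ] (h : Truncation Λ m n p q) (hw₀ : w₀ ∈ Λ)
    {x : OrientedCircleDiagram Λ} {a : Λ} (hx : x.a = a) :
    rep Λ m n p q w₀ (.single (h.idem a) 1) * rep Λ m n p q w₀ (.single x 1) =
      rep Λ m n p q w₀ (.single x 1) := by
  classical
  funext μ
  have ha : (⟨x.a, x.a_mem⟩ : Λ) = a := Subtype.ext hx
  rw [Pi.mul_apply, rep_single, rep_single, ha]
  refine (Matrix.single_mul_single_same _ _ _ _ _).trans ?_
  by_cases h0 : entry m n p q w₀ x μ = 0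
  · rw [h0, mul_zero]
    rfl
  · rw [h.entry_idem hw₀ a (hx ▸ (fits_of_loopFun_ne_zero (right_ne_zero_of_mul h0)).1), one_mul]
    rfl

theorem Truncation.rep_mul_idem [Fintype Λ] (h : Truncation Λ m n p q) (hw₀ : w₀ ∈ Λ)
    {x : OrientedCircleDiagram Λ} {a : Λ} (hx : x.b = a) :
    rep Λ m n p q w₀ (.single x 1) * rep Λ m n p q w₀ (.single (h.idem a) 1) =
      rep Λ m n p q w₀ (.single x 1) := by
  classical
  funext μ
  have ha : (⟨x.b, x.b_mem⟩ : Λ) = a := Subtype.ext hx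
  rw [Pi.mul_apply, rep_single, rep_single, ha]
  refine (Matrix.single_mul_single_same _ _ _ _ _).trans ?_
  by_cases h0 : entry m n p q w₀ x μ = 0
  · rw [h0, zero_mul]
    rfl
  · rw [h.entry_idem hw₀ a (hx ▸ (fits_of_loopFun_ne_zero (right_ne_zero_of_mul h0)).2), mul_one]
    rfl

/-- The basis of `K_Λ`. -/
noncomputable def diagramBasis (P : BilinearProduct ℂ (KLambda Λ)) :
    Module.Basis (OrientedCircleDiagram Λ) ℂ P.Carrier :=
  Finsupp.basisSingleOne.map P.equiv

theorem span_diagramBasis (P : BilinearProduct ℂ (KLambda Λ)) (S : Set (OrientedCircleDiagram Λ)) :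
    Submodule.span ℂ (diagramBasis P '' S) = (Finsupp.supported ℂ ℂ S).map P.equiv.toLinearMap := by
  rw [Finsupp.supported_eq_span_single, Submodule.map_span, Set.image_image]
  congr 1

variable [Finite (OrientedCircleDiagram Λ)] [Fintype Λ]

open Classical in
theorem Truncation.structureConst_idem_left (h : Truncation Λ m n p q) (a : Λ)
    (x : OrientedCircleDiagram Λ) :
    structureConst Λ m n (h.idem a) x = if x.a = a then .single x 1 else 0 := by
  split_ifs with hx
  · refine (h.isLeadingTerm a.2).eq_of_mul_eq ?_ (h.rep_idem_mul a.2 hx)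
    rw [h.degree_idem, zero_add]
    exact Finsupp.single_mem_supported ℂ 1 rfl
  · ext z
    rw [structureConst_apply, mulCoeff, if_neg fun h' => hx h'.1.symm]
    simp

open Classical in
theorem Truncation.structureConst_idem_right (h : Truncation Λ m n p q) (a : Λ)
    (x : OrientedCircleDiagram Λ) :
    structureConst Λ m n x (h.idem a) = if x.b = a then .single x 1 else 0 := by
  split_ifs with hx
  · refine (h.isLeadingTerm a.2).eq_of_mul_eq ?_ (h.rep_mul_idem a.2 hx)
    rw [h.degree_idem, add_zero]
    exact Finsupp.single_mem_supported ℂ 1 rfl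
  · ext z
    rw [structureConst_apply, mulCoeff, if_neg fun h' => hx h'.1]
    simp

theorem Truncation.key_le_of_structureConst_ne_zero (h : Truncation Λ m n p q)
    {x y z : OrientedCircleDiagram Λ} (hz : structureConst Λ m n x y z ≠ 0) :
    weightKey m n p q x.l ≤ weightKey m n p q z.l ∧
      weightKey m n p q y.l ≤ weightKey m n p q z.l := by
  obtain ⟨r, hr, hmul⟩ := h.exists_rep_mul x.a_mem x y
  refine h.key_le_of_mul x.a_mem hmul ?_
  have hdeg := h.degree_of_structureConst_ne_zero x.a_mem hz
  rw [Finsupp.add_apply, (Finsupp.mem_supported' ℂ r).1 hr z hdeg.not_lt, add_zero]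
  exact hz

theorem Truncation.structureConst_ne_zero (h : Truncation Λ m n p q)
    {x y z : OrientedCircleDiagram Λ} (hyx : y.l = x.l) (hb : x.b = x.l) (ha : y.a = x.l)
    (hza : z.a = x.a) (hzl : z.l = x.l) (hzb : z.b = y.b) : structureConst Λ m n x y z ≠ 0 := by
  classical
  have := Fintype.ofFinite (OrientedCircleDiagram Λ)
  have hw₀ := x.l_mem
  obtain ⟨r, hr, hmul⟩ := h.exists_rep_mul hw₀ x y
  have hr0 : r z = 0 := by
    refine (Finsupp.mem_supported' ℂ r).1 hr z ((not_lt (α := ℕ)).2 ?_)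
    simp only [OrientedCircleDiagram.degree, hza, hzl, hzb, hb, ha, hyx, h.cupDegree_self x.l_mem]
    omega
  have hne : (rep Λ m n p q x.l (.single x 1) * rep Λ m n p q x.l (.single y 1)) ⟨x.l, x.l_mem⟩
      ⟨x.a, x.a_mem⟩ ⟨y.b, y.b_mem⟩ ≠ 0 := by
    have hab : (⟨y.a, y.a_mem⟩ : Λ) = ⟨x.b, x.b_mem⟩ := Subtype.ext (ha.trans hb.symm)
    rw [Pi.mul_apply, rep_single, rep_single, hab, Matrix.single_mul_single_same,
      Matrix.single_apply_same]
    refine mul_ne_zero (h.entry_self_ne_zero hw₀ x) ?_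
    have := h.entry_self_ne_zero hw₀ y
    rwa [hyx] at this
  rw [hmul, rep_apply, Finset.sum_eq_single z, if_pos ⟨hza, hzb⟩] at hne
  · have := left_ne_zero_of_mul hne
    rwa [Finsupp.add_apply, hr0, add_zero] at this
  · intro z' _ hz'
    rw [ite_eq_right_iff]
    intro hab
    by_contra h0
    obtain ⟨h1, h2⟩ := mul_ne_zero_iff.1 h0
    have h3 := (h.key_le_of_mul hw₀ hmul h1).1
    have h4 := h.key_le_of_entry_ne_zero hw₀ h2
    exact hz' (OrientedCircleDiagram.ext' (hab.1.trans hza.symm)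
      ((h.weightKey_injOn z'.l_mem x.l_mem (le_antisymm h4 h3)).trans hzl.symm)
      (hab.2.trans hzb.symm))
  · simp

/-- The multiplication of `K_Λ`. -/
noncomputable def Truncation.product (h : Truncation Λ m n p q) (hw₀ : w₀ ∈ Λ) :
    BilinearProduct ℂ (KLambda Λ) where
  mul := mulMap (structureConst Λ m n)
  one := ∑ a : Λ, .single (h.idem a) 1
  assoc := by
    classical
    exact (h.isLeadingTerm hw₀).assoc
  one_mul f := by
    classical
    have : mulMap (structureConst Λ m n) (∑ a : Λ, .single (h.idem a) 1) = LinearMap.id := by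
      ext1 x
      ext1
      simp only [LinearMap.comp_apply, Finsupp.lsingle_apply, map_sum, LinearMap.sum_apply,
        mulMap_single, h.structureConst_idem_left, LinearMap.id_apply]
      rw [Finset.sum_eq_single ⟨x.a, x.a_mem⟩]
      · exact if_pos rfl
      · exact fun a _ ha => if_neg fun h' => ha (Subtype.ext h'.symm)
      · simp
    rw [this, LinearMap.id_apply]
  mul_one f := by
    classical
    have : (mulMap (structureConst Λ m n)).flip (∑ a : Λ, .single (h.idem a) 1) = LinearMap.id := by
      ext1 x
      ext1
      simp only [LinearMap.comp_apply, Finsupp.lsingle_apply, map_sum, LinearMap.sum_apply,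
        LinearMap.flip_apply, mulMap_single, h.structureConst_idem_right, LinearMap.id_apply]
      rw [Finset.sum_eq_single ⟨x.b, x.b_mem⟩]
      · exact if_pos rfl
      · exact fun a _ ha => if_neg fun h' => ha (Subtype.ext h'.symm)
      · simp
    rw [← LinearMap.flip_apply, this, LinearMap.id_apply]

theorem Truncation.diagramBasis_mul (h : Truncation Λ m n p q) (hw₀ : w₀ ∈ Λ)
    (x y : OrientedCircleDiagram Λ) :
    diagramBasis (h.product hw₀) x * diagramBasis (h.product hw₀) y =
      (h.product hw₀).equiv (structureConst Λ m n x y) := by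
  rw [← mulMap_single (structureConst Λ m n), diagramBasis, Module.Basis.map_apply, Module.Basis.map_apply,
    ← BilinearProduct.equiv_mul, Finsupp.coe_basisSingleOne]
  rfl

theorem Truncation.diagramBasis_mul_mem (h : Truncation Λ m n p q) (hw₀ : w₀ ∈ Λ)
    {x y : OrientedCircleDiagram Λ} {S : Set (OrientedCircleDiagram Λ)}
    (hS : ∀ z, structureConst Λ m n x y z ≠ 0 → z ∈ S) :
    diagramBasis (h.product hw₀) x * diagramBasis (h.product hw₀) y ∈
      Submodule.span ℂ (diagramBasis (h.product hw₀) '' S) := by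
  rw [h.diagramBasis_mul, span_diagramBasis]
  exact ⟨_, fun z hz => hS z (Finsupp.mem_support_iff.1 hz), rfl⟩

/-- The total order of the block. -/
@[reducible]
noncomputable def Truncation.linearOrder (h : Truncation Λ m n p q) : LinearOrder Λ :=
  LinearOrder.lift' (fun w : Λ => weightKey m n p q w.1) fun a b hab =>
    Subtype.ext (h.weightKey_injOn a.2 b.2 hab)

theorem Truncation.isCellBasis (h : Truncation Λ m n p q) (hw₀ : w₀ ∈ Λ) :
    letI := h.linearOrder
    IsCellBasis (diagramBasis (h.product hw₀)) OrientedCircleDiagram.degree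
      (fun x => (⟨x.a, x.a_mem⟩ : Λ)) (fun x => ⟨x.l, x.l_mem⟩) (fun x => ⟨x.b, x.b_mem⟩) h.idem := by
  let := h.linearOrder
  have hv : ∀ x, diagramBasis (h.product hw₀) x = (h.product hw₀).equiv (.single x 1) := by
    simp [diagramBasis]
  exact {
    ext := fun x y ha hl hb => OrientedCircleDiagram.ext' (congrArg Subtype.val ha)
      (congrArg Subtype.val hl) (congrArg Subtype.val hb)
    src_idem := fun _ => rfl
    wt_idem := fun _ => rfl
    tgt_idem := fun _ => rfl
    deg_idem := h.degree_idem
    eq_idem := fun x => h.eq_idem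
    sum_idem := by
      simp only [hv, ← map_sum]
      exact (h.product hw₀).equiv_one
    idem_mul := fun a x => by
      rw [h.diagramBasis_mul, h.structureConst_idem_left, apply_ite (h.product hw₀).equiv, map_zero,
        hv]
      by_cases hx : x.a = a
      · exact (if_pos hx).trans (if_pos (Subtype.ext hx)).symm
      · exact (if_neg hx).trans (if_neg fun h' => hx (congrArg Subtype.val h')).symm
    mul_idem := fun a x => by
      rw [h.diagramBasis_mul, h.structureConst_idem_right, apply_ite (h.product hw₀).equiv, map_zero,
        hv]
      by_cases hx : x.b = a
      · exact (if_pos hx).trans (if_pos (Subtype.ext hx)).symm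
      · exact (if_neg hx).trans (if_neg fun h' => hx (congrArg Subtype.val h')).symm
    mul_deg := fun x y => h.diagramBasis_mul_mem hw₀ fun _ =>
      h.degree_of_structureConst_ne_zero hw₀
    mul_wt := fun x y => h.diagramBasis_mul_mem hw₀ fun _ => h.key_le_of_structureConst_ne_zero
    src_le := fun x => h.weightKey_le x.a_mem x.l_mem x.a_sub
    tgt_le := fun x => h.weightKey_le x.b_mem x.l_mem x.b_sub
    mul_cell := fun x y hyx hb ha => by
      have hyx : y.l = x.l := congrArg Subtype.val hyx
      have hb : x.b = x.l := congrArg Subtype.val hb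
      have ha : y.a = x.l := congrArg Subtype.val ha
      let z : OrientedCircleDiagram Λ :=
        ⟨x.a, x.l, y.b, x.a_mem, x.l_mem, y.b_mem, x.a_sub, hyx ▸ y.b_sub⟩
      refine ⟨z, _, h.structureConst_ne_zero hyx hb ha (z := z) rfl rfl rfl, rfl, rfl, rfl, ?_⟩
      rw [h.diagramBasis_mul, hv, ← map_smul, ← map_sub, span_diagramBasis]
      refine ⟨_, fun z' hz' => ?_, rfl⟩
      have hz' := Finsupp.mem_support_iff.1 hz'
      rw [Finsupp.sub_apply, Finsupp.smul_apply] at hz'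
      have hzz : z' ≠ z := by
        rintro rfl
        simp at hz'
      rw [Finsupp.single_eq_of_ne hzz, smul_zero, sub_zero] at hz'
      refine lt_of_le_of_ne (h.key_le_of_structureConst_ne_zero hz').1 fun hl => hzz ?_
      rw [structureConst_apply, Nat.cast_ne_zero] at hz'
      obtain ⟨-, h1, h2⟩ := mulCoeff_ne_zero hz'
      exact OrientedCircleDiagram.ext' h1
        (h.weightKey_injOn x.l_mem z'.l_mem hl).symm h2
    exists_cell := fun z =>
      ⟨⟨z.a, z.l, z.l, z.a_mem, z.l_mem, z.l_mem, z.a_sub, h.sub_self z.l_mem⟩,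
        ⟨z.l, z.l, z.b, z.l_mem, z.l_mem, z.b_mem, h.sub_self z.l_mem, z.b_sub⟩,
        ⟨rfl, rfl, rfl⟩, rfl, rfl, rfl⟩ }

end CellBasis

end ArcAlgebra

theorem corollary5p4 (J : Set ℤ) (hJ : J.OrdConnected) (Λ : Set (J → ArcAlgebra.Label))
    (hΛ : ArcAlgebra.IsBlock Λ) (hfin : Λ.Finite) :
    ∃ (A : Type) (_ : Ring A) (_ : Algebra ℂ A) (e : ArcAlgebra.KLambda Λ ≃ₗ[ℂ] A),
      (∀ f g, e (ArcAlgebra.KLambda.mul hJ hΛ hfin f g) = e f * e g) ∧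
      IsPositivelyGradedQuasiHereditary ℂ fun k => (ArcAlgebra.degreePart Λ k).map e.toLinearMap := by
  classical
  have hw₀ : ∃ w₀, w₀ ∈ Λ := by
    obtain ⟨w₀, -, rfl⟩ := hΛ
    exact ⟨w₀, .refl w₀⟩
  obtain ⟨w₀, hw₀⟩ := hw₀
  have hW := (ArcAlgebra.exists_isWindow hJ hΛ hfin).choose_spec
  have hT : ArcAlgebra.Truncation Λ _ _ _ _ := ⟨hΛ, hW, fun w hw => hW.count_eq hΛ hw hw₀ .up,
    fun w hw => hW.count_eq hΛ hw hw₀ .down⟩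
  have := ArcAlgebra.finite_orientedCircleDiagram hfin
  have := Fintype.ofFinite (ArcAlgebra.OrientedCircleDiagram Λ)
  have := hfin.fintype
  refine ⟨(hT.product hw₀).Carrier, inferInstance, inferInstance, (hT.product hw₀).equiv,
    fun f g => ?_, ?_⟩
  · rw [← BilinearProduct.equiv_mul]
    refine congrArg _ ?_
    refine Eq.trans ?_ (mulMap_apply _ f g).symm
    refine Finset.sum_congr rfl fun x _ => Finset.sum_congr rfl fun y _ => ?_
    beta_reduce
    rw [finsum_eq_sum_of_fintype]
    ext z
    rw [Finsupp.finsetSum_apply, Finset.sum_eq_single z]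
    · rw [Finsupp.single_eq_same]
      rfl
    · exact fun z' _ hz' => Finsupp.single_eq_of_ne hz'.symm
    · simp
  · let := hT.linearOrder
    have := (hT.isCellBasis hw₀).isPositivelyGradedQuasiHereditary
    convert this using 1
    funext k
    exact (ArcAlgebra.span_diagramBasis _ _).symm
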